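/- Let $n\le 3$ be a nonnegative integer with $n\neq 1$, and let $G$ be an acyclic directed graph with vertex set $[n]=\{1,\dots,n\}$ (a Bayesian network on $n$ binary random variables). Let $\mathbb P^{2^n-1}$ be the complex projective space with homogeneous coordinates $p_j$, $j=(j_1,\dots,j_n)\in\{1,2\}^n$. For a closed set $Z\subseteq\mathbb P^{2^n-1}$ let $Z^\circ$ denote the union of the irreducible components of $Z$ that are contained neither in a hyperplane $\{p_j=0\}$ nor in the hyperplane $\{\sum_j p_j=0\}$; equivalently, $Z^\circ$ is the Zariski closure of the part of $Z$ outside all these hyperplanes. Let $\mathcal C$ be the set of all conditional independence statements $A\perp\!\!\!\perp B\mid C$, with $A,B,C\subseteq[n]$ pairwise disjoint and $A$, $B$ d-separated by $C$ in $G$ (global Markov property). The model is $\mathcal M_{\mathcal C}=Z^\circ$, where $Z$ is the common zero set of the quadrics $p_{abc+}\,p_{a'b'c+}-p_{ab'c+}\,p_{a'bc+}$ for all statements $A\perp\!\!\!\perp B\mid C$ in $\mathcal C$ and all states $a,a'$ of $A$, $b,b'$ of $B$, $c$ of $C$. Here $+$ means that all variables outside $A\cup B\cup C$ are summed out. For a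 game $X=(X^{(1)},\dots,X^{(n)})$ with real payoff tables $X^{(i)}=(X^{(i)}_j)_{j\in\{1,2\}^n}$, the Spohn variety $\mathcal V_X\subseteq\mathbb P^{2^n-1}$ is defined by $\det M_1=\dots=\det M_n=0$, where $M_i$ is the $2\times2$ matrix whose $k$-th row is $\bigl(\sum_{j:\,j_i=k}p_j,\ \sum_{j:\,j_i=k}X^{(i)}_jp_j\bigr)$. The Spohn CI variety is $\mathcal V_{X,\mathcal C}=(\mathcal V_X\cap\mathcal M_{\mathcal C})^\circ$. Then for generic $X$, i.e. for all $X\in(\mathbb R^{2^n})^n$ outside the zero set of some nonzero real polynomial in the payoffs (which may depend on $G$), the variety $\mathcal V_{X,\mathcal C}$ is nonempty and has the expected codimension $n$ inside $\mathcal M_{\mathcal C}$, that is, $\dim\mathcal V_{X,\mathcal C}=\dim\mathcal M_{\mathcal C}-n$. Moreover, if $G$ has at least one edge, then $\mathcal V_{X,\mathcal C}$ is positive-dimensional and irreducible. -/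

import Mathlib

open scoped LinearAlgebra.Projectivization

noncomputable section

namespace SpohnCI

/-! ### Complex projective space with its Zariski topology -/

/-- The complex projective space whose homogeneous coordinates are indexed by `σ`. -/
def PSpace (σ : Type) : Type := ℙ ℂ (σ → ℂ)

variable {σ : Type}

/-- A nonzero coordinate vector representing a point. -/
def PSpace.coords (P : PSpace σ) : σ → ℂ := Projectivization.rep P

theorem PSpace.coords_ne_zero (P : PSpace σ) : P.coords ≠ 0 := Projectivization.rep_nonzero P

/-- The point with homogeneous coordinates `v`. -/
def PSpace.mk (v : σ → ℂ) (hv : v ≠ 0) : PSpace σ := Projectivization.mk ℂ v hv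

/-- The common zero set of a family of polynomials.  It is used for homogeneous polynomials only,
and for these it does not depend on the representatives, see `mk_mem_zeros`. -/
def zeros (S : Set (MvPolynomial σ ℂ)) : Set (PSpace σ) :=
  {P | ∀ f ∈ S, MvPolynomial.eval P.coords f = 0}

theorem mk_mem_zeros {S : Set (MvPolynomial σ ℂ)} (hS : ∀ f ∈ S, ∃ d, f.IsHomogeneous d)
    (v : σ → ℂ) (hv : v ≠ 0) :
    PSpace.mk v hv ∈ zeros S ↔ ∀ f ∈ S, MvPolynomial.eval v f = 0 := by
  obtain ⟨a, ha⟩ := Projectivization.exists_smul_eq_mk_rep ℂ v hv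
  have hc : (PSpace.mk v hv).coords = (a : ℂ) • v := ha.symm
  refine forall₂_congr fun f hf => ?_
  obtain ⟨d, hd⟩ := hS f hf
  have h : MvPolynomial.eval ((a : ℂ) • v) f = (a : ℂ) ^ d * MvPolynomial.eval v f := by
    rw [MvPolynomial.eval_eq, MvPolynomial.eval_eq, Finset.mul_sum]
    refine Finset.sum_congr rfl fun m hm => ?_
    have hdeg : ∑ i ∈ m.support, m i = d := by
      have := hd (MvPolynomial.mem_support_iff.mp hm)
      simpa [Finsupp.weight_apply, Finsupp.sum] using this
    simp only [Pi.smul_apply, smul_eq_mul, mul_pow, Finset.prod_mul_distrib,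
      Finset.prod_pow_eq_pow_sum, hdeg]
    ring
  rw [hc, h]
  simp

/-- The Zariski topology: the closed sets are the zero sets of families of homogeneous
polynomials. -/
instance zariskiTopology : TopologicalSpace (PSpace σ) :=
  TopologicalSpace.ofClosed
    {Z | ∃ S : Set (MvPolynomial σ ℂ), (∀ f ∈ S, ∃ d, f.IsHomogeneous d) ∧ Z = zeros S}
    ⟨{1}, by
      rintro f rfl
      exact ⟨0, MvPolynomial.isHomogeneous_one σ ℂ⟩, by
      ext P
      simp [zeros]⟩
    (by
      intro A hA
      refine ⟨{f | (∃ d, f.IsHomogeneous d) ∧ ∃ Z ∈ A, ∀ P ∈ Z,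
        MvPolynomial.eval (PSpace.coords P) f = 0}, fun f hf => hf.1, ?_⟩
      ext P
      constructor
      · rintro hP f ⟨-, Z, hZ, h⟩
        exact h P (hP Z hZ)
      · intro hP Z hZ
        obtain ⟨S, hS, rfl⟩ := hA hZ
        exact fun f hf => hP f ⟨hS f hf, _, hZ, fun Q hQ => hQ f hf⟩)
    (by
      rintro _ ⟨S, hS, rfl⟩ _ ⟨T, hT, rfl⟩
      refine ⟨{h | ∃ f ∈ S, ∃ g ∈ T, h = f * g}, ?_, ?_⟩
      · rintro _ ⟨f, hf, g, hg, rfl⟩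
        obtain ⟨d, hd⟩ := hS f hf
        obtain ⟨e, he⟩ := hT g hg
        exact ⟨d + e, hd.mul he⟩
      · ext P
        constructor
        · rintro (hP | hP) _ ⟨f, hf, g, hg, rfl⟩
          · simp [hP f hf]
          · simp [hP g hg]
        · intro hP
          by_contra hcon
          simp only [Set.mem_union, not_or, zeros, Set.mem_ofPred_eq, not_forall] at hcon
          obtain ⟨⟨f, hf, hf0⟩, ⟨g, hg, hg0⟩⟩ := hcon
          have := hP _ ⟨f, hf, g, hg, rfl⟩
          simp only [map_mul, mul_eq_zero] at this
          tauto)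

theorem isClosed_iff (Z : Set (PSpace σ)) : IsClosed Z ↔
    ∃ S : Set (MvPolynomial σ ℂ), (∀ f ∈ S, ∃ d, f.IsHomogeneous d) ∧ Z = zeros S := by
  rw [← isOpen_compl_iff]
  change Zᶜᶜ ∈ _ ↔ _
  rw [compl_compl]
  rfl

/-- The punctured affine cone over a set of points. -/
def cone (V : Set (PSpace σ)) : Set (σ → ℂ) := {v | ∃ hv : v ≠ 0, PSpace.mk v hv ∈ V}

/-- The homogeneous vanishing ideal of `V` (the unit ideal if `V` is empty). -/
def homogeneousIdeal (V : Set (PSpace σ)) : Ideal (MvPolynomial σ ℂ) :=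
  MvPolynomial.vanishingIdeal ℂ (cone V)

/-- `V` is nonempty and has dimension `d` as a projective variety: its homogeneous coordinate
ring has Krull dimension `d + 1`. -/
def HasDim (V : Set (PSpace σ)) (d : ℕ) : Prop :=
  ringKrullDim (MvPolynomial σ ℂ ⧸ homogeneousIdeal V) = ((d + 1 : ℕ) : WithBot ℕ∞)

/-! ### Games with binary choices and the Spohn variety -/

/-- The joint states of `n` binary random variables (joint pure strategies of `n` players). -/
abbrev State (n : ℕ) : Type := Fin n → Fin 2

/-- The unknown `p_j`. -/
abbrev p {n : ℕ} (j : State n) : MvPolynomial (State n) ℂ := MvPolynomial.X j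

/-- The matrix `M_i(P)` of the game with payoff tables `X 0, …, X (n - 1)`.  Row `k` consists of
the probability that player `i` chooses `k`, and of the numerator of the payoff that player `i`
expects conditionally on this choice. -/
def spohnMatrix {n : ℕ} (X : Fin n → State n → ℝ) (i : Fin n) :
    Matrix (Fin 2) (Fin 2) (MvPolynomial (State n) ℂ) :=
  Matrix.of fun k => ![∑ j : State n with j i = k, p j,
    ∑ j : State n with j i = k, MvPolynomial.C (X i j : ℂ) * p j]

/-- The Spohn variety of a game with binary choices. -/
def spohnVariety {n : ℕ} (X : Fin n → State n → ℝ) : Set (PSpace (State n)) :=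
  zeros {f | ∃ i, f = (spohnMatrix X i).det}

/-! ### Conditional independence models -/

/-- A conditional independence statement `A ⊥⊥ B | C` on `n` random variables. -/
structure CIStatement (n : ℕ) where
  A : Finset (Fin n)
  B : Finset (Fin n)
  C : Finset (Fin n)
  disjoint_AB : Disjoint A B
  disjoint_AC : Disjoint A C
  disjoint_BC : Disjoint B C

/-- The marginal: the sum of the `p_y` over all states `y` that agree with `x` on `S`. -/
def marginal {n : ℕ} (S : Finset (Fin n)) (x : State n) : MvPolynomial (State n) ℂ :=
  ∑ y : State n with ∀ i ∈ S, y i = x i, p y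

/-- The quadrics of `A ⊥⊥ B | C`.  With `a, b` the restrictions of `x` to `A, B`, with `a', b'`
those of `y`, and with `c` the common restriction of `x` and `y` to `C`, they are
`p_{abc} p_{a'b'c} - p_{ab'c} p_{a'bc}`, where all variables outside of `A ∪ B ∪ C` are
summed out. -/
def CIStatement.quadrics {n : ℕ} (s : CIStatement n) : Set (MvPolynomial (State n) ℂ) :=
  {f | ∃ x y : State n, (∀ i ∈ s.C, x i = y i) ∧
    f = marginal (s.A ∪ s.B ∪ s.C) x * marginal (s.A ∪ s.B ∪ s.C) y -
      marginal (s.A ∪ s.B ∪ s.C) (s.A.piecewise x y) *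
        marginal (s.A ∪ s.B ∪ s.C) (s.A.piecewise y x)}

/-- The points outside of all hyperplanes `p_j = 0` and of the hyperplane `∑ j, p_j = 0`. -/
def offHyperplanes (n : ℕ) : Set (PSpace (State n)) :=
  {P | (∀ j, P.coords j ≠ 0) ∧ ∑ j, P.coords j ≠ 0}

/-- For a closed set `Z`, the union of those irreducible components of `Z` that do not lie in one
of the hyperplanes `p_j = 0`, `∑ j, p_j = 0`; that is, the Zariski closure of the part of `Z`
outside of these hyperplanes (the variety of the saturated ideal). -/
def removeSpecial {n : ℕ} (Z : Set (PSpace (State n))) : Set (PSpace (State n)) :=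
  closure (Z ∩ offHyperplanes n)

/-- The model of a collection of conditional independence statements. -/
def ciModel {n : ℕ} (𝒞 : Set (CIStatement n)) : Set (PSpace (State n)) :=
  removeSpecial (zeros (⋃ s ∈ 𝒞, s.quadrics))

/-- The Spohn CI variety. -/
def spohnCIVariety {n : ℕ} (X : Fin n → State n → ℝ) (𝒞 : Set (CIStatement n)) :
    Set (PSpace (State n)) :=
  removeSpecial (spohnVariety X ∩ ciModel 𝒞)

/-! ### Bayesian networks -/

/-- A directed graph without directed cycles (in particular without loops). -/
def IsAcyclic {n : ℕ} (G : Digraph (Fin n)) : Prop := ∀ v, ¬ Relation.TransGen G.Adj v v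

/-- `l` is a path from `a` to `b` in the underlying undirected graph: its vertices are distinct
and consecutive ones are joined by an edge, in either direction. -/
def IsPath {n : ℕ} (G : Digraph (Fin n)) (a b : Fin n) (l : List (Fin n)) : Prop :=
  l.Nodup ∧ l.IsChain (fun u v => G.Adj u v ∨ G.Adj v u) ∧ l.head? = some a ∧ l.getLast? = some b

/-- The path `l` is blocked by `C`: it has an inner vertex `v`, with neighbours `u` and `w` on the
path, such that either `v` lies in `C` and the edges do not meet head-to-head at `v`, or they meet
head-to-head at `v` and neither `v` nor a descendant of `v` lies in `C`. -/
def IsBlocked {n : ℕ} (G : Digraph (Fin n)) (C : Finset (Fin n)) (l : List (Fin n)) : Prop :=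
  ∃ u v w, [u, v, w] <:+: l ∧
    ((v ∈ C ∧ ¬ (G.Adj u v ∧ G.Adj w v)) ∨
      ((G.Adj u v ∧ G.Adj w v) ∧ ∀ c ∈ C, ¬ Relation.ReflTransGen G.Adj v c))

/-- The global Markov property: all statements `A ⊥⊥ B | C` such that `C` d-separates `A` and `B`,
i.e. `C` blocks every path from a vertex of `A` to a vertex of `B`. -/
def globalMarkov {n : ℕ} (G : Digraph (Fin n)) : Set (CIStatement n) :=
  {s | ∀ a ∈ s.A, ∀ b ∈ s.B, ∀ l, IsPath G a b l → IsBlocked G s.C l}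

end SpohnCI

end

namespace SpohnCI

/-! ### Dimension of affine domains -/

/-! Off the special hyperplanes each model is parametrized: up to scaling its points are `π z` with
`z ∈ ℂ^m`, and every `z l` is a quotient of linear forms in the coordinates. Here `m = n` if there
are no edges, and otherwise `m` is `4`, `5`, `6` or `2 ^ n - 1` and exceeds `n`. The model has
dimension `m`. For a fixed distribution the Spohn equation of player `i` is one linear equation in
the payoffs of `i`. Hence the incidence variety of pairs (parameter, game) is rational of dimension
`n * 2 ^ n + (m - n)`, and its fibre over a game `X` describes the Spohn CI variety of `X` off the
hyperplanes. Everything is a statement about the general fibre of the projection to the space of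
games. Algebraic independence of the payoffs gives nonempty general fibres of dimension `m - n`. If
`ℂ(payoffs)` is moreover algebraically closed in the function field `L` of the incidence variety,
the general fibre is irreducible.

Both facts are proved by adding one player at a time. Let `k_i` be generated over `ℂ` by the payoffs
of the first `i` players, and `E_i` by these and `z`. The next step adjoins free payoffs `x_j` to
both fields, and to `k_i` also the linear form `w = ∑ f_j x_j`, with `f_j ∈ ℂ(z)`, which is the
payoff at the state `0`. If one `f_j` is transcendental over `k_i`, then `w` and the `x_j` are
independent over `k_i` (`algebraicIndependent_option_linear`). Regularity of `E_i / k_i` is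
expressed by `D = E_i ⊗ E_i` being a domain. It is inherited if two of the `f_j` are independent
over `k_i` (`isDomain_tensor_adjoin`): the new tensor product is a localization of `D[x] / (∑ (f_j ⊗
1 - 1 ⊗ f_j) x_j)`, and this linear form is prime because two of its coefficients form a regular
sequence.

Enough independent coefficients exist by a transcendence degree count (`exists_independent_coeffs`).
The `f_j` of a player and the ratio `t` of the two marginals of that player determine the
distribution up to scaling, hence `z`; for every player but the first, the equation of the first
player is quadratic in `t`. This leaves at least `m - n + 1` independent coefficients: one if `n =
m`, two if `n < m`. The count fails for `n = 1`.

The passage from the generic to the general fibre is `exists_generic_specialization`. An integral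
primitive element presents the family by an absolutely irreducible polynomial, which stays
irreducible at general points (Bertini-Noether), while a Gröbner basis argument keeps the common
denominator a nonzerodivisor on the fibres. -/

theorem ringKrullDim_eq_of_isIntegral (R S : Type*) [CommRing R] [CommRing S] [Algebra R S]
    [Algebra.IsIntegral R S] (hinj : Function.Injective (algebraMap R S)) :
    ringKrullDim S = ringKrullDim R := by
  refine le_antisymm ?_ ?_
  · refine Order.krullDim_le_of_strictMono (PrimeSpectrum.comap (algebraMap R S)) ?_
    intro I J hIJ
    exact Ideal.IsIntegral.comap_lt_comap (R := R) (I := I.asIdeal) (J := J.asIdeal) hIJ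
  · have hup : Algebra.HasGoingUp R S := by
      refine ⟨fun {q} hq P hP hlt => ?_⟩
      obtain ⟨Q, hPQ, hQ, hQq⟩ :=
        Ideal.exists_ideal_over_prime_of_isIntegral_of_isPrime q P hlt.le
      exact ⟨Q, hPQ, hQ, ⟨hQq.symm⟩⟩
    refine iSup_le fun l => ?_
    obtain ⟨P, -, hP, hPl⟩ := Ideal.exists_ideal_over_prime_of_isIntegral
      (S := S) l.head.asIdeal ⊥ (by
        rw [← RingHom.ker_eq_comap_bot, (RingHom.injective_iff_ker_eq_bot _).1 hinj]
        exact bot_le)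
    have : P.LiesOver (RelSeries.head l).asIdeal := ⟨hPl.symm⟩
    obtain ⟨L, hL, -⟩ := Ideal.exists_ltSeries_of_hasGoingUp l P
    rw [← hL]
    exact Order.LTSeries.length_le_krullDim L

/-- Noether normalization: `R` is integral over a polynomial ring, which has the same Krull
dimension and the same transcendence degree. -/
theorem ringKrullDim_eq_trdeg (k : Type) [Field k] (R : Type) [CommRing R] [IsDomain R]
    [Algebra k R] [Algebra.FiniteType k R] (d : ℕ) (hd : Algebra.trdeg k R = d) :
    ringKrullDim R = d := by
  obtain ⟨s, g, hg, hint⟩ := exists_integral_inj_algHom_of_fg k R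
  let _ : Algebra (MvPolynomial (Fin s) k) R := g.toRingHom.toAlgebra
  have : IsScalarTower k (MvPolynomial (Fin s) k) R :=
    IsScalarTower.of_algebraMap_eq fun c => (g.commutes c).symm
  have : Algebra.IsIntegral (MvPolynomial (Fin s) k) R := ⟨hint⟩
  have hinj : Function.Injective (algebraMap (MvPolynomial (Fin s) k) R) := hg
  have : FaithfulSMul (MvPolynomial (Fin s) k) R :=
    (faithfulSMul_iff_algebraMap_injective _ _).2 hinj
  have h := _root_.trdeg_add_eq k (MvPolynomial (Fin s) k) (A := R)
  rw [_root_.trdeg_eq_zero (R := MvPolynomial (Fin s) k) (A := R), MvPolynomial.trdeg_of_isDomain, hd, add_zero] at h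
  have hs : s = d := by simpa using h
  rw [ringKrullDim_eq_of_isIntegral _ R hinj, MvPolynomial.ringKrullDim_of_isNoetherianRing,
    ringKrullDim_eq_zero_of_field, hs]
  simp

/-! ### Generic flatness of an ideal in a polynomial ring -/

open MvPolynomial in
/-- For an ideal `J` of a polynomial ring over a domain `B`, the ideals `J` and `𝔪 B[y]` are
transversal for every maximal ideal `𝔪` of a nonempty open set. -/
theorem exists_inf_map_le_map_mul {B : Type} [CommRing B] [IsDomain B] {σ : Type} [Finite σ]
    (J : Ideal (MvPolynomial σ B)) :
    ∃ F : B, F ≠ 0 ∧ ∀ 𝔪 : Ideal B, 𝔪.IsMaximal → F ∉ 𝔪 →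
      J ⊓ 𝔪.map C ≤ 𝔪.map C * J := by
  classical
  obtain ⟨_, ⟨e⟩⟩ := Finite.exists_equiv_fin σ
  let _ : LinearOrder σ := LinearOrder.lift' e e.injective
  let m : MonomialOrder σ := MonomialOrder.lex
  -- A Gröbner basis argument over `B`. The leading exponents of `J` have finitely many minimal
  -- elements by Dickson's lemma; where the corresponding leading coefficients are invertible,
  -- division by the `g a` is possible.
  let D : Set (σ →₀ ℕ) := {a | ∃ f ∈ J, f ≠ 0 ∧ m.degree f = a}
  have hDm : {a | Minimal (· ∈ D) a}.Finite :=
    WellQuasiOrderedLE.finite_of_isAntichain (setOfPred_minimal_antichain _)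
  have hg : ∀ a, ∃ g : MvPolynomial σ B, a ∈ D → g ∈ J ∧ g ≠ 0 ∧ m.degree g = a := by
    intro a
    by_cases ha : a ∈ D
    · obtain ⟨g, h⟩ := ha
      exact ⟨g, fun _ => h⟩
    · exact ⟨0, fun h => absurd h ha⟩
  choose g hg using hg
  refine ⟨∏ a ∈ hDm.toFinset, m.leadingCoeff (g a), ?_, ?_⟩
  · refine Finset.prod_ne_zero_iff.2 fun a ha => ?_
    rw [Set.Finite.mem_toFinset] at ha
    exact m.leadingCoeff_ne_zero_iff.2 (hg a ha.prop).2.1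
  intro 𝔪 h𝔪 hF
  set F := ∏ a ∈ hDm.toFinset, m.leadingCoeff (g a) with hFdef
  suffices h : ∀ (s : m.syn) (f : MvPolynomial σ B), m.toSyn (m.degree f) = s → f ∈ J →
      f ∈ 𝔪.map C → f ∈ 𝔪.map C * J from fun f hf => h _ f rfl hf.1 hf.2
  intro s
  induction s using WellFoundedLT.induction with
  | ind s ih =>
  intro f hfs hfJ hfm
  by_cases hf0 : f = 0
  · rw [hf0]
    exact Ideal.zero_mem _
  obtain ⟨a, haf, ha⟩ : ∃ a ≤ m.degree f, Minimal (· ∈ D) a :=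
    exists_minimal_le_of_wellFoundedLT (· ∈ D) (m.degree f) ⟨f, hfJ, hf0, rfl⟩
  obtain ⟨hgJ, hg0, hga⟩ := hg a ha.prop
  obtain ⟨F', hF'⟩ : m.leadingCoeff (g a) ∣ F :=
    Finset.dvd_prod_of_mem _ (hDm.mem_toFinset.2 ha)
  have hlc : m.leadingCoeff f ∈ 𝔪 := (mem_map_C_iff.1 hfm) _
  -- `t * g a` cancels the leading term of `F * f`. The coefficient of `t` is a multiple of the
  -- leading coefficient of `f`, hence lies in `𝔪`, so what is subtracted is already in `𝔪 J`.
  set t := monomial (m.degree f - a) (F' * m.leadingCoeff f) with ht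
  have htm : t ∈ 𝔪.map (C : B →+* MvPolynomial σ B) := by
    rw [ht, ← mul_one (F' * _), mul_comm F', mul_assoc, ← C_mul_monomial]
    exact Ideal.mul_mem_right _ _ (Ideal.mem_map_of_mem _ hlc)
  have htJ : t * g a ∈ 𝔪.map C * J := Ideal.mul_mem_mul htm hgJ
  have hf' : C F * f - t * g a ∈ 𝔪.map C * J := by
    by_cases h0 : C F * f - t * g a = 0
    · rw [h0]
      exact Ideal.zero_mem _
    refine ih _ ?_ _ rfl (J.sub_mem (J.mul_mem_left _ hfJ) (J.mul_mem_left _ hgJ))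
      (Ideal.sub_mem _ (Ideal.mul_mem_left _ _ hfm) (Ideal.mul_mem_right _ _ htm))
    rw [← hfs]
    have hdeg : m.degree f - a + a = m.degree f := tsub_add_cancel_of_le haf
    have hc : coeff (m.degree f) (C F * f - t * g a) = 0 := by
      rw [coeff_sub, coeff_C_mul, ht]
      nth_rewrite 2 [← hdeg]
      rw [coeff_monomial_mul]
      have hga' : coeff a (g a) = m.leadingCoeff (g a) := by
        rw [MonomialOrder.leadingCoeff, hga]
      rw [hga', hF']
      change _ * m.leadingCoeff f - _ = 0
      ring
    refine lt_of_le_of_ne ?_ fun heq => ?_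
    · refine le_trans m.degree_sub_le (sup_le ?_ ?_)
      · rw [← smul_eq_C_mul]
        exact m.degree_smul_le
      · refine le_trans m.degree_mul_le ?_
        rw [map_add, ← hdeg, map_add, hga]
        have := m.degree_monomial_le (d := m.degree f - a) (F' * m.leadingCoeff f)
        simpa [ht, hdeg] using this
    · rw [m.toSyn.injective heq |>.symm] at hc
      exact h0 (m.leadingCoeff_eq_zero_iff.1 hc)
  have hFf : C F * f ∈ 𝔪.map C * J := by
    have := Ideal.add_mem _ hf' htJ
    rwa [sub_add_cancel] at this
  -- `F` is invertible modulo `𝔪`, and both terms of `f = u F f + v f` lie in `𝔪 J`.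
  obtain ⟨u, v, hv, huv⟩ : ∃ u, ∃ v ∈ 𝔪, u * F + v = 1 := by
    obtain ⟨u, hu⟩ := h𝔪.exists_inv hF
    exact ⟨u, hu⟩
  have : f = C u * (C F * f) + C v * f := by
    rw [← mul_assoc, ← C_mul, ← add_mul, ← C_add, huv, C_1, one_mul]
  rw [this]
  exact Ideal.add_mem _ (Ideal.mul_mem_left _ _ hFf)
    (Ideal.mul_mem_mul (Ideal.mem_map_of_mem _ hv) hfJ)

/-! ### Irreducible specializations of an absolutely irreducible polynomial -/

/-- An ideal of a polynomial ring over a domain `B` without zeros over an algebraically closed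
extension of `B` contains a nonzero constant. -/
theorem exists_C_mem_of_zeroLocus_eq_empty {B : Type} [CommRing B] [IsDomain B] {U : Type}
    [Finite U] {Ω : Type} [Field Ω] [IsAlgClosed Ω] [Algebra B Ω] [FaithfulSMul B Ω]
    (I : Ideal (MvPolynomial U B))
    (hI : ∀ u : U → Ω, ∃ f ∈ I, MvPolynomial.aeval u f ≠ 0) :
    ∃ F : B, F ≠ 0 ∧ MvPolynomial.C F ∈ I := by
  let K := FractionRing B
  let _ : Algebra K Ω := FractionRing.liftAlgebra B Ω
  have : IsScalarTower B K Ω := FractionRing.isScalarTower_liftAlgebra B Ω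
  let J : Ideal (MvPolynomial U K) := I.map (MvPolynomial.map (algebraMap B K))
  have hJ : J = ⊤ := by
    -- The Nullstellensatz for ideals over `K` with points in `Ω`; the nonzero constant then arises
    -- by clearing denominators in a representation of `1`.
    rw [← Ideal.radical_eq_top, ← MvPolynomial.vanishingIdeal_zeroLocus_eq_radical (K := Ω)]
    have : MvPolynomial.zeroLocus Ω J = ∅ := by
      refine Set.eq_empty_iff_forall_notMem.2 fun u hu => ?_
      obtain ⟨f, hf, hfu⟩ := hI u
      have := hu _ (Ideal.mem_map_of_mem _ hf)
      rw [MvPolynomial.aeval_map_algebraMap] at this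
      exact hfu this
    rw [this, MvPolynomial.vanishingIdeal_empty]
  let _ : Algebra (MvPolynomial U B) (MvPolynomial U K) := MvPolynomial.algebraMvPolynomial
  have hloc := MvPolynomial.isLocalization (σ := U) (nonZeroDivisors B) K
  have h1 : (1 : MvPolynomial U K) ∈ I.map (algebraMap (MvPolynomial U B) (MvPolynomial U K)) := by
    have : algebraMap (MvPolynomial U B) (MvPolynomial U K)
        = MvPolynomial.map (algebraMap B K) := rfl
    rw [this]
    change 1 ∈ J
    rw [hJ]
    trivial
  rw [IsLocalization.mem_map_algebraMap_iff ((nonZeroDivisors B).map MvPolynomial.C)] at h1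
  obtain ⟨⟨⟨f, hf⟩, ⟨_, F, hF, rfl⟩⟩, h⟩ := h1
  refine ⟨F, nonZeroDivisors.ne_zero hF, ?_⟩
  rw [one_mul] at h
  have hinj : Function.Injective (algebraMap (MvPolynomial U B) (MvPolynomial U K)) :=
    MvPolynomial.map_injective _ (IsFractionRing.injective B K)
  have := hinj h
  simp only at this
  rw [this]
  exact hf

open MvPolynomial in
/-- The polynomial with prescribed coefficients on a finite set of monomials. -/
noncomputable def ofCoeffs {σ R : Type} [CommRing R] (s : Finset (σ →₀ ℕ)) (c : (σ →₀ ℕ) → R) :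
    MvPolynomial σ R := ∑ a ∈ s, monomial a (c a)

-- The Bertini-Noether theorem. Factorizations into factors of degrees at most `a` and `D - a` are
-- the solutions of a polynomial system over `B` in the unknown coefficients of the factors. It has
-- no solution over `Ω`, so by the Nullstellensatz its ideal contains a nonzero constant, and there
-- is no solution over `k` either when this constant survives.
open MvPolynomial in
theorem exists_irreducible_specialization {B : Type} [CommRing B] [IsDomain B] {σ : Type}
    [Finite σ] {Ω : Type} [Field Ω] [IsAlgClosed Ω] [Algebra B Ω] [FaithfulSMul B Ω]
    (f : MvPolynomial σ B) (hf : Irreducible (map (algebraMap B Ω) f)) :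
    ∃ F : B, F ≠ 0 ∧ ∀ (k : Type) [Field k] (φ : B →+* k), φ F ≠ 0 →
      Irreducible (map φ f) := by
  classical
  have _ := Fintype.ofFinite σ
  have hinj : Function.Injective (algebraMap B Ω) := FaithfulSMul.algebraMap_injective B Ω
  set D := f.totalDegree with hD
  have hDΩ : (map (algebraMap B Ω) f).totalDegree = D := by
    simp only [hD, totalDegree, support_map_of_injective _ hinj]
  have hfin : ∀ a : ℕ, {m : σ →₀ ℕ | m.degree ≤ a}.Finite := fun a =>
    Finsupp.finite_of_degree_le a
  let M : ℕ → Finset (σ →₀ ℕ) := fun a => (hfin a).toFinset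
  have hM : ∀ {R : Type} [CommRing R] (g : MvPolynomial σ R) (a : ℕ), g.totalDegree ≤ a →
      ofCoeffs (M a) (fun m => coeff m g) = g := by
    intro R _ g a hg
    rw [ofCoeffs]
    conv_rhs => rw [← support_sum_monomial_coeff g]
    symm
    refine Finset.sum_subset (fun m hm => ?_) (fun m _ hm => ?_)
    · rw [Set.Finite.mem_toFinset]
      refine le_trans ?_ hg
      rw [Finsupp.degree_eq_sum]
      have := le_totalDegree hm
      rwa [Finsupp.sum_fintype _ _ (fun _ => rfl)] at this
    · rw [notMem_support_iff.1 hm, monomial_zero]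
  have hMdeg : ∀ {R : Type} [CommRing R] (a : ℕ) (c : (σ →₀ ℕ) → R),
      (ofCoeffs (M a) c).totalDegree ≤ a := by
    intro R _ a c
    refine totalDegree_finsetSum_le fun m hm => ?_
    refine (totalDegree_monomial_le _ _).trans ?_
    rw [Set.Finite.mem_toFinset] at hm
    rw [Set.mem_ofPred_eq, Finsupp.degree_eq_sum] at hm
    rwa [Finsupp.sum_fintype _ _ (fun _ => rfl)]
  have hmap : ∀ {R R' : Type} [CommRing R] [CommRing R'] (ψ : R →+* R') (a : ℕ)
      (c : (σ →₀ ℕ) → R),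
      map ψ (ofCoeffs (M a) c) = ofCoeffs (M a) (fun m => ψ (c m)) := by
    intro R R' _ _ ψ a c
    simp only [ofCoeffs, map_sum, map_monomial]
  let U := (M D) ⊕ (M D)
  let c₁ : (σ →₀ ℕ) → MvPolynomial U B := fun m => if h : m ∈ M D then X (Sum.inl ⟨m, h⟩) else 0
  let c₂ : (σ →₀ ℕ) → MvPolynomial U B := fun m => if h : m ∈ M D then X (Sum.inr ⟨m, h⟩) else 0
  let P : ℕ → MvPolynomial σ (MvPolynomial U B) := fun a =>
    ofCoeffs (M a) c₁ * ofCoeffs (M (D - a)) c₂ - map C f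
  let I : ℕ → Ideal (MvPolynomial U B) := fun a => Ideal.span (Set.range fun m => coeff m (P a))
  have hP : ∀ {R : Type} [CommRing R] (φ : B →+* R) (u : U → R) (a : ℕ),
      map (eval₂Hom φ u) (P a) = ofCoeffs (M a) (fun m => eval₂Hom φ u (c₁ m)) *
        ofCoeffs (M (D - a)) (fun m => eval₂Hom φ u (c₂ m)) - map φ f := by
    intro R _ φ u a
    have hC : (eval₂Hom φ u).comp C = φ := RingHom.ext fun b => by simp
    simp only [P, map_sub, map_mul, hmap, map_map, hC]
  have hF : ∀ a, 1 ≤ a ∧ a < D → ∃ F : B, F ≠ 0 ∧ C F ∈ I a := by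
    rintro a ⟨ha1, haD⟩
    refine exists_C_mem_of_zeroLocus_eq_empty (Ω := Ω) (I a) fun u => ?_
    by_contra! hcon
    have h0 : map (eval₂Hom (algebraMap B Ω) u) (P a) = 0 := by
      ext m
      rw [coeff_map, coeff_zero]
      exact hcon _ (Ideal.subset_span ⟨m, rfl⟩)
    rw [hP, sub_eq_zero] at h0
    have hdeg : ∀ g h : MvPolynomial σ Ω, IsUnit g → g * h = map (algebraMap B Ω) f →
        h.totalDegree < D → False := by
      intro g h hg hgh hh
      obtain ⟨r, hr, rfl⟩ := isUnit_iff_eq_C_of_isReduced.1 hg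
      have : (C r * h).totalDegree ≤ h.totalDegree := by
        rw [← smul_eq_C_mul]
        exact totalDegree_smul_le _ _
      rw [hgh, hDΩ] at this
      omega
    rcases hf.isUnit_or_isUnit h0.symm with hu | hu
    · exact hdeg _ _ hu h0 ((hMdeg _ _).trans_lt (by omega))
    · exact hdeg _ _ hu ((mul_comm _ _).trans h0) ((hMdeg _ _).trans_lt haD)
  choose! F hF0 hFI using hF
  have hDpos : D ≠ 0 := by
    intro h0
    rw [h0, totalDegree_eq_zero_iff_eq_C] at hDΩ
    refine hf.not_isUnit ?_
    rw [hDΩ] at hf ⊢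
    refine (isUnit_iff_ne_zero.2 fun h => ?_).map C
    rw [h, C_0] at hf
    exact hf.ne_zero rfl
  -- A coefficient at a nonconstant monomial. Keeping it nonzero prevents the specialization from
  -- becoming constant.
  obtain ⟨m₀, hm₀, hm₀D⟩ : ∃ m ∈ f.support, m ≠ 0 := by
    by_contra! hcon
    refine hDpos (Nat.le_zero.1 ?_)
    rw [hD, totalDegree]
    refine Finset.sup_le fun m hm => ?_
    rw [hcon m hm]
    simp
  refine ⟨coeff m₀ f * ∏ a ∈ Finset.Ico 1 D, F a, mul_ne_zero (mem_support_iff.1 hm₀)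
    (Finset.prod_ne_zero_iff.2 fun a ha => hF0 a (Finset.mem_Ico.1 ha)), fun k _ φ hφ => ?_⟩
  rw [map_mul, map_prod, mul_ne_zero_iff, Finset.prod_ne_zero_iff] at hφ
  obtain ⟨hφ₀, hφ₁⟩ := hφ
  have hfk : coeff m₀ (map φ f) ≠ 0 := by rwa [coeff_map]
  have hfk0 : map φ f ≠ 0 := fun h => hfk (by rw [h, coeff_zero])
  have hfD : (map φ f).totalDegree ≤ D :=
    Finset.sup_mono (support_map_subset _ _)
  refine ⟨fun hu => ?_, fun g h hgh => ?_⟩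
  · obtain ⟨r, -, hr⟩ := isUnit_iff_eq_C_of_isReduced.1 hu
    rw [hr, coeff_C, if_neg (Ne.symm hm₀D)] at hfk
    exact hfk rfl
  have hg0 : g ≠ 0 := by
    rintro rfl
    exact hfk0 (by rw [hgh, zero_mul])
  have hh0 : h ≠ 0 := by
    rintro rfl
    exact hfk0 (by rw [hgh, mul_zero])
  have hunit : ∀ g : MvPolynomial σ k, g ≠ 0 → g.totalDegree = 0 → IsUnit g := by
    intro g hg h
    rw [totalDegree_eq_zero_iff_eq_C] at h
    rw [h] at hg ⊢
    refine (isUnit_iff_ne_zero.2 fun h' => hg ?_).map C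
    rw [h', C_0]
  by_contra! hcon
  have hg1 : g.totalDegree ≠ 0 := fun h => hcon.1 (hunit g hg0 h)
  have hh1 : h.totalDegree ≠ 0 := fun h' => hcon.2 (hunit h hh0 h')
  -- The degree may drop under `φ`. An inequality is enough, because the systems only bound the
  -- degrees of the two factors.
  rw [hgh, totalDegree_mul_of_isDomain hg0 hh0] at hfD
  set a := g.totalDegree with ha
  let u : U → k := Sum.elim (fun m => coeff m.1 g) (fun m => coeff m.1 h)
  have hMmem : ∀ b ≤ D, ∀ m ∈ M b, m ∈ M D := by
    intro b hb m hm
    rw [Set.Finite.mem_toFinset] at hm ⊢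
    exact le_trans (by exact hm) hb
  have hu : map (eval₂Hom φ u) (P a) = 0 := by
    rw [hP, hgh, sub_eq_zero]
    congr 1
    · conv_rhs => rw [← hM g a le_rfl]
      refine Finset.sum_congr rfl fun m hm => ?_
      simp only [c₁, dif_pos (hMmem a (by omega) m hm), coe_eval₂Hom, eval₂_X, u, Sum.elim_inl]
    · conv_rhs => rw [← hM h (D - a) (by omega)]
      refine Finset.sum_congr rfl fun m hm => ?_
      simp only [c₂, dif_pos (hMmem (D - a) (by omega) m hm), coe_eval₂Hom, eval₂_X, u,
        Sum.elim_inr]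
  have hle : I a ≤ RingHom.ker (eval₂Hom φ u) := by
    refine Ideal.span_le.2 ?_
    rintro _ ⟨m, rfl⟩
    rw [SetLike.mem_coe, RingHom.mem_ker, ← coeff_map, hu, coeff_zero]
  have := hle (hFI a ⟨by omega, by omega⟩)
  rw [RingHom.mem_ker, coe_eval₂Hom, eval₂_C] at this
  exact hφ₁ a (Finset.mem_Ico.2 ⟨by omega, by omega⟩) this

end SpohnCI

namespace SpohnCI

/-! ### Absolute irreducibility -/

open Polynomial in
/-- If `K` is algebraically closed in `L`, then `L` is linearly disjoint over `K` from every
algebraic extension of `K`. -/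
theorem linearIndependent_of_algebraic {K L N : Type} [Field K] [Field L] [Field N] [CharZero K]
    [Algebra K L] [Algebra L N] [Algebra K N] [IsScalarTower K L N]
    (hcl : ∀ a : L, IsAlgebraic K a → a ∈ (algebraMap K L).range)
    (Ω : IntermediateField K N) [Algebra.IsAlgebraic K Ω] {κ : Type} (l : κ → L)
    (hl : LinearIndependent K l) : LinearIndependent Ω (fun i => algebraMap L N (l i)) := by
  classical
  rw [linearIndependent_iff']
  intro s c hc
  set F : IntermediateField K N := IntermediateField.adjoin K ((fun i => (c i : N)) '' s) with hF
  have hint : ∀ i, IsIntegral K (c i : N) := fun i =>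
    ((Algebra.IsAlgebraic.isAlgebraic (R := K) (c i)).isIntegral).map Ω.val
  have : FiniteDimensional K F := by
    have : Finite ((fun i => (c i : N)) '' s) := (s.finite_toSet.image _).to_subtype
    refine IntermediateField.finiteDimensional_adjoin ?_
    rintro _ ⟨i, -, rfl⟩
    exact hint i
  obtain ⟨ζ, hζ⟩ := Field.exists_primitive_element K F
  have hζi : IsIntegral K ζ := Algebra.IsIntegral.isIntegral ζ
  have hζN : IsIntegral K (ζ : N) := hζi.map F.val
  -- The coefficients of the minimal polynomial over `L` are integral over `K`, since it divides the
  -- one over `K`. They therefore lie in `K`, and `ζ` has the same degree over `L` as over `K`.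
  have hmp : minpoly L (ζ : N) = (minpoly K (ζ : N)).map (algebraMap K L) := by
    have hLi : IsIntegral L (ζ : N) := hζN.tower_top
    have hdvd : minpoly L (ζ : N) ∣ (minpoly K (ζ : N)).map (algebraMap K L) :=
      minpoly.dvd_map_of_isScalarTower K L (ζ : N)
    have hcoef : ∀ n, (minpoly L (ζ : N)).coeff n ∈ (algebraMap K L).range := fun n =>
      hcl _ (isIntegral_coeff_of_dvd _ _ (minpoly.monic hζN) (minpoly.monic hLi) hdvd
        n).isAlgebraic
    obtain ⟨q, hq⟩ : ∃ q : K[X], q.map (algebraMap K L) = minpoly L (ζ : N) := by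
      rw [← mem_lifts, lifts_iff_coeff_lifts]
      exact hcoef
    have hqm : q.Monic := monic_of_injective (algebraMap K L).injective
      (by rw [hq]; exact minpoly.monic hLi)
    have hqζ : aeval (ζ : N) q = 0 := by
      rw [← aeval_map_algebraMap L, hq, minpoly.aeval]
    refine (eq_of_monic_of_dvd_of_natDegree_le (minpoly.monic hLi)
      ((minpoly.monic hζN).map _) hdvd ?_).symm ▸ rfl
    rw [natDegree_map, ← hq, natDegree_map]
    exact natDegree_le_natDegree (minpoly.min K _ hqm hqζ)
  have hpow : ∀ i, ∃ q : K[X], i ∈ s → q.degree < (minpoly K (ζ : N)).degree ∧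
      aeval (ζ : N) q = c i := by
    intro i
    by_cases hi : i ∈ s
    swap
    · exact ⟨0, fun h => absurd h hi⟩
    have hmem : (c i : N) ∈ F := IntermediateField.subset_adjoin _ _ ⟨i, hi, rfl⟩
    obtain ⟨q, hq⟩ : ∃ q : K[X], aeval ζ q = (⟨c i, hmem⟩ : F) := by
      have : (⟨c i, hmem⟩ : F) ∈ (⊤ : IntermediateField K F) := trivial
      rw [← hζ] at this
      rw [← IntermediateField.mem_toSubalgebra,
        IntermediateField.adjoin_simple_toSubalgebra_of_isAlgebraic hζi.isAlgebraic,
        Algebra.adjoin_singleton_eq_range_aeval] at this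
      exact this
    refine ⟨q %ₘ minpoly K (ζ : N), fun _ => ⟨degree_modByMonic_lt _ (minpoly.monic hζN), ?_⟩⟩
    rw [aeval_modByMonic_eq_self_of_root (minpoly.aeval K (ζ : N))]
    have := congrArg F.val hq
    rwa [← aeval_algHom_apply] at this
  choose q hq using hpow
  -- With `c i = q i (ζ)`, the relation says that a polynomial over `L` of degree below that of `ζ`
  -- vanishes at `ζ`. So it is zero, and its coefficients are relations over `K` between the `l i`.
  have hsum : ∑ i ∈ s, C (l i) * (q i).map (algebraMap K L) = 0 := by
    by_contra hne
    have h0 : aeval (ζ : N) (∑ i ∈ s, C (l i) * (q i).map (algebraMap K L)) = 0 := by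
      rw [map_sum, ← hc]
      refine Finset.sum_congr rfl fun i hi => ?_
      rw [map_mul, aeval_C, aeval_map_algebraMap, (hq i hi).2, mul_comm]
      rfl
    have h1 := minpoly.degree_le_of_ne_zero L (ζ : N) hne h0
    refine absurd h1 (not_le.2 ?_)
    rw [hmp, degree_map]
    refine (degree_sum_le _ _).trans_lt ((Finset.sup_lt_iff ?_).2 fun i hi => ?_)
    · exact bot_lt_iff_ne_bot.2 (fun h => (minpoly.ne_zero hζN) (degree_eq_bot.1 h))
    · rw [← smul_eq_C_mul]
      refine (degree_smul_le (l i) _).trans_lt ?_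
      rw [degree_map]
      exact (hq i hi).1
  intro i hi
  have hcoeff : ∀ n, (q i).coeff n = 0 := by
    intro n
    have := congrArg (fun p => coeff p n) hsum
    simp only [finsetSum_coeff, coeff_C_mul, coeff_map, coeff_zero] at this
    rw [linearIndependent_iff'] at hl
    refine hl s (fun i => (q i).coeff n) ?_ i hi
    rw [← this]
    refine Finset.sum_congr rfl fun j _ => ?_
    rw [Algebra.smul_def, mul_comm]
  have : q i = 0 := Polynomial.ext hcoeff
  have h2 := (hq i hi).2
  rw [this, map_zero] at h2
  exact Subtype.ext h2.symm

open MvPolynomial in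
theorem linearIndepOn_monomials_iff {R N σ : Type} [CommRing R] [CommRing N] [Algebra R N]
    (y : σ → N) (s : Set (σ →₀ ℕ)) :
    LinearIndepOn R (fun m => aeval y (monomial m (1 : R))) s ↔
      ∀ P : MvPolynomial σ R, (∀ m ∈ P.support, m ∈ s) → aeval y P = 0 → P = 0 := by
  classical
  have key : ∀ (t : Finset (σ →₀ ℕ)) (c : (σ →₀ ℕ) → R),
      aeval y (∑ m ∈ t, monomial m (c m)) = ∑ m ∈ t, c m • aeval y (monomial m (1 : R)) := by
    intro t c
    rw [map_sum]
    refine Finset.sum_congr rfl fun m _ => ?_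
    rw [← map_smul, smul_monomial, smul_eq_mul, mul_one]
  rw [linearIndepOn_iff']
  constructor
  · intro h P hPs hP
    refine MvPolynomial.ext _ _ fun m => ?_
    by_cases hm : m ∈ P.support
    · refine h P.support (fun m => coeff m P) hPs ?_ m hm
      rw [← key, support_sum_monomial_coeff, hP]
    · rw [notMem_support_iff.1 hm, coeff_zero]
  · intro h t c hts hc m hm
    have h0 : ∑ m ∈ t, monomial m (c m) = 0 := by
      refine h _ (fun m hm => hts ?_) ((key t c).trans hc)
      by_contra hmt
      refine mem_support_iff.1 hm ?_
      rw [coeff_sum]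
      refine Finset.sum_eq_zero fun k hk => ?_
      rw [coeff_monomial, if_neg]
      rintro rfl
      exact hmt hk
    have := congrArg (coeff m) h0
    rw [coeff_sum, coeff_zero, Finset.sum_eq_single m] at this
    · simpa using this
    · intro k _ hk
      rw [coeff_monomial, if_neg hk]
    · exact fun h => absurd hm h

open MvPolynomial in
/-- The minimal polynomial `f` of a primitive element is absolutely irreducible if the ground
field is algebraically closed in the extension. -/
theorem exists_irreducible_map {B A ι : Type} [CommRing B] [IsDomain B] [CharZero B] [CommRing A]
    [IsDomain A] [Algebra B A] [FaithfulSMul B A]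
    (hcl : ∀ a : FractionRing A, IsAlgebraic B a →
      ∃ b c : B, c ≠ 0 ∧ algebraMap B (FractionRing A) c * a = algebraMap B (FractionRing A) b)
    (Y : Option ι → A) (f : MvPolynomial (Option ι) B) (hf : aeval Y f = 0)
    (hmonic : (optionEquivLeft B ι f).Monic)
    (hmin : ∀ P : MvPolynomial (Option ι) B,
      (∀ m ∈ P.support, m none < (optionEquivLeft B ι f).natDegree) → aeval Y P = 0 → P = 0) :
    ∃ (Ω : Type) (_ : Field Ω) (_ : IsAlgClosed Ω) (_ : Algebra B Ω) (_ : FaithfulSMul B Ω),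
      Irreducible (map (algebraMap B Ω) f) := by
  let K := FractionRing B
  let L := FractionRing A
  let N := AlgebraicClosure L
  have : FaithfulSMul B L := FaithfulSMul.trans B A L
  let _ : Algebra K L := FractionRing.liftAlgebra B L
  have : IsScalarTower B K L := FractionRing.isScalarTower_liftAlgebra B L
  have : CharZero K := charZero_of_injective_algebraMap (IsFractionRing.injective B K)
  let Ω := algebraicClosure K N
  have : IsAlgClosed Ω := (algebraicClosure.isAlgClosure K N).1
  let _ : Algebra B Ω := ((algebraMap K Ω).comp (algebraMap B K)).toAlgebra
  have : IsScalarTower B K Ω := IsScalarTower.of_algebraMap_eq fun _ => rfl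
  have hinj : Function.Injective (algebraMap B Ω) :=
    (algebraMap K Ω).injective.comp (IsFractionRing.injective B K)
  have hfaith : FaithfulSMul B Ω := (faithfulSMul_iff_algebraMap_injective _ _).2 hinj
  refine ⟨Ω, inferInstance, ‹_›, inferInstance, hfaith, ?_⟩
  set e := (optionEquivLeft B ι f).natDegree with he
  -- The minimality of `f` is the linear independence over `B` of the monomials in `Y` of degree
  -- below `e` in the distinguished variable. In this form it passes to `K` and, by linear
  -- disjointness, to the algebraic closure `Ω` of `K` in `N`.
  have hli : LinearIndepOn B
      (fun m => aeval (fun i => algebraMap A L (Y i)) (monomial m (1 : B))) {m | m none < e} := by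
    rw [linearIndepOn_monomials_iff]
    intro P hP h0
    refine hmin P hP (IsFractionRing.injective A L ?_)
    rw [map_zero, ← h0, ← aeval_algebraMap_apply]
    rfl
  have hliK : LinearIndependent K
      (fun m : {m : Option ι →₀ ℕ | m none < e} =>
        aeval (fun i => algebraMap A L (Y i)) (monomial m.1 (1 : B))) :=
    (LinearIndependent.iff_fractionRing B K).1 hli
  have hclK : ∀ a : L, IsAlgebraic K a → a ∈ (algebraMap K L).range := by
    intro a ha
    obtain ⟨b, c, hc, hbc⟩ := hcl a ((IsFractionRing.isAlgebraic_iff B K L).2 ha)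
    refine ⟨algebraMap B K b / algebraMap B K c, ?_⟩
    have hc' : algebraMap B L c ≠ 0 := by
      rwa [Ne, FaithfulSMul.algebraMap_eq_zero_iff]
    rw [map_div₀, ← IsScalarTower.algebraMap_apply, ← IsScalarTower.algebraMap_apply,
      div_eq_iff hc', mul_comm]
    exact hbc.symm
  have hliΩ := linearIndependent_of_algebraic hclK Ω _ hliK
  have hminΩ : ∀ P : MvPolynomial (Option ι) Ω, (∀ m ∈ P.support, m none < e) →
      aeval (fun i => algebraMap L N (algebraMap A L (Y i))) P = 0 → P = 0 := by
    intro P hP h0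
    refine (linearIndepOn_monomials_iff (R := Ω) _ {m | m none < e}).1 ?_ P hP h0
    have hfun : (fun m : {m : Option ι →₀ ℕ | m none < e} =>
        aeval (fun i => algebraMap L N (algebraMap A L (Y i))) (monomial m.1 (1 : Ω))) =
        fun m => algebraMap L N (aeval (fun i => algebraMap A L (Y i)) (monomial m.1 (1 : B))) := by
      funext m
      simp only [aeval_monomial, map_one, one_mul, Finsupp.prod, map_prod, map_pow]
    rw [← hfun] at hliΩ
    exact hliΩ
  have hmapcomm : ∀ g : MvPolynomial (Option ι) B, optionEquivLeft Ω ι (map (algebraMap B Ω) g) =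
      (optionEquivLeft B ι g).map (map (algebraMap B Ω)) := by
    intro g
    have : ((optionEquivLeft Ω ι).toRingEquiv.toRingHom.comp (map (algebraMap B Ω))) =
        (Polynomial.mapRingHom (map (algebraMap B Ω))).comp
          (optionEquivLeft B ι).toRingEquiv.toRingHom := by
      refine MvPolynomial.ringHom_ext (fun r => ?_) (fun i => ?_)
      · simp [optionEquivLeft_C]
      · cases i <;> simp [optionEquivLeft_X_none, optionEquivLeft_X_some]
    exact congrArg (fun φ => φ g) this
  rw [← MulEquiv.irreducible_iff (optionEquivLeft Ω ι)]
  rw [hmapcomm]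
  have hmonΩ := hmonic.map (map (σ := ι) (algebraMap B Ω))
  have hnd : ((optionEquivLeft B ι f).map (map (algebraMap B Ω))).natDegree = e :=
    hmonic.natDegree_map _
  have hfΩ : aeval (fun i => algebraMap L N (algebraMap A L (Y i))) (map (algebraMap B Ω) f) = 0 := by
    have hBN : (algebraMap Ω N).comp (algebraMap B Ω) =
        (algebraMap A N).comp (algebraMap B A) := by
      ext b
      change algebraMap K N (algebraMap B K b) = algebraMap L N (algebraMap A L (algebraMap B A b))
      rw [IsScalarTower.algebraMap_apply K L N, ← IsScalarTower.algebraMap_apply B K L,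
        ← IsScalarTower.algebraMap_apply B A L]
    rw [aeval_def, eval₂_map, hBN]
    have := congrArg (algebraMap A N) hf
    rw [map_zero, aeval_def, hom_eval₂] at this
    exact this
  -- A proper monic factor of `f` does not vanish at `Y`, as it would be a relation between these
  -- monomials. But a product of two such factors equal to `f` would vanish there.
  have hkey : ∀ g : Polynomial (MvPolynomial ι Ω), g.Monic → g.natDegree < e →
      aeval (fun i => algebraMap L N (algebraMap A L (Y i))) ((optionEquivLeft Ω ι).symm g) ≠ 0 := by
    intro g hg hge h0
    have := hminΩ _ (fun m hm => ?_) h0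
    · rw [map_eq_zero_iff _ (optionEquivLeft Ω ι).symm.injective] at this
      exact hg.ne_zero this
    · have h1 := MvPolynomial.monomial_le_degreeOf none hm
      rw [← natDegree_optionEquivLeft, AlgEquiv.apply_symm_apply] at h1
      omega
  rw [hmonΩ.irreducible_iff_natDegree']
  refine ⟨fun h1 => ?_, fun g h hg hh hgh hdeg => ?_⟩
  · rw [h1, Polynomial.natDegree_one] at hnd
    have h2 : optionEquivLeft B ι f = 1 := hmonic.natDegree_eq_zero.1 (by rw [← he, hnd])
    rw [map_eq_one_iff _ (optionEquivLeft B ι).injective] at h2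
    rw [h2, map_one] at hf
    exact one_ne_zero hf
  · rw [Finset.mem_Ioc, hnd] at hdeg
    have hsum : g.natDegree + h.natDegree = e := by
      rw [← hg.natDegree_mul hh, hgh, hnd]
    have h0 : aeval (fun i => algebraMap L N (algebraMap A L (Y i)))
        ((optionEquivLeft Ω ι).symm (g * h)) = 0 := by
      rw [hgh, ← hmapcomm, AlgEquiv.symm_apply_apply, hfΩ]
    rw [map_mul, map_mul, mul_eq_zero] at h0
    rcases h0 with h0 | h0
    · exact hkey g hg (by omega) h0
    · exact hkey h hh (by omega) h0

end SpohnCI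

namespace SpohnCI

/-! ### Specialization of families of affine domains -/

-- The primitive element theorem for the fraction fields with denominators cleared; `c` is a common
-- denominator for the finitely many generators of `A`, and products of generators only need powers
-- of it.
open Polynomial in
theorem exists_integral_primitive {S A : Type} [CommRing S] [IsDomain S] [CharZero S] [CommRing A]
    [IsDomain A] [Algebra S A] [FaithfulSMul S A] [Algebra.FiniteType S A]
    [Algebra.IsAlgebraic S A] :
    ∃ θ : A, IsIntegral S θ ∧ ∃ c : S, c ≠ 0 ∧ ∀ a : A, ∃ (k : ℕ) (P : S[X]),
      aeval θ P = c ^ k • a := by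
  classical
  let K := FractionRing S
  let L := FractionRing A
  have : FaithfulSMul S L := FaithfulSMul.trans S A L
  let _ : Algebra K L := FractionRing.liftAlgebra S L
  have : IsScalarTower S K L := FractionRing.isScalarTower_liftAlgebra S L
  have : CharZero K := charZero_of_injective_algebraMap (IsFractionRing.injective S K)
  have : Algebra.IsAlgebraic A L := IsLocalization.isAlgebraic L (nonZeroDivisors A)
  have : Algebra.IsAlgebraic S L := Algebra.IsAlgebraic.trans S A L
  have : Algebra.IsAlgebraic K L := (IsFractionRing.comap_isAlgebraic_iff (A := S) (K := K)).1 this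
  have : Algebra.EssFiniteType A L := Algebra.EssFiniteType.of_isLocalization L (nonZeroDivisors A)
  have : Algebra.EssFiniteType S L := Algebra.EssFiniteType.comp S A L
  have : Algebra.EssFiniteType K L := Algebra.EssFiniteType.of_comp S K L
  have : Module.Finite K L := Algebra.finite_of_essFiniteType_of_isAlgebraic
  obtain ⟨α, hα⟩ := Field.exists_primitive_element K L
  obtain ⟨u, v, hv, huv⟩ := IsFractionRing.div_surjective (A := A) α
  -- Write the primitive element as `u / v`. A multiple `s = v * t` of the denominator lies in `S`,
  -- and a further factor `r` from `S` makes `u * t` integral. So `θ = r s α` is still primitive.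
  obtain ⟨s, hs, t, hst⟩ := (Algebra.IsAlgebraic.isAlgebraic (R := S) v).exists_nonzero_dvd hv
  obtain ⟨r, hr, hint⟩ := (Algebra.IsAlgebraic.isAlgebraic (R := S) (u * t)).exists_integral_multiple
  have hv0 : algebraMap A L v ≠ 0 := by
    simpa using nonZeroDivisors.ne_zero hv
  have hθ : algebraMap A L (r • (u * t)) = algebraMap K L (algebraMap S K (r * s)) * α := by
    rw [← huv, ← IsScalarTower.algebraMap_apply, map_mul, IsScalarTower.algebraMap_apply S A L s,
      hst, Algebra.smul_def, map_mul, map_mul, map_mul, ← IsScalarTower.algebraMap_apply,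
      mul_assoc, mul_assoc, mul_comm (algebraMap A L v), mul_div_assoc', div_mul_cancel₀ _ hv0,
      mul_comm (algebraMap A L u)]
  set θ : A := r • (u * t) with hθd
  have hrs : algebraMap S K (r * s) ≠ 0 := by
    rw [Ne, FaithfulSMul.algebraMap_eq_zero_iff]
    exact mul_ne_zero hr hs
  have hpow : ∀ a : A, ∃ c : S, c ≠ 0 ∧ ∃ P : S[X], aeval θ P = c • a := by
    intro a
    have hmem : algebraMap A L a ∈ IntermediateField.adjoin K {α} := by rw [hα]; trivial
    rw [← IntermediateField.mem_toSubalgebra,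
      IntermediateField.adjoin_simple_toSubalgebra_of_isAlgebraic
        (Algebra.IsAlgebraic.isAlgebraic α), Algebra.adjoin_singleton_eq_range_aeval] at hmem
    obtain ⟨q, hq⟩ := hmem
    let q' := q.comp (C (algebraMap S K (r * s))⁻¹ * X)
    have hq' : aeval (algebraMap A L θ) q' = algebraMap A L a := by
      rw [← hq, aeval_comp, hθ]
      rw [map_mul, aeval_C, aeval_X, ← mul_assoc, ← map_mul, inv_mul_cancel₀ hrs, map_one, one_mul]
      rfl
    obtain ⟨b, hb⟩ := IsLocalization.integerNormalization_spec (nonZeroDivisors S) q'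
    refine ⟨b, nonZeroDivisors.ne_zero hb.1, IsLocalization.integerNormalization (nonZeroDivisors S) q',
      IsFractionRing.injective A L ?_⟩
    have hmap : (IsLocalization.integerNormalization (nonZeroDivisors S) q').map (algebraMap S K)
        = C (algebraMap S K b) * q' := by
      rw [hb.2, Algebra.smul_def]
      rfl
    rw [← aeval_algebraMap_apply, ← aeval_map_algebraMap K, hmap, map_mul, hq', aeval_C,
      Algebra.smul_def, map_mul, ← IsScalarTower.algebraMap_apply, ← IsScalarTower.algebraMap_apply]
  refine ⟨θ, hint, ?_⟩
  obtain ⟨G, hG⟩ := Algebra.FiniteType.out (R := S) (A := A)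
  choose c hc P hP using hpow
  set c0 : S := ∏ g ∈ G, c g
  have hc0 : c0 ≠ 0 := Finset.prod_ne_zero_iff.2 fun g _ => hc g
  refine ⟨c0, hc0, fun a => ?_⟩
  have ha : a ∈ Algebra.adjoin S (G : Set A) := by rw [hG]; trivial
  induction ha using Algebra.adjoin_induction with
  | mem g hg =>
    refine ⟨1, C (∏ h ∈ G.erase g, c h) * P g, ?_⟩
    rw [map_mul, hP, aeval_C, ← Algebra.smul_def, smul_smul, pow_one,
      Finset.prod_erase_mul _ _ hg]
  | algebraMap r => exact ⟨0, C r, by simp⟩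
  | add x y _ _ hx hy =>
    obtain ⟨k, p, hp⟩ := hx
    obtain ⟨l, q, hq⟩ := hy
    refine ⟨k + l, C (c0 ^ l) * p + C (c0 ^ k) * q, ?_⟩
    simp only [map_add, map_mul, aeval_C, hp, hq, ← Algebra.smul_def, smul_smul, smul_add, pow_add]
    rw [mul_comm (c0 ^ l)]
  | mul x y _ _ hx hy =>
    obtain ⟨k, p, hp⟩ := hx
    obtain ⟨l, q, hq⟩ := hy
    refine ⟨k + l, p * q, ?_⟩
    rw [map_mul, hp, hq, smul_mul_smul_comm, pow_add]

/-- Transversality is applied to the preimage `J` of the ideal `c A` in a polynomial ring: it gives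
`c * a ∈ 𝔪 A * c A`, where `c` can be cancelled. -/
theorem exists_mul_mem_map_imp {B A : Type} [CommRing B] [IsDomain B] [CommRing A] [IsDomain A]
    [Algebra B A] [Algebra.FiniteType B A] (c : A) (hc : c ≠ 0) :
    ∃ F : B, F ≠ 0 ∧ ∀ 𝔪 : Ideal B, 𝔪.IsMaximal → F ∉ 𝔪 → ∀ a : A,
      c * a ∈ 𝔪.map (algebraMap B A) → a ∈ 𝔪.map (algebraMap B A) := by
  obtain ⟨r, π, hπ⟩ := Algebra.FiniteType.iff_quotient_mvPolynomial''.1 ‹Algebra.FiniteType B A›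
  let J : Ideal (MvPolynomial (Fin r) B) := (Ideal.span {c}).comap π
  obtain ⟨F, hF, h⟩ := exists_inf_map_le_map_mul J
  refine ⟨F, hF, fun 𝔪 hm hFm a ha => ?_⟩
  have hmap : (𝔪.map (MvPolynomial.C (σ := Fin r))).map (π : MvPolynomial (Fin r) B →+* A) =
      𝔪.map (algebraMap B A) := by
    rw [Ideal.map_map]
    congr 1
    exact π.comp_algebraMap
  rw [← hmap, Ideal.mem_map_iff_of_surjective (π : MvPolynomial (Fin r) B →+* A) hπ] at ha
  obtain ⟨p, hp, hpa⟩ := ha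
  have hpJ : p ∈ 𝔪.map MvPolynomial.C * J := h 𝔪 hm hFm
    ⟨Ideal.mem_comap.2 (Ideal.mem_span_singleton.2 ⟨a, hpa⟩), hp⟩
  have := Ideal.mem_map_of_mem (π : MvPolynomial (Fin r) B →+* A) hpJ
  rw [Ideal.map_mul, hmap, hpa] at this
  have h2 : c * a ∈ 𝔪.map (algebraMap B A) * Ideal.span {c} :=
    Ideal.mul_mono_right Ideal.map_comap_le this
  rw [Ideal.mem_mul_span_singleton] at h2
  obtain ⟨z, hz, hzc⟩ := h2
  rw [mul_comm z c, mul_right_inj' hc] at hzc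
  rwa [← hzc]

section specialize

open MvPolynomial

variable {B A ι k : Type} [CommRing B] [CommRing A] [Algebra B A] {Y : Option ι → A}
  {f : MvPolynomial (Option ι) B} [Field k] {φ : B →+* k}

theorem optionEquivLeft_map {R S : Type} [CommRing R] [CommRing S] (φ : R →+* S)
    (g : MvPolynomial (Option ι) R) : optionEquivLeft S ι (map φ g) =
      (optionEquivLeft R ι g).map (map φ) := by
  have : ((optionEquivLeft S ι).toRingEquiv.toRingHom.comp (map φ)) =
      (Polynomial.mapRingHom (map φ)).comp (optionEquivLeft R ι).toRingEquiv.toRingHom := by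
    refine MvPolynomial.ringHom_ext (fun r => ?_) (fun i => ?_)
    · simp [optionEquivLeft_C]
    · cases i <;> simp [optionEquivLeft_X_none, optionEquivLeft_X_some]
  exact congrArg (fun ψ => ψ g) this

theorem optionEquivLeft_rename_some {R : Type} [CommRing R] (g : MvPolynomial ι R) :
    optionEquivLeft R ι (rename some g) = Polynomial.C g := by
  have : ((optionEquivLeft R ι).toAlgHom.comp (rename some)) =
      (IsScalarTower.toAlgHom R (MvPolynomial ι R) (Polynomial (MvPolynomial ι R))) := by
    refine MvPolynomial.algHom_ext fun i => ?_
    simp [optionEquivLeft_X_some]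
  exact congrArg (fun ψ => ψ g) this

theorem exists_dvd_sub_of_monic [Nontrivial B] (hmonic : (optionEquivLeft B ι f).Monic)
    (he : (optionEquivLeft B ι f).natDegree ≠ 0)
    (P : MvPolynomial (Option ι) B) : ∃ Q : MvPolynomial (Option ι) B,
      f ∣ P - Q ∧ ∀ m ∈ Q.support, m none < (optionEquivLeft B ι f).natDegree := by
  refine ⟨(optionEquivLeft B ι).symm (optionEquivLeft B ι P %ₘ optionEquivLeft B ι f), ?_, ?_⟩
  · rw [← map_dvd_iff (optionEquivLeft B ι), map_sub, AlgEquiv.apply_symm_apply]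
    exact ⟨optionEquivLeft B ι P /ₘ optionEquivLeft B ι f, by
      rw [sub_eq_iff_eq_add', Polynomial.modByMonic_add_div]⟩
  · intro m hm
    have h1 := MvPolynomial.monomial_le_degreeOf none hm
    rw [← natDegree_optionEquivLeft, AlgEquiv.apply_symm_apply] at h1
    refine h1.trans_lt (Polynomial.natDegree_modByMonic_lt _ hmonic fun h => he ?_)
    rw [h, Polynomial.natDegree_one]

theorem eq_zero_of_dvd_rename (hmonic : (optionEquivLeft B ι f).Monic)
    (he : (optionEquivLeft B ι f).natDegree ≠ 0) {g : MvPolynomial ι k}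
    (h : map φ f ∣ rename some g) : g = 0 := by
  rw [← map_dvd_iff (optionEquivLeft k ι), optionEquivLeft_map, optionEquivLeft_rename_some] at h
  by_contra hg
  have h1 := Polynomial.natDegree_le_of_dvd h (Polynomial.C_ne_zero.2 hg)
  have hnd : ((optionEquivLeft B ι f).map (map φ)).natDegree =
      (optionEquivLeft B ι f).natDegree := hmonic.natDegree_map _
  rw [Polynomial.natDegree_C] at h1
  omega

/-- The elements which after multiplication by a power of `c` are represented by a polynomial killed
by `φ` form an ideal containing `ker φ * A`. Two polynomials representing the same element differ by
a multiple of `f`, since the remainder of division by the monic `f` vanishes by `hmin`. -/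
theorem exists_dvd_of_aeval_mem [Nontrivial B] {c : MvPolynomial ι B} (hf : aeval Y f = 0)
    (hmonic : (optionEquivLeft B ι f).Monic) (he : (optionEquivLeft B ι f).natDegree ≠ 0)
    (hmin : ∀ P : MvPolynomial (Option ι) B,
      (∀ m ∈ P.support, m none < (optionEquivLeft B ι f).natDegree) → aeval Y P = 0 → P = 0)
    (hc : ∀ a : A, ∃ (l : ℕ) (P : MvPolynomial (Option ι) B),
      aeval Y P = aeval Y (rename some c) ^ l * a)
    {P : MvPolynomial (Option ι) B}
    (hP : aeval Y P ∈ (RingHom.ker φ).map (algebraMap B A)) :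
    ∃ l : ℕ, map φ f ∣ rename some (map φ c) ^ l * map φ P := by
  let T : Ideal A :=
    { carrier := {w | ∃ (l : ℕ) (M : MvPolynomial (Option ι) B), map φ M = 0 ∧
        aeval Y M = aeval Y (rename some c) ^ l * w}
      zero_mem' := ⟨0, 0, by simp, by simp⟩
      add_mem' := by
        rintro v w ⟨l, M, hM, h⟩ ⟨l', M', hM', h'⟩
        refine ⟨l + l', rename some c ^ l' * M + rename some c ^ l * M', ?_, ?_⟩
        · simp [hM, hM']
        · simp only [map_add, map_mul, map_pow, h, h']
          ring
      smul_mem' := by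
        rintro a w ⟨l, M, hM, h⟩
        obtain ⟨l', P, hP⟩ := hc a
        refine ⟨l' + l, P * M, by simp [hM], ?_⟩
        simp only [map_mul, h, hP, smul_eq_mul]
        ring }
  have hT : (RingHom.ker φ).map (algebraMap B A) ≤ T := by
    rw [Ideal.map_le_iff_le_comap]
    intro b hb
    refine ⟨0, C b, by simpa using hb, by simp⟩
  obtain ⟨l, M, hM, h⟩ := hT hP
  refine ⟨l, ?_⟩
  obtain ⟨Q, hQ, hQd⟩ := exists_dvd_sub_of_monic hmonic he (rename some c ^ l * P - M)
  have hQ0 : Q = 0 := by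
    refine hmin Q hQd ?_
    obtain ⟨q, hq⟩ := hQ
    have := congrArg (aeval Y) hq
    rw [map_mul, hf, zero_mul, map_sub, map_sub, map_mul, map_pow, h, sub_self, zero_sub,
      neg_eq_zero] at this
    exact this
  rw [hQ0, sub_zero] at hQ
  have := map_dvd (map φ) hQ
  rwa [map_sub, map_mul, map_pow, hM, sub_zero, map_rename] at this

theorem map_ker_ne_top [Nontrivial B] {c : MvPolynomial ι B} (hf : aeval Y f = 0)
    (hmonic : (optionEquivLeft B ι f).Monic) (he : (optionEquivLeft B ι f).natDegree ≠ 0)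
    (hmin : ∀ P : MvPolynomial (Option ι) B,
      (∀ m ∈ P.support, m none < (optionEquivLeft B ι f).natDegree) → aeval Y P = 0 → P = 0)
    (hc : ∀ a : A, ∃ (l : ℕ) (P : MvPolynomial (Option ι) B),
      aeval Y P = aeval Y (rename some c) ^ l * a) (hcφ : map φ c ≠ 0) :
    (RingHom.ker φ).map (algebraMap B A) ≠ ⊤ := by
  intro htop
  obtain ⟨l, hl⟩ := exists_dvd_of_aeval_mem (φ := φ) (P := 1) hf hmonic he hmin hc
    (by rw [htop]; trivial)
  rw [map_one, mul_one, ← map_pow] at hl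
  exact pow_ne_zero l hcφ (eq_zero_of_dvd_rename hmonic he hl)

theorem mem_of_dvd (hφ : Function.Surjective φ) (hf : aeval Y f = 0)
    {P : MvPolynomial (Option ι) B} (h : map φ f ∣ map φ P) :
    aeval Y P ∈ (RingHom.ker φ).map (algebraMap B A) := by
  obtain ⟨q, hq⟩ := h
  obtain ⟨q, rfl⟩ := map_surjective φ hφ q
  have h1 : P - f * q ∈ RingHom.ker (map (σ := Option ι) φ) := by
    rw [RingHom.mem_ker, map_sub, map_mul, hq, sub_self]
  rw [ker_map] at h1
  have h2 := Ideal.mem_map_of_mem (aeval (R := B) Y : MvPolynomial (Option ι) B →+* A) h1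
  rw [Ideal.map_map] at h2
  have h3 : (aeval (R := B) Y : MvPolynomial (Option ι) B →+* A).comp C = algebraMap B A :=
    (aeval (R := B) Y).comp_algebraMap
  rw [h3] at h2
  simpa [hf] using h2

/-- After inverting `c`, the fibre is the polynomial ring over `k` modulo the prime element `map φ
f`. By `hreg` nothing is lost by inverting `c`. -/
theorem isPrime_map_ker [Nontrivial B] {c : MvPolynomial ι B} (hφ : Function.Surjective φ)
    (hf : aeval Y f = 0)
    (hmonic : (optionEquivLeft B ι f).Monic) (he : (optionEquivLeft B ι f).natDegree ≠ 0)
    (hmin : ∀ P : MvPolynomial (Option ι) B,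
      (∀ m ∈ P.support, m none < (optionEquivLeft B ι f).natDegree) → aeval Y P = 0 → P = 0)
    (hc : ∀ a : A, ∃ (l : ℕ) (P : MvPolynomial (Option ι) B),
      aeval Y P = aeval Y (rename some c) ^ l * a) (hcφ : map φ c ≠ 0)
    (hreg : ∀ a : A, aeval Y (rename some c) * a ∈ (RingHom.ker φ).map (algebraMap B A) →
      a ∈ (RingHom.ker φ).map (algebraMap B A))
    (hirr : Irreducible (map φ f)) :
    ((RingHom.ker φ).map (algebraMap B A)).IsPrime := by
  have hregpow : ∀ (l : ℕ) (a : A), aeval Y (rename some c) ^ l * a ∈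
      (RingHom.ker φ).map (algebraMap B A) → a ∈ (RingHom.ker φ).map (algebraMap B A) := by
    intro l
    induction l with
    | zero => intro a ha; simpa using ha
    | succ l ih => exact fun a ha => ih a (hreg _ (by rwa [← mul_assoc, ← pow_succ']))
  refine ⟨map_ker_ne_top hf hmonic he hmin hc hcφ, fun {u v} huv => ?_⟩
  obtain ⟨l, U, hU⟩ := hc u
  obtain ⟨l', V, hV⟩ := hc v
  have hUV : aeval Y (U * V) ∈ (RingHom.ker φ).map (algebraMap B A) := by
    rw [map_mul, hU, hV, mul_mul_mul_comm]
    exact Ideal.mul_mem_left _ _ huv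
  obtain ⟨r, hr⟩ := exists_dvd_of_aeval_mem hf hmonic he hmin hc hUV
  have hp : Prime (map φ f) := hirr.prime
  rw [map_mul] at hr
  rcases hp.dvd_or_dvd hr with h | h
  · rw [← map_pow] at h
    exact absurd (eq_zero_of_dvd_rename hmonic he h) (pow_ne_zero r hcφ)
  · rcases hp.dvd_or_dvd h with h | h
    · exact Or.inl (hregpow l u (hU ▸ mem_of_dvd hφ hf h))
    · exact Or.inr (hregpow l' v (hV ▸ mem_of_dvd hφ hf h))

/-- The `Y (some i)` stay independent on the fibre: a relation between them would, up to a power of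
`c`, be divisible by `map φ f`, which has positive degree in the remaining variable. Up to powers of
`c`, everything is integral over them. -/
theorem trdeg_quotient_map_ker [Nontrivial B] [Finite ι] {c : MvPolynomial ι B}
    [Algebra k B] (hφk : φ.comp (algebraMap k B) = RingHom.id k) [Algebra k A] [IsScalarTower k B A]
    (hf : aeval Y f = 0)
    (hmonic : (optionEquivLeft B ι f).Monic) (he : (optionEquivLeft B ι f).natDegree ≠ 0)
    (hmin : ∀ P : MvPolynomial (Option ι) B,
      (∀ m ∈ P.support, m none < (optionEquivLeft B ι f).natDegree) → aeval Y P = 0 → P = 0)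
    (hc : ∀ a : A, ∃ (l : ℕ) (P : MvPolynomial (Option ι) B),
      aeval Y P = aeval Y (rename some c) ^ l * a) (hcφ : map φ c ≠ 0)
    (hprime : ((RingHom.ker φ).map (algebraMap B A)).IsPrime) :
    Algebra.trdeg k (A ⧸ (RingHom.ker φ).map (algebraMap B A)) = Nat.card ι := by
  set I := (RingHom.ker φ).map (algebraMap B A) with hI
  let q : A →ₐ[k] A ⧸ I := Ideal.Quotient.mkₐ k I
  have hlift : ∀ {τ : Type} (Z : τ → A) (P : MvPolynomial τ B),
      q (aeval Z P) = aeval (fun i => q (Z i)) (map φ P) := by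
    intro τ Z P
    have : ((q : A →+* A ⧸ I).comp (aeval (R := B) Z : MvPolynomial τ B →+* A)) =
        (aeval (R := k) (fun i => q (Z i)) : MvPolynomial τ k →+* A ⧸ I).comp (map φ) := by
      refine MvPolynomial.ringHom_ext (fun b => ?_) (fun i => by simp)
      simp only [RingHom.coe_comp, Function.comp_apply, RingHom.coe_coe, map_C, aeval_C]
      change Ideal.Quotient.mk I _ = _
      rw [IsScalarTower.algebraMap_apply k A (A ⧸ I), IsScalarTower.algebraMap_apply k B A]
      refine Ideal.Quotient.eq.2 ?_
      rw [← map_sub]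
      refine Ideal.mem_map_of_mem _ ?_
      rw [RingHom.mem_ker, map_sub, sub_eq_zero]
      exact (congrArg (fun ψ : k →+* k => ψ (φ b)) hφk).symm
    exact congrArg (fun ψ => ψ P) this
  have hφ : Function.Surjective φ := fun a => ⟨algebraMap k B a,
    congrArg (fun ψ : k →+* k => ψ a) hφk⟩
  have hsome : ∀ P : MvPolynomial ι k, aeval (fun i => q (Y i)) (rename some P) =
      aeval (fun i => q (Y (some i))) P := fun P => by
    rw [aeval_rename]; rfl
  have hindep : AlgebraicIndependent k (fun i => q (Y (some i))) := by
    rw [algebraicIndependent_iff]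
    intro P hP
    obtain ⟨P, rfl⟩ := map_surjective φ hφ P
    have h0 : aeval Y (rename some P) ∈ I := by
      rw [← hsome, ← map_rename, ← hlift] at hP
      exact Ideal.Quotient.eq_zero_iff_mem.1 hP
    obtain ⟨l, hl⟩ := exists_dvd_of_aeval_mem hf hmonic he hmin hc h0
    rw [map_rename, ← map_pow, ← map_mul] at hl
    exact (mul_eq_zero.1 (eq_zero_of_dvd_rename hmonic he hl)).resolve_left (pow_ne_zero l hcφ)
  let S := Algebra.adjoin k (Set.range fun i => q (Y (some i)))
  have hθ : IsIntegral S (q (Y none)) := by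
    have hmem : ∀ g : MvPolynomial ι k, aeval (fun i => q (Y (some i))) g ∈ S := fun g => by
      change _ ∈ Algebra.adjoin k (Set.range fun i => q (Y (some i)))
      rw [Algebra.adjoin_range_eq_range_aeval]
      exact ⟨g, rfl⟩
    let ψ : MvPolynomial ι k →+* S :=
      ((aeval (R := k) (fun i => q (Y (some i)))).codRestrict S hmem : MvPolynomial ι k →ₐ[k] S)
    refine ⟨(optionEquivLeft k ι (map φ f)).map ψ, ?_, ?_⟩
    · rw [optionEquivLeft_map]
      exact (hmonic.map _).map _
    · rw [Polynomial.eval₂_map]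
      have : (Polynomial.eval₂RingHom ((algebraMap S (A ⧸ I)).comp ψ) (q (Y none))).comp
          ((optionEquivLeft k ι).toRingEquiv.toRingHom) =
          (aeval (R := k) (fun i => q (Y i)) : MvPolynomial (Option ι) k →+* A ⧸ I) := by
        refine MvPolynomial.ringHom_ext (fun b => ?_) (fun i => ?_)
        · simp [optionEquivLeft_C, ψ]
        · cases i
          · simp [optionEquivLeft_X_none]
          · simp [optionEquivLeft_X_some, ψ]
      have h2 := congrArg (fun χ => χ (map φ f)) this
      refine Eq.trans h2 ?_
      change aeval _ _ = _
      rw [← hlift, hf, map_zero]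
  have halg : Algebra.IsAlgebraic S (A ⧸ I) := by
    refine ⟨fun a => ?_⟩
    obtain ⟨a, rfl⟩ := Ideal.Quotient.mk_surjective a
    obtain ⟨l, P, hP⟩ := hc a
    have hint : ∀ P : MvPolynomial (Option ι) k, IsIntegral S (aeval (fun i => q (Y i)) P) := by
      intro P
      induction P using MvPolynomial.induction_on with
      | C r =>
        rw [aeval_C, IsScalarTower.algebraMap_apply k S]
        exact isIntegral_algebraMap
      | add p p' hp hp' => rw [map_add]; exact hp.add hp'
      | mul_X p i hp =>
        rw [map_mul, aeval_X]
        refine hp.mul ?_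
        cases i with
        | none => exact hθ
        | some i =>
          exact isIntegral_algebraMap (x := (⟨_, Algebra.subset_adjoin ⟨i, rfl⟩⟩ : S))
    have hPq := congrArg q hP
    rw [map_mul, hlift, map_pow, hlift, map_rename, hsome] at hPq
    have hc0 : aeval (fun i => q (Y (some i))) (map φ c) ≠ 0 := fun h =>
      hcφ ((algebraicIndependent_iff.1 hindep) _ h)
    have h1 : IsAlgebraic S (aeval (fun i => q (Y (some i))) (map φ c) ^ l * q a) :=
      hPq ▸ (hint _).isAlgebraic
    refine IsAlgebraic.of_mul (mem_nonZeroDivisors_of_ne_zero (pow_ne_zero l hc0)) ?_ h1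
    have := (hint (rename some (map φ c))).isAlgebraic
    rw [hsome] at this
    exact this.pow l
  have hb : IsTranscendenceBasis k (fun i => q (Y (some i))) :=
    hindep.isTranscendenceBasis_iff_isAlgebraic.2 halg
  rw [← hb.cardinalMk_eq_trdeg, Nat.cast_card]

end specialize

end SpohnCI

/-! ### Fibres of a dominant family over a general point -/

namespace SpohnCI

/-- Each generator of `A` becomes integral over `B` after multiplication by some `b g ∈ B`. Where
these factors do not vanish, the fibre is generated by finitely many integral elements. -/
theorem exists_finite_quotient {B A k : Type} [Field k] [CommRing B] [IsDomain B] [CommRing A]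
    [IsDomain A] [Algebra B A] [FaithfulSMul B A] [Algebra.IsAlgebraic B A] [Algebra k B]
    [Algebra k A] [IsScalarTower k B A] [Algebra.FiniteType k A] :
    ∃ F : B, F ≠ 0 ∧ ∀ φ : B →+* k, φ.comp (algebraMap k B) = RingHom.id k → φ F ≠ 0 →
      Module.Finite k (A ⧸ (RingHom.ker φ).map (algebraMap B A)) := by
  classical
  obtain ⟨G, hG⟩ := Algebra.FiniteType.out (R := k) (A := A)
  have h := fun g : A => (Algebra.IsAlgebraic.isAlgebraic (R := B) g).exists_integral_multiple
  choose b hb hint using h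
  refine ⟨∏ g ∈ G, b g, Finset.prod_ne_zero_iff.2 fun g _ => hb g, fun φ hφk hφ => ?_⟩
  set I := (RingHom.ker φ).map (algebraMap B A) with hI
  let q : A →ₐ[k] A ⧸ I := Ideal.Quotient.mkₐ k I
  have hq : ∀ r : B, q (algebraMap B A r) = algebraMap k _ (φ r) := by
    intro r
    change Ideal.Quotient.mk I _ = _
    rw [IsScalarTower.algebraMap_apply k A (A ⧸ I), IsScalarTower.algebraMap_apply k B A]
    refine Ideal.Quotient.eq.2 ?_
    rw [← map_sub]
    refine Ideal.mem_map_of_mem _ ?_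
    rw [RingHom.mem_ker, map_sub, sub_eq_zero]
    exact (congrArg (fun ψ : k →+* k => ψ (φ r)) hφk).symm
  have hqint : ∀ x : A, IsIntegral B x → IsIntegral k (q x) := by
    rintro x ⟨p, hp, hpx⟩
    refine ⟨p.map φ, hp.map φ, ?_⟩
    have h1 : (algebraMap k (A ⧸ I)).comp φ = (q : A →+* A ⧸ I).comp (algebraMap B A) :=
      RingHom.ext fun r => (hq r).symm
    rw [Polynomial.eval₂_map, h1]
    have := congrArg q hpx
    rwa [map_zero, ← RingHom.coe_coe, Polynomial.hom_eval₂] at this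
  have hall : ∀ x : A, IsIntegral k (q x) := by
    intro x
    have hx : x ∈ Algebra.adjoin k (G : Set A) := by rw [hG]; trivial
    induction hx using Algebra.adjoin_induction with
    | mem g hg =>
      have h1 := hqint _ (hint g)
      rw [Algebra.smul_def, map_mul, hq, ← Algebra.smul_def] at h1
      rw [map_prod, Finset.prod_ne_zero_iff] at hφ
      have h2 := h1.smul (φ (b g))⁻¹
      rwa [smul_smul, inv_mul_cancel₀ (hφ g hg), one_smul] at h2
    | algebraMap r => rw [AlgHom.commutes]; exact isIntegral_algebraMap
    | add x y _ _ hx hy => rw [map_add]; exact hx.add hy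
    | mul x y _ _ hx hy => rw [map_mul]; exact hx.mul hy
  have : Algebra.IsIntegral k (A ⧸ I) := ⟨fun x => by
    obtain ⟨x, rfl⟩ := Ideal.Quotient.mk_surjective x
    exact hall x⟩
  exact Algebra.IsIntegral.finite

open MvPolynomial in
theorem map_ker_eval {τ A : Type} [CommRing A] [Algebra ℂ A] (X : τ → A) (x : τ → ℂ) :
    (RingHom.ker (eval x)).map (aeval (R := ℂ) X : MvPolynomial τ ℂ →+* A) =
      Ideal.span (Set.range fun q => X q - algebraMap ℂ A (x q)) := by
  refine le_antisymm ?_ ?_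
  · rw [Ideal.map_le_iff_le_comap]
    intro P hP
    rw [Ideal.mem_comap, ← Ideal.Quotient.eq_zero_iff_mem]
    set I := Ideal.span (Set.range fun q => X q - algebraMap ℂ A (x q))
    have : ((Ideal.Quotient.mk I).comp (aeval (R := ℂ) X : MvPolynomial τ ℂ →+* A)) =
        (algebraMap ℂ (A ⧸ I)).comp (eval x) := by
      refine MvPolynomial.ringHom_ext (fun r => ?_) (fun i => ?_)
      · simp only [RingHom.coe_comp, Function.comp_apply, RingHom.coe_coe, aeval_C, eval_C]
        rfl
      · simp only [RingHom.coe_comp, Function.comp_apply, RingHom.coe_coe, aeval_X, eval_X]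
        refine Ideal.Quotient.eq.2 (Ideal.subset_span ⟨i, rfl⟩)
    have h := congrArg (fun ψ => ψ P) this
    refine h.trans ?_
    rw [RingHom.comp_apply, RingHom.mem_ker.1 hP, map_zero]
  · rw [Ideal.span_le]
    rintro _ ⟨q, rfl⟩
    have h : (aeval (R := ℂ) X : MvPolynomial τ ℂ →+* A) (MvPolynomial.X q - C (x q)) =
        X q - algebraMap ℂ A (x q) := by simp
    have h2 : MvPolynomial.X q - C (x q) ∈ RingHom.ker (eval x) := by simp [RingHom.mem_ker]
    have h3 := Ideal.mem_map_of_mem (aeval (R := ℂ) X : MvPolynomial τ ℂ →+* A) h2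
    rwa [h] at h3

open MvPolynomial in
/-- Specialization at a generic point `x` of the algebraically independent elements `X q` of an
affine domain. -/
theorem exists_generic_specialization {τ A : Type} [Finite τ] [CommRing A] [IsDomain A]
    [Algebra ℂ A] [Algebra.FiniteType ℂ A] (X : τ → A) (hX : AlgebraicIndependent ℂ X) (d : ℕ)
    (hd : Algebra.trdeg ℂ A = (Nat.card τ + d : ℕ)) :
    ∃ F : MvPolynomial τ ℂ, F ≠ 0 ∧ ∀ x : τ → ℂ, eval x F ≠ 0 →
      Ideal.span (Set.range fun q => X q - algebraMap ℂ A (x q)) ≠ ⊤ ∧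
      (d = 0 → Module.Finite ℂ
        (A ⧸ Ideal.span (Set.range fun q => X q - algebraMap ℂ A (x q)))) ∧
      ((∀ a : FractionRing A,
        IsAlgebraic (IntermediateField.adjoin ℂ
          (Set.range fun q => algebraMap A (FractionRing A) (X q))) a →
        a ∈ IntermediateField.adjoin ℂ
          (Set.range fun q => algebraMap A (FractionRing A) (X q))) →
        (Ideal.span (Set.range fun q => X q - algebraMap ℂ A (x q))).IsPrime ∧
        Algebra.trdeg ℂ (A ⧸ Ideal.span (Set.range fun q => X q - algebraMap ℂ A (x q))) = d) := by
  let B := MvPolynomial τ ℂ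
  let _ : Algebra B A := (aeval X : MvPolynomial τ ℂ →ₐ[ℂ] A).toRingHom.toAlgebra
  have hBA : ∀ P : B, algebraMap B A P = aeval X P := fun _ => rfl
  have : IsScalarTower ℂ B A := IsScalarTower.of_algebraMap_eq fun r => by
    rw [hBA, MvPolynomial.algebraMap_eq, aeval_C]
  have : FaithfulSMul B A := (faithfulSMul_iff_algebraMap_injective _ _).2 hX
  have : Algebra.FiniteType B A := Algebra.FiniteType.of_restrictScalars_finiteType ℂ B A
  have htr : Algebra.trdeg B A = d := by
    have h1 := _root_.trdeg_add_eq ℂ B (A := A)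
    rw [MvPolynomial.trdeg_of_isDomain, hd, Cardinal.lift_id, ← Nat.cast_card] at h1
    rw [Nat.cast_add] at h1
    exact Cardinal.eq_of_add_eq_add_left h1 (Cardinal.natCast_lt_aleph0)
  obtain ⟨s, hs⟩ := exists_isTranscendenceBasis B A
  let ι : Type := s
  let y : ι → A := Subtype.val
  have hcard : Cardinal.mk ι = d := by rw [← htr]; exact hs.cardinalMk_eq_trdeg
  have : Finite ι := Cardinal.mk_lt_aleph0_iff.1 (by rw [hcard]; exact Cardinal.natCast_lt_aleph0)
  let S := MvPolynomial ι B
  let _ : Algebra S A := (aeval y : MvPolynomial ι B →ₐ[B] A).toRingHom.toAlgebra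
  have hSA : ∀ P : S, algebraMap S A P = aeval y P := fun _ => rfl
  have : IsScalarTower B S A := IsScalarTower.of_algebraMap_eq fun r => by
    rw [hSA, MvPolynomial.algebraMap_eq, aeval_C]
  have : FaithfulSMul S A := (faithfulSMul_iff_algebraMap_injective _ _).2 hs.1
  have : Algebra.FiniteType S A := Algebra.FiniteType.of_restrictScalars_finiteType B S A
  have : Algebra.IsAlgebraic S A := by
    have h1 := hs.isAlgebraic
    refine Algebra.IsAlgebraic.of_ringHom_of_comp_eq hs.1.aevalEquiv (RingHom.id A)
      hs.1.aevalEquiv.surjective Function.injective_id ?_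
    ext z
    · simp [hSA]
    · simp [hSA]
    · simp [hSA, y]
  -- The family is now presented as `B[y][θ]` up to powers of `c ∈ B[y]`, with `y` a transcendence
  -- basis of `A` over `B`, consisting of `d` elements.
  obtain ⟨θ, hθ, c, hc0, hc⟩ := exists_integral_primitive (S := S) (A := A)
  let Y : Option ι → A := fun o => o.elim θ y
  let f : MvPolynomial (Option ι) B := (optionEquivLeft B ι).symm (minpoly S θ)
  have hfm : optionEquivLeft B ι f = minpoly S θ := AlgEquiv.apply_symm_apply _ _
  have hY : ∀ P : MvPolynomial (Option ι) B,
      aeval Y P = Polynomial.aeval θ (optionEquivLeft B ι P) := by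
    have : (aeval Y : MvPolynomial (Option ι) B →ₐ[B] A) =
        ((Polynomial.aeval (R := S) θ).restrictScalars B).comp
          (optionEquivLeft B ι : MvPolynomial (Option ι) B →ₐ[B] Polynomial S) := by
      refine MvPolynomial.algHom_ext fun i => ?_
      cases i with
      | none => simp [optionEquivLeft_X_none, Y]
      | some i => simp [optionEquivLeft_X_some, Y, hSA]
    exact fun P => congrArg (fun ψ => ψ P) this
  have hf : aeval Y f = 0 := by rw [hY, hfm, minpoly.aeval]
  have hmonic : (optionEquivLeft B ι f).Monic := by rw [hfm]; exact minpoly.monic hθ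
  have he : (optionEquivLeft B ι f).natDegree ≠ 0 := by
    rw [hfm]; exact (minpoly.natDegree_pos hθ).ne'
  have hmin : ∀ P : MvPolynomial (Option ι) B,
      (∀ m ∈ P.support, m none < (optionEquivLeft B ι f).natDegree) → aeval Y P = 0 → P = 0 := by
    intro P hP h0
    rw [hY] at h0
    -- `S` is a polynomial ring over a polynomial ring, hence integrally closed, so the minimal
    -- polynomial over `S` divides every polynomial over `S` vanishing at `θ`.
    have hdvd := minpoly.isIntegrallyClosed_dvd hθ h0
    by_contra hne
    have hne' : optionEquivLeft B ι P ≠ 0 := fun h => hne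
      ((map_eq_zero_iff _ (optionEquivLeft B ι).injective).1 h)
    have h1 := Polynomial.natDegree_le_of_dvd hdvd hne'
    rw [natDegree_optionEquivLeft, degreeOf_eq_sup, ← hfm] at h1
    refine absurd h1 (not_le.2 ?_)
    exact (Finset.sup_lt_iff (Nat.pos_of_ne_zero he)).2 hP
  have hcY : aeval Y (rename some c) = algebraMap S A c := by
    rw [hY, optionEquivLeft_rename_some, Polynomial.aeval_C]
  have hcs : ∀ a : A, ∃ (l : ℕ) (P : MvPolynomial (Option ι) B),
      aeval Y P = aeval Y (rename some c) ^ l * a := by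
    intro a
    obtain ⟨l, P, hP⟩ := hc a
    refine ⟨l, (optionEquivLeft B ι).symm P, ?_⟩
    rw [hY, AlgEquiv.apply_symm_apply, hP, hcY, Algebra.smul_def, map_pow]
  obtain ⟨m, hm⟩ := ne_zero_iff.1 hc0
  obtain ⟨F₁, hF₁, hreg⟩ := exists_mul_mem_map_imp (B := B) (algebraMap S A c) (by
    rwa [Ne, FaithfulSMul.algebraMap_eq_zero_iff])
  -- The last two conclusions are conditional. Where the condition fails, the constant `1` serves as
  -- the open condition, both here and for `F₃`.
  obtain ⟨F₂, hF₂, hfin⟩ : ∃ F : B, F ≠ 0 ∧ ∀ φ : B →+* ℂ,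
      φ.comp (algebraMap ℂ B) = RingHom.id ℂ → φ F ≠ 0 → d = 0 →
      Module.Finite ℂ (A ⧸ (RingHom.ker φ).map (algebraMap B A)) := by
    by_cases hd0 : d = 0
    · have : Algebra.IsAlgebraic B A := by
        rw [← _root_.trdeg_eq_zero_iff, htr, hd0, Nat.cast_zero]
      obtain ⟨F, hF, h⟩ := exists_finite_quotient (B := B) (A := A) (k := ℂ)
      exact ⟨F, hF, fun φ h1 h2 _ => h φ h1 h2⟩
    · exact ⟨1, one_ne_zero, fun _ _ _ h => absurd h hd0⟩
  set E := IntermediateField.adjoin ℂ (Set.range fun q => algebraMap A (FractionRing A) (X q))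
  obtain ⟨F₃, hF₃, hirr⟩ : ∃ F : B, F ≠ 0 ∧ ∀ φ : B →+* ℂ, φ F ≠ 0 →
      (∀ a : FractionRing A, IsAlgebraic E a → a ∈ E) → Irreducible (map φ f) := by
    by_cases hcl : ∀ a : FractionRing A, IsAlgebraic E a → a ∈ E
    · have hcl' : ∀ a : FractionRing A, IsAlgebraic B a → ∃ b c : B, c ≠ 0 ∧
          algebraMap B (FractionRing A) c * a = algebraMap B (FractionRing A) b := by
        intro a ha
        have hXE : ∀ q, algebraMap A (FractionRing A) (X q) ∈ E :=
          fun q => IntermediateField.subset_adjoin _ _ ⟨q, rfl⟩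
        let _ : Algebra B E := (aeval (R := ℂ) fun q => (⟨_, hXE q⟩ : E)).toRingHom.toAlgebra
        have hBE : ∀ P : B, ((algebraMap B E P : E) : FractionRing A) =
            algebraMap A _ (aeval X P) := by
          intro P
          change E.val (aeval _ P) = _
          rw [MvPolynomial.comp_aeval_apply, ← aeval_algebraMap_apply]
          rfl
        have : IsScalarTower B E (FractionRing A) := IsScalarTower.of_algebraMap_eq fun P =>
          (hBE P).symm
        have hinj : Function.Injective (algebraMap B E) := by
          intro P Q hPQ
          have := congrArg (fun z : E => (z : FractionRing A)) hPQ
          simp only [hBE] at this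
          exact hX (IsFractionRing.injective A _ this)
        have hmem := hcl a (ha.extendScalars hinj)
        rw [IntermediateField.mem_adjoin_range_iff] at hmem
        obtain ⟨r, s, hrs⟩ := hmem
        by_cases hs0 : aeval (fun q => algebraMap A (FractionRing A) (X q)) s = 0
        · exact ⟨0, 1, one_ne_zero, by rw [hrs, hs0, div_zero, mul_zero, map_zero]⟩
        · refine ⟨r, s, fun h => hs0 (by rw [h, map_zero]), ?_⟩
          have h2 : ∀ P : B, algebraMap B (FractionRing A) P =
              aeval (fun q => algebraMap A (FractionRing A) (X q)) P := by
            intro P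
            rw [IsScalarTower.algebraMap_apply B A, hBA, ← aeval_algebraMap_apply]
            rfl
          rw [h2, h2, hrs, mul_div_cancel₀ _ hs0]
      obtain ⟨Ω, _, _, _, _, hΩ⟩ := exists_irreducible_map hcl' Y f hf hmonic hmin
      obtain ⟨F, hF, h⟩ := exists_irreducible_specialization f hΩ
      exact ⟨F, hF, fun φ h1 _ => h ℂ φ h1⟩
    · exact ⟨1, one_ne_zero, fun _ _ h => absurd h hcl⟩
  refine ⟨coeff m c * F₁ * F₂ * F₃, mul_ne_zero (mul_ne_zero (mul_ne_zero hm hF₁) hF₂) hF₃,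
    fun x hx => ?_⟩
  simp only [map_mul, mul_ne_zero_iff] at hx
  obtain ⟨⟨⟨hxm, hx1⟩, hx2⟩, hx3⟩ := hx
  have hφk : (eval x).comp (algebraMap ℂ B) = RingHom.id ℂ := by
    ext r
    simp [B]
  have hφ : Function.Surjective (eval x) := fun a => ⟨C a, eval_C a⟩
  have hcφ : map (eval x) c ≠ 0 := fun h => hxm (by
    have := congrArg (coeff m) h
    rwa [coeff_map, coeff_zero] at this)
  rw [← map_ker_eval X x]
  change (RingHom.ker (eval x)).map (algebraMap B A) ≠ ⊤ ∧ _
  refine ⟨map_ker_ne_top hf hmonic he hmin hcs hcφ, hfin _ hφk hx2, fun hcl => ?_⟩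
  have hprime : ((RingHom.ker (eval x)).map (algebraMap B A)).IsPrime := by
    refine isPrime_map_ker hφ hf hmonic he hmin hcs hcφ (fun a ha => ?_) (hirr _ hx3 hcl)
    rw [hcY] at ha
    exact hreg _ (RingHom.ker_isMaximal_of_surjective _ hφ) hx1 a ha
  refine ⟨hprime, ?_⟩
  refine (trdeg_quotient_map_ker hφk hf hmonic he hmin hcs hcφ hprime).trans ?_
  rw [Nat.cast_card, hcard]

end SpohnCI

namespace SpohnCI

/-! ### Regular field extensions -/

open scoped TensorProduct

/-- If `f` is transcendental over `k`, then `f ⊗ 1 - 1 ⊗ f` is not a zero divisor. -/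
theorem eq_zero_of_sub_mul_eq_zero {k E : Type} [Field k] [Field E] [Algebra k E] {f : E}
    (hf : Transcendental k f) (t : E ⊗[k] E)
    (h : (f ⊗ₜ[k] (1 : E) - (1 : E) ⊗ₜ[k] f) * t = 0) : t = 0 := by
  -- Contractions of the second tensor factor. The contractions of `t` form a finite-dimensional
  -- subspace `U` of `E`, which is stable under `f` because `(f ⊗ 1) t = (1 ⊗ f) t`. If `U` were
  -- nonzero, `f` would be algebraic; so all contractions vanish.
  let ctr : (E →ₗ[k] k) →ₗ[k] (E ⊗[k] E) →ₗ[k] E :=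
    { toFun := fun l => (TensorProduct.rid k E).toLinearMap ∘ₗ l.lTensor E
      map_add' := fun l l' => by ext; simp
      map_smul' := fun c l => by ext; simp }
  have hctr : ∀ l a b, ctr l (a ⊗ₜ b) = l b • a := fun l a b => by simp [ctr]
  let U : Submodule k E := LinearMap.range (ctr.flip t)
  have hUfg : U.FG := by
    have key : ∀ t : E ⊗[k] E, ∃ V : Submodule k E, V.FG ∧ ∀ l, ctr l t ∈ V := by
      intro t
      induction t using TensorProduct.induction_on with
      | zero => exact ⟨⊥, Submodule.fg_bot, fun l => by simp⟩
      | tmul a b =>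
        refine ⟨k ∙ a, Submodule.fg_span_singleton a, fun l => ?_⟩
        rw [hctr]
        exact Submodule.smul_mem _ _ (Submodule.mem_span_singleton_self a)
      | add t t' ht ht' =>
        obtain ⟨V, hV, h⟩ := ht
        obtain ⟨V', hV', h'⟩ := ht'
        refine ⟨V ⊔ V', hV.sup hV', fun l => ?_⟩
        rw [map_add]
        exact Submodule.add_mem_sup (h l) (h' l)
    obtain ⟨V, hV, hVt⟩ := key t
    have : Module.Finite k V := Module.Finite.iff_fg.2 hV
    refine Submodule.FG.of_le hV ?_
    rintro _ ⟨l, rfl⟩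
    exact hVt l
  have h1 : ∀ (l : E →ₗ[k] k) (t : E ⊗[k] E),
      ctr l ((f ⊗ₜ[k] (1 : E)) * t) = f * ctr l t := by
    intro l t
    induction t using TensorProduct.induction_on with
    | zero => simp
    | tmul a b =>
      rw [Algebra.TensorProduct.tmul_mul_tmul, hctr, hctr, one_mul, mul_smul_comm]
    | add t t' ht ht' => rw [mul_add, map_add, map_add, ht, ht', mul_add]
  have h2 : ∀ (l : E →ₗ[k] k) (t : E ⊗[k] E),
      ctr l (((1 : E) ⊗ₜ[k] f) * t) = ctr (l ∘ₗ LinearMap.mulLeft k f) t := by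
    intro l t
    induction t using TensorProduct.induction_on with
    | zero => simp
    | tmul a b =>
      rw [Algebra.TensorProduct.tmul_mul_tmul, hctr, hctr, one_mul]
      rfl
    | add t t' ht ht' => rw [mul_add, map_add, map_add, ht, ht']
  have hU : U = ⊥ := by
    by_contra hne
    refine hf (isIntegral_of_smul_mem_submodule (R := k) (A := E) U hne hUfg f ?_).isAlgebraic
    rintro _ ⟨l, rfl⟩
    refine ⟨l ∘ₗ LinearMap.mulLeft k f, ?_⟩
    rw [sub_mul, sub_eq_zero] at h
    change ctr _ t = f • ctr l t
    rw [← h2, ← h, h1, smul_eq_mul]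
  have h0 : ∀ l, ctr l t = 0 := fun l => by
    have : ctr.flip t l ∈ U := ⟨l, rfl⟩
    rwa [hU, Submodule.mem_bot] at this
  let b := Module.Free.chooseBasis k E
  let B := Algebra.TensorProduct.basis E b
  refine B.repr.map_eq_zero_iff.1 (Finsupp.ext fun i => ?_)
  have key : ∀ t, B.repr t i = ctr (b.coord i) t := by
    intro t
    induction t using TensorProduct.induction_on with
    | zero => simp
    | tmul x y => 
      rw [Algebra.TensorProduct.basis_repr_tmul, hctr]
      simp [Algebra.smul_def, mul_comm]
    | add t t' ht ht' => rw [map_add, map_add, Finsupp.add_apply, ht, ht']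
  rw [key, h0, Finsupp.zero_apply]

/-- The kernel of `E ⊗[k] E → E ⊗[k₁] E` for `k₁ = k(f)`. -/
theorem dvd_of_map_eq_zero {k E : Type} [Field k] [Field E] [Algebra k E] (f : E)
    (k₁ : IntermediateField k E) (hk₁ : k₁ ≤ IntermediateField.adjoin k {f}) (t : E ⊗[k] E)
    (ht : Algebra.TensorProduct.mapOfCompatibleSMul k₁ k k E E t = 0) :
    (f ⊗ₜ[k] (1 : E) - (1 : E) ⊗ₜ[k] f) ∣ t := by
  set g := (f ⊗ₜ[k] (1 : E) - (1 : E) ⊗ₜ[k] f)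
  let Q := (E ⊗[k] E) ⧸ Ideal.span {g}
  rw [← Ideal.mem_span_singleton, ← Ideal.Quotient.eq_zero_iff_mem]
  rcases subsingleton_or_nontrivial Q with hQ | hQ
  · exact Subsingleton.elim (α := Q) _ _
  let i₁ : E →ₐ[k] Q := (Ideal.Quotient.mkₐ k (Ideal.span {g})).comp
    Algebra.TensorProduct.includeLeft
  let i₂ : E →ₐ[k] Q := (Ideal.Quotient.mkₐ k (Ideal.span {g})).comp
    Algebra.TensorProduct.includeRight
  -- In the quotient by `g` the two copies of `E` agree on `f`, hence on `k(f)`. So the quotient map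
  -- factors through the tensor product over `k₁`.
  have hle : (IntermediateField.adjoin k {f}).toSubfield ≤
      (i₁ : E →+* Q).eqLocusField (i₂ : E →+* Q) := by
    rw [IntermediateField.adjoin_toSubfield, Subfield.closure_le]
    rintro x (⟨c, rfl⟩ | rfl)
    · change i₁ _ = i₂ _
      rw [AlgHom.commutes, AlgHom.commutes]
    · exact Ideal.Quotient.eq.2 (Ideal.mem_span_singleton_self g)
  have heq : ∀ c : k₁, i₁ (c : E) = i₂ (c : E) := fun c => hle (hk₁ c.2)
  let _ : Algebra k₁ Q := ((i₁ : E →+* Q).comp (algebraMap k₁ E)).toAlgebra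
  let j₁ : E →ₐ[k₁] Q := { (i₁ : E →+* Q) with commutes' := fun c => rfl }
  let j₂ : E →ₐ[k₁] Q := { (i₂ : E →+* Q) with commutes' := fun c => (heq c).symm }
  have hcomp : ∀ s : E ⊗[k] E, Algebra.TensorProduct.productMap j₁ j₂
      (Algebra.TensorProduct.mapOfCompatibleSMul k₁ k k E E s) =
      Ideal.Quotient.mk (Ideal.span {g}) s := by
    intro s
    induction s using TensorProduct.induction_on with
    | zero => simp
    | tmul a b =>
      rw [Algebra.TensorProduct.mapOfCompatibleSMul_tmul,
        Algebra.TensorProduct.productMap_apply_tmul]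
      change Ideal.Quotient.mk _ (a ⊗ₜ 1) * Ideal.Quotient.mk _ (1 ⊗ₜ b) = _
      rw [← map_mul, Algebra.TensorProduct.tmul_mul_tmul, one_mul, mul_one]
    | add s s' hs hs' => rw [map_add, map_add, map_add, hs, hs']
  rw [← hcomp t, ht, map_zero]

/-- Modulo the first element the ring becomes `E ⊗ E` over `k(f₁)`, where the second element is a
nonzerodivisor because `f₂` is transcendental over `k(f₁)`. This is the regular sequence needed for
primality of linear forms. -/
theorem dvd_of_dvd_mul_of_transcendental {k E : Type} [Field k] [Field E] [Algebra k E] (f₁ f₂ : E)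
    (h₂ : Transcendental (IntermediateField.adjoin k {f₁}) f₂) (t : E ⊗[k] E)
    (h : (f₁ ⊗ₜ[k] (1 : E) - (1 : E) ⊗ₜ[k] f₁) ∣ (f₂ ⊗ₜ[k] (1 : E) - (1 : E) ⊗ₜ[k] f₂) * t) :
    (f₁ ⊗ₜ[k] (1 : E) - (1 : E) ⊗ₜ[k] f₁) ∣ t := by
  refine dvd_of_map_eq_zero f₁ _ le_rfl t ?_
  obtain ⟨s, hs⟩ := h
  refine eq_zero_of_sub_mul_eq_zero h₂ _ ?_
  set Φ := Algebra.TensorProduct.mapOfCompatibleSMul (IntermediateField.adjoin k {f₁}) k k E E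
  have hΦt : ∀ a b : E, Φ (a ⊗ₜ b) = a ⊗ₜ b := fun a b => rfl
  have := congrArg Φ hs
  simp only [map_mul, map_sub, hΦt] at this
  rw [this]
  have hself : (f₁ ⊗ₜ[IntermediateField.adjoin k {f₁}] (1 : E)) = (1 : E) ⊗ₜ f₁ := by
    have h3 := TensorProduct.smul_tmul (R := IntermediateField.adjoin k {f₁})
      (⟨f₁, IntermediateField.mem_adjoin_simple_self k f₁⟩ : IntermediateField.adjoin k {f₁})
      (1 : E) (1 : E)
    simpa [Algebra.smul_def] using h3
  rw [hself, sub_self, zero_mul]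

/-- Every element of `E ⊗ E` comes from `R` after multiplication by a unit `a ⊗ b`, so injectivity
of `Ψ` can be tested on the image of `Φ`. The tensor product then embeds into a field. -/
theorem isDomain_tensor_of_fractions {k E Ω R : Type} [Field k] [Field E] [Algebra k E] [Field Ω]
    [CommRing R] (Φ : R →+* E ⊗[k] E) (Ψ : E ⊗[k] E →+* Ω) (S : Subring E)
    (hS₁ : ∀ a ∈ S, ∃ r, Φ r = a ⊗ₜ 1) (hS₂ : ∀ a ∈ S, ∃ r, Φ r = 1 ⊗ₜ a)
    (hfrac : ∀ e : E, ∃ a ∈ S, ∃ b ∈ S, b ≠ 0 ∧ e * b = a)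
    (hΨ : ∀ r, Ψ (Φ r) = 0 → Φ r = 0) : IsDomain (E ⊗[k] E) := by
  have key : ∀ t : E ⊗[k] E, ∃ a ∈ S, ∃ b ∈ S, a ≠ 0 ∧ b ≠ 0 ∧ ∃ r, Φ r = (a ⊗ₜ b) * t := by
    intro t
    induction t using TensorProduct.induction_on with
    | zero => exact ⟨1, S.one_mem, 1, S.one_mem, one_ne_zero, one_ne_zero, 0, by simp⟩
    | tmul x y =>
      obtain ⟨a, ha, b, hb, hb0, hx⟩ := hfrac x
      obtain ⟨a', ha', b', hb', hb0', hy⟩ := hfrac y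
      obtain ⟨r, hr⟩ := hS₁ a ha
      obtain ⟨r', hr'⟩ := hS₂ a' ha'
      refine ⟨b, hb, b', hb', hb0, hb0', r * r', ?_⟩
      rw [map_mul, hr, hr', Algebra.TensorProduct.tmul_mul_tmul,
        Algebra.TensorProduct.tmul_mul_tmul, one_mul, mul_one, mul_comm b, mul_comm b', hx, hy]
    | add t t' ht ht' =>
      obtain ⟨a, ha, b, hb, ha0, hb0, r, hr⟩ := ht
      obtain ⟨a', ha', b', hb', ha0', hb0', r', hr'⟩ := ht'
      obtain ⟨s, hs⟩ := hS₁ a ha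
      obtain ⟨u, hu⟩ := hS₂ b hb
      obtain ⟨s', hs'⟩ := hS₁ a' ha'
      obtain ⟨u', hu'⟩ := hS₂ b' hb'
      refine ⟨a * a', S.mul_mem ha ha', b * b', S.mul_mem hb hb', mul_ne_zero ha0 ha0',
        mul_ne_zero hb0 hb0', s' * u' * r + s * u * r', ?_⟩
      have h1 : (a ⊗ₜ[k] (1 : E)) * ((1 : E) ⊗ₜ[k] b) = a ⊗ₜ b := by simp
      have h2 : (a' ⊗ₜ[k] (1 : E)) * ((1 : E) ⊗ₜ[k] b') = a' ⊗ₜ b' := by simp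
      rw [← Algebra.TensorProduct.tmul_mul_tmul]
      simp only [map_add, map_mul, hr, hr', hs, hs', hu, hu', h1, h2]
      ring
  have hinj : Function.Injective Ψ := by
    rw [injective_iff_map_eq_zero]
    intro t ht
    obtain ⟨a, -, b, -, ha, hb, r, hr⟩ := key t
    have h0 : Φ r = 0 := hΨ r (by rw [hr, map_mul, ht, mul_zero])
    rw [h0] at hr
    have := congrArg (fun z => (a⁻¹ ⊗ₜ[k] b⁻¹) * z) hr
    simp only [mul_zero, ← mul_assoc, Algebra.TensorProduct.tmul_mul_tmul, inv_mul_cancel₀ ha,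
      inv_mul_cancel₀ hb] at this
    rw [← Algebra.TensorProduct.one_def, one_mul] at this
    exact this.symm
  exact hinj.isDomain Ψ

/-- If `E ⊗[k] E` is a domain, then `k` is algebraically closed in `E`. -/
theorem mem_range_of_isAlgebraic {k E : Type} [Field k] [Field E] [Algebra k E]
    [IsDomain (E ⊗[k] E)] (a : E) (ha : IsAlgebraic k a) : a ∈ (algebraMap k E).range := by
  let K := IntermediateField.adjoin k {a}
  have : FiniteDimensional k K := IntermediateField.adjoin.finiteDimensional ha.isIntegral
  have hinj : Function.Injective (Algebra.TensorProduct.map K.val K.val) := by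
    exact TensorProduct.map_injective_of_flat_flat _ _ K.val.injective K.val.injective
  have : IsDomain (K ⊗[k] K) := hinj.isDomain (Algebra.TensorProduct.map K.val K.val)
  -- For `K = k(a)` the finite-dimensional domain `K ⊗ K` is a field. The multiplication to `K` is
  -- then injective, which forces the square of the degree of `K` to be at most the degree.
  have hfield : IsField (K ⊗[k] K) := Algebra.TensorProduct.isField_of_isAlgebraic k K K
    (Or.inl inferInstance)
  let _ : Field (K ⊗[k] K) := hfield.toField
  have hmul : Function.Injective (Algebra.TensorProduct.lmul' k (S := K)) :=
    (Algebra.TensorProduct.lmul' k (S := K) : K ⊗[k] K →+* K).injective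
  have h1 := LinearMap.finrank_le_finrank_of_injective
    (f := (Algebra.TensorProduct.lmul' k (S := K)).toLinearMap) hmul
  have h2 : Module.finrank k (K ⊗[k] K) = Module.finrank k K * Module.finrank k K :=
    Module.finrank_tensorProduct
  have h3 : 0 < Module.finrank k K := Module.finrank_pos
  have h4 : Module.finrank k K = 1 := by
    have : Module.finrank k K * Module.finrank k K ≤ Module.finrank k K := h2 ▸ h1
    nlinarith
  have h5 := IntermediateField.finrank_adjoin_simple_eq_one_iff.1 h4
  exact IntermediateField.mem_bot.1 h5

end SpohnCI

namespace SpohnCI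

/-! ### Linear forms that are prime -/

-- If `a, b` is a regular sequence, `a X + b` generates the kernel of the evaluation `A[X] → Frac A`
-- at `-b / a`, and this kernel is prime.
open Polynomial in
theorem prime_C_mul_X_add_C {A : Type} [CommRing A] [IsDomain A] (a b : A) (ha : a ≠ 0)
    (hb : ∀ c, a ∣ b * c → a ∣ c) : Prime (C a * X + C b) := by
  let K := FractionRing A
  let r : K := IsLocalization.mk' K (-b) ⟨a, mem_nonZeroDivisors_of_ne_zero ha⟩
  have har : algebraMap A K a * r = - algebraMap A K b := by
    have := IsLocalization.mk'_spec' K (-b) ⟨a, mem_nonZeroDivisors_of_ne_zero ha⟩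
    rwa [map_neg] at this
  have hr0 : aeval r (C a * X + C b) = 0 := by
    rw [map_add, map_mul, aeval_C, aeval_C, aeval_X, har, neg_add_cancel]
  have hpow : ∀ (n : ℕ) c, a ∣ b ^ n * c → a ∣ c := by
    intro n
    induction n with
    | zero => intro c hc; simpa using hc
    | succ n ih => exact fun c hc => ih c (hb _ (by rwa [← mul_assoc, ← pow_succ']))
  have key : ∀ (n : ℕ) (P : A[X]), P.natDegree ≤ n → aeval r P = 0 → C a * X + C b ∣ P := by
    intro n
    induction n with
    | zero =>
      intro P hP h0
      rw [eq_C_of_natDegree_le_zero hP, aeval_C] at h0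
      have h1 := (FaithfulSMul.algebraMap_eq_zero_iff A K).1 h0
      rw [eq_C_of_natDegree_le_zero hP, h1, C_0]
      exact dvd_zero _
    | succ n ih =>
      intro P hP h0
      by_cases hPn : P.natDegree ≤ n
      · exact ih P hPn h0
      have hdeg : P.natDegree = n + 1 := by omega
      -- As in the rational root theorem, clearing denominators shows that `a` divides the leading
      -- coefficient times a power of `b`, hence the leading coefficient. Subtracting a multiple of
      -- `a X + b` lowers the degree.
      have hs := scaleRoots_aeval_eq_zero_of_aeval_mk'_eq_zero
        (s := ⟨a, mem_nonZeroDivisors_of_ne_zero ha⟩) h0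
      rw [aeval_algebraMap_apply, FaithfulSMul.algebraMap_eq_zero_iff, coe_aeval_eq_eval,
        eval_eq_sum_range, natDegree_scaleRoots, hdeg, Finset.sum_range_succ] at hs
      simp only [coeff_scaleRoots, hdeg, tsub_self, pow_zero, mul_one] at hs
      have hd1 : a ∣ ∑ x ∈ Finset.range (n + 1), P.coeff x * a ^ (n + 1 - x) * (-b) ^ x := by
        refine Finset.dvd_sum fun x hx => ?_
        have : n + 1 - x ≠ 0 := by have := Finset.mem_range.1 hx; omega
        exact ((dvd_pow_self a this).mul_left _).mul_right _
      have hd2 : a ∣ P.coeff (n + 1) := by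
        refine hpow (n + 1) _ ?_
        rw [add_eq_zero_iff_neg_eq] at hs
        have h2 : a ∣ P.coeff (n + 1) * (-b) ^ (n + 1) := hs ▸ (dvd_neg.2 hd1)
        rw [neg_pow, ← mul_assoc, mul_comm, ← mul_assoc] at h2
        exact (IsUnit.dvd_mul_right ((isUnit_one.neg).pow (n + 1))).1 h2
      obtain ⟨q, hq⟩ := hd2
      have h3 : C a * X + C b ∣ P - C q * X ^ n * (C a * X + C b) := by
        refine ih _ ?_ ?_
        · rw [natDegree_le_iff_coeff_eq_zero]
          intro N hN
          rw [coeff_sub, mul_add, coeff_add,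
            show C q * X ^ n * (C a * X) = C (a * q) * X ^ (n + 1) by rw [C_mul]; ring,
            show C q * X ^ n * C b = C (q * b) * X ^ n by rw [C_mul]; ring,
            coeff_C_mul_X_pow, coeff_C_mul_X_pow, if_neg (by omega : ¬ N = n), add_zero]
          by_cases hN1 : N = n + 1
          · rw [if_pos hN1, hN1, hq, sub_self]
          · rw [if_neg hN1, coeff_eq_zero_of_natDegree_lt (by omega), sub_zero]
        · rw [map_sub, map_mul, hr0, mul_zero, h0, sub_zero]
      exact (dvd_sub_left (Dvd.intro_left _ rfl)).1 h3
  refine ⟨fun h => ha ?_, fun h => ?_, fun P Q hPQ => ?_⟩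
  · simpa using congrArg (fun p => coeff p 1) h
  · obtain ⟨q, hq⟩ := h.exists_right_inv
    have := congrArg (aeval r) hq
    rw [map_mul, hr0, zero_mul, map_one] at this
    exact zero_ne_one this
  · obtain ⟨q, hq⟩ := hPQ
    have := congrArg (aeval r) hq
    rw [map_mul, map_mul, hr0, zero_mul, mul_eq_zero] at this
    exact this.imp (key _ P le_rfl) (key _ Q le_rfl)

-- Descending induction on the coefficients of `c`: in degree `i + 1` the product has coefficient
-- `g₂ * c_i + b * c_{i+1}`, and `c_{i+1}` is already known to be divisible by `g₁`.
open Polynomial in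
theorem C_dvd_of_dvd_linear_mul {R : Type} [CommRing R] (g₁ g₂ b : R)
    (h : ∀ c, g₁ ∣ g₂ * c → g₁ ∣ c) (c : R[X]) (hc : C g₁ ∣ (C g₂ * X + C b) * c) : C g₁ ∣ c := by
  rw [C_dvd_iff_dvd_coeff] at hc ⊢
  have key : ∀ k i, c.natDegree < i + k → g₁ ∣ c.coeff i := by
    intro k
    induction k with
    | zero =>
      intro i hi
      rw [coeff_eq_zero_of_natDegree_lt (by simpa using hi)]
      exact dvd_zero _
    | succ k ih =>
      intro i hi
      have h1 := hc (i + 1)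
      rw [add_mul, mul_assoc, coeff_add, coeff_C_mul, coeff_C_mul, coeff_X_mul] at h1
      exact h _ ((dvd_add_left ((ih (i + 1) (by omega)).mul_left b)).1 h1)
  exact fun i => key (c.natDegree + 1) i (by omega)

open MvPolynomial in
/-- Polynomials in `X i`, `i : J`, as polynomials in `X j` over the polynomials in the other
variables. -/
noncomputable def splitVar {J : Type} [DecidableEq J] (R : Type) [CommRing R] (j : J) :
    MvPolynomial J R ≃ₐ[R] Polynomial (MvPolynomial {i // i ≠ j} R) :=
  (renameEquiv R (Equiv.optionSubtypeNe j).symm).trans (optionEquivLeft R _)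

open MvPolynomial in
theorem splitVar_C {J : Type} [DecidableEq J] {R : Type} [CommRing R] (j : J) (r : R) :
    splitVar R j (C r) = Polynomial.C (C r) := by
  simp [splitVar, optionEquivLeft_C]

open MvPolynomial in
theorem splitVar_sum {J : Type} [DecidableEq J] [Fintype J] {R : Type} [CommRing R] (j : J)
    (g : J → R) : splitVar R j (∑ i, C (g i) * X i) =
      Polynomial.C (C (g j)) * Polynomial.X +
        Polynomial.C (∑ i : {i // i ≠ j}, C (g i) * X i) := by
  have h1 : splitVar R j (X j) = Polynomial.X := by
    simp [splitVar, optionEquivLeft_X_none]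
  have h2 : ∀ i : {i // i ≠ j}, splitVar R j (X i) = Polynomial.C (X i) := by
    intro i
    simp [splitVar, Equiv.optionSubtypeNe_symm_of_ne i.2, optionEquivLeft_X_some]
  rw [← (Equiv.optionSubtypeNe j).sum_comp, Fintype.sum_option, map_add]
  refine congrArg₂ (· + ·) ?_ ?_
  · rw [Equiv.optionSubtypeNe_none, map_mul, splitVar_C, h1]
  · rw [map_sum, map_sum]
    refine Finset.sum_congr rfl fun i _ => ?_
    rw [Equiv.optionSubtypeNe_some, map_mul, splitVar_C, h2, map_mul]

open MvPolynomial in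
theorem C_dvd_of_dvd_sum_mul {J : Type} [Fintype J] {R : Type} [CommRing R] (g₁ : R)
    (g : J → R) (j : J) (h : ∀ c, g₁ ∣ g j * c → g₁ ∣ c) (c : MvPolynomial J R)
    (hc : C g₁ ∣ (∑ i, C (g i) * X i) * c) : C g₁ ∣ c := by
  classical
  rw [← map_dvd_iff (splitVar R j), splitVar_C]
  rw [← map_dvd_iff (splitVar R j), splitVar_C, map_mul, splitVar_sum] at hc
  refine C_dvd_of_dvd_linear_mul _ _ _ (fun c hc => ?_) _ hc
  rw [C_dvd_iff_dvd_coeff] at hc ⊢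
  intro m
  have := hc m
  rw [coeff_C_mul] at this
  exact h _ this

-- Singling out the variable `j₁` gives a linear polynomial with leading coefficient `g j₁`. Its
-- constant term is a linear form containing `g j₂`, which makes it a nonzerodivisor modulo `g j₁`.
open MvPolynomial in
theorem prime_sum_C_mul_X {J : Type} [Fintype J] {R : Type} [CommRing R] [IsDomain R]
    (g : J → R) (j₁ j₂ : J) (hj : j₂ ≠ j₁) (h₁ : g j₁ ≠ 0)
    (h₂ : ∀ c, g j₁ ∣ g j₂ * c → g j₁ ∣ c) :
    Prime (∑ i, C (g i) * X i : MvPolynomial J R) := by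
  classical
  rw [← MulEquiv.prime_iff (splitVar R j₁), splitVar_sum]
  refine prime_C_mul_X_add_C _ _ (C_ne_zero.2 h₁) fun c hc => ?_
  exact C_dvd_of_dvd_sum_mul (g j₁) (fun i : {i // i ≠ j₁} => g i) ⟨j₂, hj⟩ h₂ c hc

end SpohnCI

/-! ### Regularity after adjoining variables and a linear form -/

namespace SpohnCI

open scoped TensorProduct

open MvPolynomial in
theorem isFractionRing_of_adjoin_eq_top {E E' J : Type} [Field E] [Field E'] [Algebra E E']
    (x : J → E') (hx : AlgebraicIndependent E x)
    (hE' : IntermediateField.adjoin E (Set.range x) = ⊤) :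
    @IsFractionRing (MvPolynomial J E) _ E' _ (aeval x : MvPolynomial J E →ₐ[E] E').toAlgebra := by
  let _ : Algebra (MvPolynomial J E) E' := (aeval x : MvPolynomial J E →ₐ[E] E').toAlgebra
  have : FaithfulSMul (MvPolynomial J E) E' := (faithfulSMul_iff_algebraMap_injective _ _).2 hx
  refine IsFractionRing.of_field _ _ fun z => ?_
  have hz : z ∈ IntermediateField.adjoin E (Set.range x) := by rw [hE']; trivial
  rw [IntermediateField.mem_adjoin_range_iff] at hz
  obtain ⟨r, s, h⟩ := hz
  exact ⟨r, s, h⟩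

theorem exists_field_hom_of_prime {R : Type} [CommRing R] {l : R} (hl : Prime l) :
    ∃ (Ω : Type) (_ : Field Ω) (χ : R →+* Ω), ∀ r, χ r = 0 ↔ l ∣ r := by
  have hI : (Ideal.span {l}).IsPrime := (Ideal.span_singleton_prime hl.ne_zero).2 hl
  refine ⟨FractionRing (R ⧸ Ideal.span {l}), inferInstance,
    (algebraMap (R ⧸ Ideal.span {l}) _).comp (Ideal.Quotient.mk (Ideal.span {l})), fun r => ?_⟩
  rw [← Ideal.mem_span_singleton, ← Ideal.Quotient.eq_zero_iff_mem]
  exact FaithfulSMul.algebraMap_eq_zero_iff (R ⧸ Ideal.span {l}) _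

open MvPolynomial in
/-- The regularity of `E / k` passes to `E(x) / k(x, w)`, for `w` a linear form in the variables
`x` with sufficiently general coefficients in `E`. -/
theorem isDomain_tensor_adjoin {k E k' E' J : Type} [Field k] [Field E] [Field k'] [Field E']
    [Algebra k E] [Algebra k k'] [Algebra k' E'] [Algebra E E'] [Algebra k E']
    [IsScalarTower k E E'] [IsScalarTower k k' E'] [Fintype J] [IsDomain (E ⊗[k] E)]
    (x : J → k') (w : k') (f : J → E)
    (hw : algebraMap k' E' w = ∑ j, algebraMap E E' (f j) * algebraMap k' E' (x j))
    (hk' : IntermediateField.adjoin k (insert w (Set.range x)) = ⊤)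
    (hx : AlgebraicIndependent E (fun j => algebraMap k' E' (x j)))
    (hE' : IntermediateField.adjoin E (Set.range fun j => algebraMap k' E' (x j)) = ⊤)
    (j₁ j₂ : J) (hj : j₂ ≠ j₁) (h₁ : Transcendental k (f j₁))
    (h₂ : Transcendental (IntermediateField.adjoin k {f j₁}) (f j₂)) :
    IsDomain (E' ⊗[k'] E') := by
  let D := E ⊗[k] E
  let T := E' ⊗[k'] E'
  -- `E' ⊗ E'` over `k'` is a localization of `D[x] / (l)`: the two copies of each `x j` are
  -- identified, and identifying the two copies of `w = ∑ f_j x_j` is the relation `l = 0`.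
  let g : J → D := fun j => f j ⊗ₜ 1 - 1 ⊗ₜ f j
  let l : MvPolynomial J D := ∑ j, C (g j) * X j
  have hl : Prime l := by
    refine prime_sum_C_mul_X g j₁ j₂ hj (fun h0 => ?_) fun c =>
      dvd_of_dvd_mul_of_transcendental (f j₁) (f j₂) h₂ c
    exact one_ne_zero (eq_zero_of_sub_mul_eq_zero h₁ (1 : D) (by
      change g j₁ * 1 = 0
      rw [h0, zero_mul]))
  obtain ⟨Ω, _, χ, hχ⟩ := exists_field_hom_of_prime hl
  let iL : E →+* D := (Algebra.TensorProduct.includeLeft : E →ₐ[k] D)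
  let iR : E →+* D := (Algebra.TensorProduct.includeRight : E →ₐ[k] D)
  let mul : D →+* E := (Algebra.TensorProduct.lmul' k (S := E) : D →ₐ[k] E)
  -- The multiplication `D → E` kills `l`, so it induces a retraction of both maps from `E[x]` to
  -- `D[x] / (l)`. These maps are therefore injective and extend to the fraction field `E'`.
  have hml : map mul l = 0 := by
    rw [map_sum]
    refine Finset.sum_eq_zero fun j _ => ?_
    rw [map_mul, map_C]
    have : mul (g j) = 0 := by
      change Algebra.TensorProduct.lmul' k (S := E) (f j ⊗ₜ 1 - 1 ⊗ₜ f j) = 0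
      rw [map_sub, Algebra.TensorProduct.lmul'_apply_tmul, Algebra.TensorProduct.lmul'_apply_tmul,
        one_mul, mul_one, sub_self]
    rw [this, C_0, zero_mul]
  have hinj : ∀ i : E →+* D, mul.comp i = RingHom.id E →
      Function.Injective (χ.comp (map (σ := J) i)) := by
    intro i hi
    rw [injective_iff_map_eq_zero]
    intro P hP
    obtain ⟨q, hq⟩ := (hχ _).1 hP
    have := congrArg (map mul) hq
    rwa [map_map, hi, map_id, map_mul, hml, zero_mul] at this
  have hiL : mul.comp iL = RingHom.id E := by
    ext e
    exact (Algebra.TensorProduct.lmul'_apply_tmul e 1).trans (mul_one e)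
  have hiR : mul.comp iR = RingHom.id E := by
    ext e
    exact (Algebra.TensorProduct.lmul'_apply_tmul 1 e).trans (one_mul e)
  let x' : J → E' := fun j => algebraMap k' E' (x j)
  let _ : Algebra (MvPolynomial J E) E' := (aeval x' : MvPolynomial J E →ₐ[E] E').toAlgebra
  have hEx : ∀ P : MvPolynomial J E, algebraMap (MvPolynomial J E) E' P = aeval x' P :=
    fun _ => rfl
  have hfr : IsFractionRing (MvPolynomial J E) E' := isFractionRing_of_adjoin_eq_top x' hx hE'
  let σ₁ : E' →+* Ω := IsFractionRing.lift (hinj iL hiL)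
  let σ₂ : E' →+* Ω := IsFractionRing.lift (hinj iR hiR)
  have hσ₁ : ∀ P : MvPolynomial J E, σ₁ (aeval x' P) = χ (map iL P) := fun P =>
    IsFractionRing.lift_algebraMap (hinj iL hiL) P
  have hσ₂ : ∀ P : MvPolynomial J E, σ₂ (aeval x' P) = χ (map iR P) := fun P =>
    IsFractionRing.lift_algebraMap (hinj iR hiR) P
  have hσE₁ : ∀ e : E, σ₁ (algebraMap E E' e) = χ (C (e ⊗ₜ 1)) := fun e => by
    have := hσ₁ (C e)
    rwa [aeval_C, map_C] at this
  have hσE₂ : ∀ e : E, σ₂ (algebraMap E E' e) = χ (C (1 ⊗ₜ e)) := fun e => by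
    have := hσ₂ (C e)
    rwa [aeval_C, map_C] at this
  have hσx₁ : ∀ j, σ₁ (x' j) = χ (X j) := fun j => by
    have := hσ₁ (X j)
    rwa [aeval_X, map_X] at this
  have hσx₂ : ∀ j, σ₂ (x' j) = χ (X j) := fun j => by
    have := hσ₂ (X j)
    rwa [aeval_X, map_X] at this
  -- It suffices to compare the two embeddings of `E'` on generators of `k'`; on `w` they differ by
  -- the image of `l`.
  have hagree : ∀ c : k', σ₁ (algebraMap k' E' c) = σ₂ (algebraMap k' E' c) := by
    have hle : (IntermediateField.adjoin k (insert w (Set.range x))).toSubfield ≤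
        (σ₁.comp (algebraMap k' E')).eqLocusField (σ₂.comp (algebraMap k' E')) := by
      rw [IntermediateField.adjoin_toSubfield, Subfield.closure_le]
      rintro y (⟨c, rfl⟩ | rfl | ⟨j, rfl⟩)
      · change σ₁ _ = σ₂ _
        rw [← IsScalarTower.algebraMap_apply k k' E', IsScalarTower.algebraMap_apply k E E',
          hσE₁, hσE₂]
        congr 2
        rw [Algebra.algebraMap_eq_smul_one, TensorProduct.smul_tmul]
      · change σ₁ _ = σ₂ _
        rw [hw, map_sum, map_sum, ← sub_eq_zero, ← Finset.sum_sub_distrib]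
        rw [← (hχ l).2 dvd_rfl, map_sum]
        refine Finset.sum_congr rfl fun j _ => ?_
        rw [map_mul, map_mul, hσE₁, hσE₂]
        change _ * σ₁ (x' j) - _ * σ₂ (x' j) = _
        rw [hσx₁, hσx₂, ← sub_mul, ← map_sub, ← map_sub, ← map_mul]
      · change σ₁ (x' j) = σ₂ (x' j)
        rw [hσx₁, hσx₂]
    rw [hk'] at hle
    exact fun c => hle (show c ∈ (⊤ : IntermediateField k k') from trivial)
  let _ : Algebra k' Ω := (σ₁.comp (algebraMap k' E')).toAlgebra
  let s₁ : E' →ₐ[k'] Ω := { σ₁ with commutes' := fun c => rfl }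
  let s₂ : E' →ₐ[k'] Ω := { σ₂ with commutes' := fun c => (hagree c).symm }
  let Ψ : T →ₐ[k'] Ω := Algebra.TensorProduct.productMap s₁ s₂
  have hΨt : ∀ a b : E', Ψ (a ⊗ₜ b) = σ₁ a * σ₂ b := fun a b =>
    Algebra.TensorProduct.productMap_apply_tmul s₁ s₂ a b
  let ΦD : D →+* T := ((Algebra.TensorProduct.mapOfCompatibleSMul k' k k E' E' :
    E' ⊗[k] E' →ₐ[k] T) : E' ⊗[k] E' →+* T).comp
      (Algebra.TensorProduct.map (IsScalarTower.toAlgHom k E E') (IsScalarTower.toAlgHom k E E') :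
        D →ₐ[k] E' ⊗[k] E')
  have hΦD : ∀ a b : E, ΦD (a ⊗ₜ b) = algebraMap E E' a ⊗ₜ algebraMap E E' b := fun a b => rfl
  let Φ : MvPolynomial J D →+* T := eval₂Hom ΦD fun j => x' j ⊗ₜ 1
  have hswap : ∀ c : k', (algebraMap k' E' c) ⊗ₜ[k'] (1 : E') = 1 ⊗ₜ (algebraMap k' E' c) := by
    intro c
    rw [Algebra.algebraMap_eq_smul_one, TensorProduct.smul_tmul]
  have hΨΦ : ∀ r, Ψ (Φ r) = χ r := by
    have : (Ψ : T →+* Ω).comp Φ = χ := by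
      refine MvPolynomial.ringHom_ext (fun d => ?_) (fun j => ?_)
      · induction d using TensorProduct.induction_on with
        | zero => simp
        | tmul a b =>
          simp only [RingHom.coe_comp, Function.comp_apply, Φ, coe_eval₂Hom, eval₂_C, hΦD,
            RingHom.coe_coe, hΨt, hσE₁, hσE₂]
          rw [← map_mul, ← map_mul, Algebra.TensorProduct.tmul_mul_tmul, mul_one, one_mul]
        | add a b ha hb => rw [map_add, map_add, ha, hb, map_add]
      · simp only [RingHom.coe_comp, Function.comp_apply, Φ, coe_eval₂Hom, eval₂_X,
          RingHom.coe_coe, hΨt, map_one, mul_one, hσx₁]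
    exact fun r => congrArg (fun ψ => ψ r) this
  have hΦl : Φ l = 0 := by
    have : Φ l = (algebraMap k' E' w) ⊗ₜ 1 - 1 ⊗ₜ (algebraMap k' E' w) := by
      rw [hw, TensorProduct.sum_tmul, TensorProduct.tmul_sum, ← Finset.sum_sub_distrib, map_sum]
      refine Finset.sum_congr rfl fun j _ => ?_
      simp only [map_mul, Φ, coe_eval₂Hom, eval₂_C, eval₂_X, g, map_sub, hΦD, map_one, sub_mul,
        x']
      have e₁ : ∀ a c : E', (a ⊗ₜ[k'] (1 : E')) * (c ⊗ₜ[k'] (1 : E')) = (a * c) ⊗ₜ 1 :=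
        fun a c => by rw [Algebra.TensorProduct.tmul_mul_tmul, mul_one]
      have e₂ : ∀ a c : E', ((1 : E') ⊗ₜ[k'] a) * ((1 : E') ⊗ₜ[k'] c) = 1 ⊗ₜ (a * c) :=
        fun a c => by rw [Algebra.TensorProduct.tmul_mul_tmul, mul_one]
      rw [e₁, hswap (x j), e₂]
    rw [this, hswap, sub_self]
  refine isDomain_tensor_of_fractions Φ (Ψ : T →+* Ω)
    ((aeval x' : MvPolynomial J E →ₐ[E] E') : MvPolynomial J E →+* E').range ?_ ?_ ?_ ?_
  · rintro _ ⟨P, rfl⟩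
    refine ⟨map iL P, ?_⟩
    induction P using MvPolynomial.induction_on with
    | C r => simp [Φ, iL, hΦD]
    | add p q hp hq => rw [map_add, map_add, hp, hq, map_add, TensorProduct.add_tmul]
    | mul_X p j hp =>
      rw [map_mul, map_mul, hp, map_mul, map_X]
      simp [Φ]
  · rintro _ ⟨P, rfl⟩
    refine ⟨map iR P, ?_⟩
    induction P using MvPolynomial.induction_on with
    | C r => simp [Φ, iR, hΦD]
    | add p q hp hq => rw [map_add, map_add, hp, hq, map_add, TensorProduct.tmul_add]
    | mul_X p j hp =>
      rw [map_mul, map_mul, hp, map_mul, map_X]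
      simp [Φ, x', hswap]
  · intro e
    obtain ⟨a, b, hb, h⟩ := IsFractionRing.div_surjective (A := MvPolynomial J E) e
    have hb0 : aeval x' b ≠ 0 := by
      rw [← hEx]
      exact IsFractionRing.to_map_ne_zero_of_mem_nonZeroDivisors hb
    refine ⟨aeval x' a, ⟨a, rfl⟩, aeval x' b, ⟨b, rfl⟩, hb0, ?_⟩
    rw [← h, hEx, hEx, div_mul_cancel₀ _ hb0]
  · intro r hr
    have h0 : χ r = 0 := (hΨΦ r).symm.trans hr
    obtain ⟨q, rfl⟩ := (hχ r).1 h0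
    rw [map_mul, hΦl, zero_mul]

-- `E ⊗ E` is a localization of the polynomial ring in two copies of the variables.
open MvPolynomial in
theorem isDomain_tensor_of_purelyTranscendental {k E J : Type} [Field k] [Field E] [Algebra k E]
    (x : J → E) (hx : AlgebraicIndependent k x)
    (hE : IntermediateField.adjoin k (Set.range x) = ⊤) : IsDomain (E ⊗[k] E) := by
  let Ω := FractionRing (MvPolynomial (J ⊕ J) k)
  let _ : Algebra (MvPolynomial J k) E := (aeval x : MvPolynomial J k →ₐ[k] E).toAlgebra
  have hEx : ∀ P : MvPolynomial J k, algebraMap (MvPolynomial J k) E P = aeval x P :=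
    fun _ => rfl
  have : IsScalarTower k (MvPolynomial J k) E := IsScalarTower.of_algebraMap_eq fun c => by
    rw [hEx, algebraMap_eq, aeval_C]
  have hfr : IsFractionRing (MvPolynomial J k) E := isFractionRing_of_adjoin_eq_top x hx hE
  have hinj : ∀ i : J → J ⊕ J, Function.Injective i → Function.Injective
      ((IsScalarTower.toAlgHom k (MvPolynomial (J ⊕ J) k) Ω).comp (rename i) : MvPolynomial J k →ₐ[k] Ω) := fun i hi =>
    (IsFractionRing.injective (MvPolynomial (J ⊕ J) k) Ω).comp (rename_injective i hi)
  let s : ∀ i : J → J ⊕ J, Function.Injective i → (E →ₐ[k] Ω) := fun i hi =>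
    IsFractionRing.liftAlgHom (hinj i hi)
  have hs : ∀ i hi (P : MvPolynomial J k), s i hi (aeval x P) = algebraMap (MvPolynomial (J ⊕ J) k) Ω (rename i P) :=
    fun i hi P => IsFractionRing.lift_algebraMap (hinj i hi) P
  let Ψ : E ⊗[k] E →ₐ[k] Ω :=
    Algebra.TensorProduct.productMap (s _ Sum.inl_injective) (s _ Sum.inr_injective)
  let Φ : MvPolynomial (J ⊕ J) k →ₐ[k] E ⊗[k] E := aeval (Sum.elim (fun j => x j ⊗ₜ 1) (fun j => 1 ⊗ₜ x j))
  have hΨΦ : ∀ r, Ψ (Φ r) = algebraMap (MvPolynomial (J ⊕ J) k) Ω r := by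
    have : Ψ.comp Φ = IsScalarTower.toAlgHom k (MvPolynomial (J ⊕ J) k) Ω := by
      refine MvPolynomial.algHom_ext fun j => ?_
      have h1 : ∀ i hi j, s i hi (x j) = algebraMap (MvPolynomial (J ⊕ J) k) Ω (X (i j)) := fun i hi j => by
        have := hs i hi (X j)
        rwa [aeval_X, rename_X] at this
      cases j <;> simp [Φ, Ψ, h1]
    exact fun r => congrArg (fun ψ => ψ r) this
  refine isDomain_tensor_of_fractions (Φ : MvPolynomial (J ⊕ J) k →+* _) (Ψ : _ →+* Ω)
    ((aeval x : MvPolynomial J k →ₐ[k] E) : MvPolynomial J k →+* E).range ?_ ?_ ?_ ?_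
  · rintro _ ⟨P, rfl⟩
    refine ⟨rename Sum.inl P, ?_⟩
    have : Φ.comp (rename Sum.inl) = Algebra.TensorProduct.includeLeft.comp (aeval x) := by
      refine MvPolynomial.algHom_ext fun j => ?_
      simp [Φ]
    exact congrArg (fun ψ => ψ P) this
  · rintro _ ⟨P, rfl⟩
    refine ⟨rename Sum.inr P, ?_⟩
    have : Φ.comp (rename Sum.inr) = Algebra.TensorProduct.includeRight.comp (aeval x) := by
      refine MvPolynomial.algHom_ext fun j => ?_
      simp [Φ]
    exact congrArg (fun ψ => ψ P) this
  · intro e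
    obtain ⟨a, b, hb, h⟩ := IsFractionRing.div_surjective (A := MvPolynomial J k) e
    have hb0 : aeval x b ≠ 0 := by
      rw [← hEx]
      exact IsFractionRing.to_map_ne_zero_of_mem_nonZeroDivisors hb
    refine ⟨aeval x a, ⟨a, rfl⟩, aeval x b, ⟨b, rfl⟩, hb0, ?_⟩
    rw [← h, hEx, hEx, div_mul_cancel₀ _ hb0]
  · intro r hr
    have h0 : algebraMap (MvPolynomial (J ⊕ J) k) Ω r = 0 := (hΨΦ r).symm.trans hr
    rw [FaithfulSMul.algebraMap_eq_zero_iff] at h0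
    rw [h0, map_zero]

end SpohnCI

namespace SpohnCI

open MvPolynomial in
/-- A linear form in independent variables is independent of the variables over `k` if one of its
coefficients is transcendental over `k`. -/
theorem algebraicIndependent_option_linear {k E E' J : Type} [Field k] [Field E] [Field E']
    [Algebra k E] [Algebra E E'] [Algebra k E'] [IsScalarTower k E E'] [Fintype J] (x : J → E')
    (hx : AlgebraicIndependent E x) (f : J → E) (j₁ : J) (h₁ : Transcendental k (f j₁)) :
    AlgebraicIndependent k
      (fun o : Option J => o.elim (∑ j, algebraMap E E' (f j) * x j) x) := by
  classical
  let _ : Algebra (MvPolynomial J k) (MvPolynomial J E) := (MvPolynomial.map (algebraMap k E)).toAlgebra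
  have hRM : ∀ P : (MvPolynomial J k), algebraMap (MvPolynomial J k) (MvPolynomial J E) P = map (algebraMap k E) P := fun _ => rfl
  have hRinj : Function.Injective (algebraMap (MvPolynomial J k) (MvPolynomial J E)) :=
    map_injective _ (algebraMap k E).injective
  let W : MvPolynomial J E := ∑ j, C (f j) * X j
  have hCf : Transcendental (MvPolynomial J k) (C (f j₁) : MvPolynomial J E) := by
    rw [transcendental_iff]
    intro q hq
    ext i m
    have hm : Polynomial.aeval (f j₁) (∑ i ∈ q.support, Polynomial.monomial i (coeff m (q.coeff i)))
        = 0 := by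
      have := congrArg (coeff m) hq
      rw [Polynomial.aeval_eq_sum_range, coeff_sum, coeff_zero] at this
      rw [← this, map_sum, Finset.sum_subset (Polynomial.supp_subset_range_natDegree_succ)]
      · refine Finset.sum_congr rfl fun i _ => ?_
        rw [Polynomial.aeval_monomial, Algebra.smul_def, hRM, ← C_pow, mul_comm (map _ _),
          coeff_C_mul, coeff_map, mul_comm]
      · intro i _ hi
        rw [Polynomial.notMem_support_iff.1 hi, coeff_zero, map_zero, map_zero]
    have h0 := (transcendental_iff.1 h₁) _ hm
    have := congrArg (fun p => Polynomial.coeff p i) h0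
    simp only [Polynomial.finsetSum_coeff, Polynomial.coeff_monomial, Polynomial.coeff_zero] at this
    rw [Finset.sum_ite_eq'] at this
    rw [Polynomial.coeff_zero, coeff_zero]
    split_ifs at this with hi
    · exact this
    · rw [Polynomial.notMem_support_iff.1 hi, coeff_zero]
  have hW : Transcendental (MvPolynomial J k) W := by
    intro hW
    -- The translation `x_{j₁} ↦ x_{j₁} + 1` preserves `k[x]` and changes `W` by `f j₁`. If `W` were
    -- algebraic over `k[x]`, so would be its translate, and hence the difference `f j₁`.
    let σ : MvPolynomial J E →ₐ[E] MvPolynomial J E := aeval fun j => X j + if j = j₁ then 1 else 0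
    let τ : (MvPolynomial J k) →ₐ[k] MvPolynomial J k := aeval fun j => X j + if j = j₁ then 1 else 0
    let τ' : (MvPolynomial J k) →ₐ[k] MvPolynomial J k := aeval fun j => X j - if j = j₁ then 1 else 0
    have hτ : τ'.comp τ = AlgHom.id k (MvPolynomial J k) := by
      refine MvPolynomial.algHom_ext fun j => ?_
      by_cases h : j = j₁ <;> simp [τ, τ', h]
    have hτi : Function.Injective τ := Function.LeftInverse.injective (g := τ')
      fun P => congrArg (fun ψ => ψ P) hτ
    have hcomm : (algebraMap (MvPolynomial J k) (MvPolynomial J E)).comp (τ : MvPolynomial J k →+* MvPolynomial J k) =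
        (σ : MvPolynomial J E →+* MvPolynomial J E).comp (algebraMap (MvPolynomial J k) (MvPolynomial J E)) := by
      refine MvPolynomial.ringHom_ext (fun r => ?_) (fun j => ?_)
      · simp [hRM, σ, τ]
      · by_cases h : j = j₁ <;> simp [hRM, σ, τ, h]
    have h2 : IsAlgebraic (MvPolynomial J k) (σ W) := hW.ringHom_of_comp_eq (τ : MvPolynomial J k →+* MvPolynomial J k)
      (σ : MvPolynomial J E →+* MvPolynomial J E) hτi hcomm
    have h3 : σ W = W + C (f j₁) := by
      simp only [W, map_sum, map_mul, σ, aeval_X, mul_add, Finset.sum_add_distrib, mul_ite, mul_one,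
        mul_zero, Finset.sum_ite_eq', Finset.mem_univ, if_true, algHom_C, algebraMap_eq]
    rw [h3] at h2
    have h4 := h2.sub hW
    rw [add_sub_cancel_left] at h4
    exact hCf h4
  have hind : AlgebraicIndependent k (fun o : Option J => o.elim W X) := by
    have : IsScalarTower k (MvPolynomial J k) (MvPolynomial J E) := IsScalarTower.of_algebraMap_eq fun c => by
      rw [hRM, algebraMap_eq, map_C]
      rfl
    rw [algebraicIndependent_iff]
    intro P hP
    have hY : (aeval (fun o : Option J => o.elim W X) : MvPolynomial (Option J) k →ₐ[k] _) =
        ((Polynomial.aeval (R := MvPolynomial J k) W).restrictScalars k).comp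
          (optionEquivLeft k J : MvPolynomial (Option J) k →ₐ[k] Polynomial (MvPolynomial J k)) := by
      refine MvPolynomial.algHom_ext fun i => ?_
      cases i with
      | none => simp [optionEquivLeft_X_none]
      | some i => simp [optionEquivLeft_X_some, hRM]
    have h1 : Polynomial.aeval W (optionEquivLeft k J P) = 0 := by
      rw [← hP, hY]
      rfl
    have h2 := (transcendental_iff.1 hW) _ h1
    exact (map_eq_zero_iff _ (optionEquivLeft k J).injective).1 h2
  have hfinal := hind.map' (f := (aeval x : MvPolynomial J E →ₐ[E] E').restrictScalars k) hx
  convert hfinal using 1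
  funext o
  cases o with
  | none => simp [W]
  | some j => simp

end SpohnCI

namespace SpohnCI

/-! ### A tower of regular extensions -/

open scoped TensorProduct IntermediateField.algebraAdjoinAdjoin

theorem algebraicIndependent_adjoin_field {k L ι : Type} [Field k] [Field L] [Algebra k L]
    {s : Set L} {y : ι → L} (h : AlgebraicIndependent (Algebra.adjoin k s) y) :
    AlgebraicIndependent (IntermediateField.adjoin k s) y :=
  h.extendScalars (IntermediateField.adjoin k s)

theorem transcendental_adjoin_field {k L : Type} [Field k] [Field L] [Algebra k L]
    {s : Set L} {y : L} (h : Transcendental (Algebra.adjoin k s) y) :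
    Transcendental (IntermediateField.adjoin k s) y :=
  h.extendScalars (IntermediateField.adjoin k s)

theorem isAlgebraic_adjoin_of_mem {k L : Type} [Field k] [Field L] [Algebra k L]
    {s : Set L} {a : L} (h : a ∈ IntermediateField.adjoin k s) :
    IsAlgebraic (Algebra.adjoin k s) a := by
  have h1 := (Algebra.IsAlgebraic.isAlgebraic (R := Algebra.adjoin k s)
    (⟨a, h⟩ : IntermediateField.adjoin k s))
  exact h1.algebraMap (A := L)

theorem adjoin_preimage_eq_top {k L : Type} [Field k] [Field L] [Algebra k L]
    {K K' : IntermediateField k L} (hle : K ≤ K') (s : Set K')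
    (h : K' ≤ IntermediateField.adjoin k ((K : Set L) ∪ Subtype.val '' s)) :
    @IntermediateField.adjoin K _ K' _ (IntermediateField.inclusion hle).toRingHom.toAlgebra s
      = ⊤ := by
  let _ : Algebra K K' := (IntermediateField.inclusion hle).toRingHom.toAlgebra
  have hle' : IntermediateField.adjoin k ((K : Set L) ∪ Subtype.val '' s) ≤ K' := by
    rw [IntermediateField.adjoin_le_iff]
    rintro a (ha | ⟨b, -, rfl⟩)
    · exact hle ha
    · exact b.2
  rw [eq_top_iff]
  rintro ⟨a, ha⟩ -
  have key : ∀ a (ha : a ∈ IntermediateField.adjoin k ((K : Set L) ∪ Subtype.val '' s)),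
      (⟨a, hle' ha⟩ : K') ∈ IntermediateField.adjoin K s := by
    intro a ha
    induction ha using IntermediateField.adjoin_induction with
    | mem b hb =>
      rcases hb with hb | ⟨c, hc, rfl⟩
      · exact IntermediateField.algebraMap_mem (IntermediateField.adjoin K s) (⟨b, hb⟩ : K)
      · exact IntermediateField.subset_adjoin K s hc
    | algebraMap c =>
      exact IntermediateField.algebraMap_mem (IntermediateField.adjoin K s)
        (algebraMap k K c)
    | add b c hb hc hb' hc' => exact add_mem hb' hc'
    | inv b hb hb' => exact inv_mem hb'
    | mul b c hb hc hb' hc' => exact mul_mem hb' hc'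
  exact key a (h ha)

section tower

variable {L : Type} [Field L] [Algebra ℂ L] {n m : ℕ} {J : Type}

/-- The variables `x (i, j)` together with the linear forms `w i`. -/
def extendedFamily (x : Fin n × J → L) (w : Fin n → L) (q : Fin n × Option J) : L :=
  q.2.elim (w q.1) fun j => x (q.1, j)

theorem ncard_prod_lt (i : ℕ) (hi : i ≤ n) (T : Type) [Fintype T] :
    {q : Fin n × T | q.1.val < i}.ncard = i * Fintype.card T := by
  have : {q : Fin n × T | q.1.val < i} = {a : Fin n | a.val < i} ×ˢ Set.univ := by
    ext q; simp
  rw [this, Set.ncard_prod, Set.ncard_univ, Nat.card_eq_fintype_card]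
  congr 1
  have h2 : Set.range (Fin.castLE hi) = {a : Fin n | a.val < i} := by
    ext a
    exact ⟨by rintro ⟨b, rfl⟩; exact b.2, fun h => ⟨⟨a, h⟩, rfl⟩⟩
  rw [← h2, ← Set.image_univ, Set.ncard_image_of_injective _ (Fin.castLE_injective hi),
    Set.ncard_univ, Nat.card_eq_fintype_card, Fintype.card_fin]

theorem ncard_prod_ge (i : ℕ) (hi : i ≤ n) (T : Type) [Fintype T] :
    {q : Fin n × T | i ≤ q.1.val}.ncard + i * Fintype.card T = n * Fintype.card T := by
  rw [← ncard_prod_lt i hi T, ← Set.ncard_union_eq]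
  · have : {q : Fin n × T | i ≤ q.1.val} ∪ {q | q.1.val < i} = Set.univ := by
      ext q
      simp [le_or_gt]
    rw [this, Set.ncard_univ, Nat.card_eq_fintype_card, Fintype.card_prod, Fintype.card_fin]
  · rw [Set.disjoint_left]
    intro q h1 h2
    simp only [Set.mem_ofPred_eq] at h1 h2
    omega

variable {z : Fin m → L} {x : Fin n × J → L} {w : Fin n → L} {f : Fin n → J → L}

/-- A count in `L`, which has transcendence degree `m + n |J|`. It is algebraic over the set `S`
consisting of the payoffs `T` of the earlier players (at most `i (|J| + 1)` elements), the
coefficients of player `i`, the free payoffs of the players from `i` on (at most `(n - i) |J|`), and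
possibly `t`. Extending `T` to a transcendence basis inside `S` leaves at least `m + 1 - n`
coefficients in the basis. -/
theorem exists_independent_coeffs [Fintype J] (hn : n ≠ 1)
    (hind : AlgebraicIndependent ℂ (Sum.elim z x))
    (hgen : IntermediateField.adjoin ℂ (Set.range (Sum.elim z x)) = ⊤)
    (hrank : ∀ i, ∃ t, (∀ l, IsAlgebraic (Algebra.adjoin ℂ (Set.range (f i) ∪ {t})) (z l)) ∧
      (0 < i.val → IsAlgebraic (Algebra.adjoin ℂ
        (extendedFamily x w '' {q | q.1.val < i.val} ∪ Set.range (f i))) t))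
    (i : Fin n) (hi : AlgebraicIndepOn ℂ (extendedFamily x w) {q | q.1.val < i.val}) :
    ∃ V : Set L, V ⊆ Set.range (f i) ∧ m + 1 ≤ n + V.ncard ∧
      AlgebraicIndependent
        (IntermediateField.adjoin ℂ (extendedFamily x w '' {q | q.1.val < i.val}))
        ((↑) : V → L) := by
  classical
  obtain ⟨t, ht, ht'⟩ := hrank i
  set T := extendedFamily x w '' {q | q.1.val < i.val} with hT
  -- The element `t` has to be added for the first player only; for the others it is algebraic over
  -- earlier payoffs and the coefficients.
  let e : Set L := if i.val = 0 then {t} else ∅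
  let Xs : Set L := x '' {q | i.val ≤ q.1.val}
  let S : Set L := T ∪ Set.range (f i) ∪ e ∪ Xs
  have hcl : ∀ {s : Set L} {a : L}, s ⊆ S → IsAlgebraic (Algebra.adjoin ℂ s) a →
      IsAlgebraic (Algebra.adjoin ℂ S) a := fun hs ha => by
    refine IsAlgebraic.adjoin_of_forall_isAlgebraic (fun y hy => absurd (hs hy.1) hy.2) ha
  have hmem : ∀ {a : L}, a ∈ S → IsAlgebraic (Algebra.adjoin ℂ S) a := fun {a} ha =>
    isAlgebraic_algebraMap (⟨a, Algebra.subset_adjoin ha⟩ : Algebra.adjoin ℂ S)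
  have htS : IsAlgebraic (Algebra.adjoin ℂ S) t := by
    by_cases h0 : i.val = 0
    · exact hmem (Or.inl (Or.inr (by simp [e, h0])))
    · exact hcl (fun a ha => Or.inl (Or.inl ha)) (ht' (Nat.pos_of_ne_zero h0))
  have hzS : ∀ l, IsAlgebraic (Algebra.adjoin ℂ S) (z l) := fun l => by
    refine IsAlgebraic.adjoin_of_forall_isAlgebraic ?_ (ht l)
    rintro y ⟨hy | rfl, -⟩
    · exact hmem (Or.inl (Or.inl (Or.inr hy)))
    · exact htS
  have hxS : ∀ q, IsAlgebraic (Algebra.adjoin ℂ S) (x q) := fun q => by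
    by_cases hq : i.val ≤ q.1.val
    · exact hmem (Or.inr ⟨q, hq, rfl⟩)
    · exact hmem (Or.inl (Or.inl (Or.inl ⟨(q.1, some q.2), not_le.1 hq, rfl⟩)))
  have hall : Algebra.IsAlgebraic (Algebra.adjoin ℂ S) L := by
    refine ⟨fun a => ?_⟩
    refine IsAlgebraic.adjoin_of_forall_isAlgebraic ?_
      (isAlgebraic_adjoin_of_mem (s := Set.range (Sum.elim z x)) (by rw [hgen]; trivial))
    rintro _ ⟨⟨l | q, rfl⟩, -⟩
    · exact hzS l
    · exact hxS q
  have hTi : AlgebraicIndepOn ℂ id T := by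
    have := hi.to_subtype_range
    rwa [← Set.image_eq_range] at this
  obtain ⟨u, hTu, huS, hu⟩ := exists_isTranscendenceBasis_between T S
    (fun a ha => Or.inl (Or.inl (Or.inl ha))) hTi
  let V : Set L := (u \ T) ∩ Set.range (f i)
  refine ⟨V, Set.inter_subset_right, ?_, ?_⟩
  · have hbasis : IsTranscendenceBasis ℂ (Sum.elim z x) := by
      refine hind.isTranscendenceBasis_iff_isAlgebraic.2 ⟨fun a => ?_⟩
      exact isAlgebraic_adjoin_of_mem (by rw [hgen]; trivial)
    have hcard : Nat.card u = m + n * Fintype.card J := by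
      rw [Nat.card_congr (Cardinal.eq.1 (hu.cardinalMk_eq hbasis)).some,
        Nat.card_eq_fintype_card]
      simp
    have hTfin : T.Finite := Set.toFinite _
    have hXfin : Xs.Finite := Set.toFinite _
    have hVfin : V.Finite := (Set.finite_range (f i)).subset Set.inter_subset_right
    have hefin : e.Finite := by
      by_cases h0 : i.val = 0 <;> simp [e, h0]
    have hsub : u ⊆ T ∪ V ∪ e ∪ Xs := by
      intro a ha
      rcases huS ha with ((h | h) | h) | h
      · exact Or.inl (Or.inl (Or.inl h))
      · by_cases haT : a ∈ T
        · exact Or.inl (Or.inl (Or.inl haT))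
        · exact Or.inl (Or.inl (Or.inr ⟨⟨ha, haT⟩, h⟩))
      · exact Or.inl (Or.inr h)
      · exact Or.inr h
    have h1 := Set.ncard_le_ncard hsub (((hTfin.union hVfin).union hefin).union hXfin)
    rw [← Nat.card_coe_set_eq u, hcard] at h1
    have h2 := Set.ncard_union_le (T ∪ V ∪ e) Xs
    have h3 := Set.ncard_union_le (T ∪ V) e
    have h4 := Set.ncard_union_le T V
    have h5 : T.ncard ≤ i.val * (Fintype.card J + 1) := by
      refine (Set.ncard_image_le (Set.toFinite _)).trans ?_
      rw [ncard_prod_lt i.val i.2.le, Fintype.card_option]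
    have h6 : Xs.ncard + i.val * Fintype.card J ≤ n * Fintype.card J := by
      rw [← ncard_prod_ge i.val i.2.le J]
      exact Nat.add_le_add_right (Set.ncard_image_le (Set.toFinite _)) _
    -- For `i = 0` this reads `2 ≤ n`, the place where `n ≠ 1` enters.
    have h7 : e.ncard + i.val + 1 ≤ n := by
      have := i.2
      by_cases h0 : i.val = 0
      · simp only [e, h0, if_true, Set.ncard_singleton]
        omega
      · simp only [e, h0, if_false, Set.ncard_empty]
        omega
    rw [mul_add, mul_one] at h5
    omega
  · have h1 := hu.1.adjoin_of_disjoint (s := Subtype.val ⁻¹' T) (t := Subtype.val ⁻¹' V) (by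
      rw [Set.disjoint_left]
      rintro a h1 ⟨⟨-, h2⟩, -⟩
      exact h2 h1)
    rw [Subtype.image_preimage_coe, Set.inter_eq_right.2 hTu] at h1
    exact algebraicIndependent_adjoin_field (h1.comp
      (fun v : V => (⟨⟨v.1, v.2.1.1⟩, v.2⟩ : (Subtype.val ⁻¹' V : Set u)))
      fun a b hab => Subtype.ext (congrArg (fun c => c.1.1) hab))

variable (x w) in
/-- The field generated by the payoffs of the first `i` players. -/
noncomputable def payoffField (i : ℕ) : IntermediateField ℂ L :=
  IntermediateField.adjoin ℂ (extendedFamily x w '' {q | q.1.val < i})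

variable (z x) in
/-- The field generated by the parameters and the payoffs of the first `i` players. -/
noncomputable def totalField (i : ℕ) : IntermediateField ℂ L :=
  IntermediateField.adjoin ℂ (Sum.elim z x '' {o | ∀ q, o = Sum.inr q → q.1.val < i})

theorem mem_totalField_of_mem_adjoin {i : ℕ} {a : L}
    (ha : a ∈ IntermediateField.adjoin ℂ (Set.range z)) : a ∈ totalField z x i := by
  refine IntermediateField.adjoin.mono ℂ _ _ ?_ ha
  rintro _ ⟨l, rfl⟩
  exact ⟨Sum.inl l, fun q hq => (Sum.inl_ne_inr hq).elim, rfl⟩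

theorem mem_totalField {i : ℕ} {q : Fin n × J} (hq : q.1.val < i) : x q ∈ totalField z x i := by
  refine IntermediateField.subset_adjoin _ _ ⟨Sum.inr q, ?_, rfl⟩
  rintro q' hq'
  rwa [← Sum.inr_injective hq']

theorem mem_payoffField {i : ℕ} {q : Fin n × Option J} (hq : q.1.val < i) :
    extendedFamily x w q ∈ payoffField x w i :=
  IntermediateField.subset_adjoin _ _ ⟨q, hq, rfl⟩

theorem payoffField_le_totalField [Fintype J] (hf : ∀ i j, f i j ∈ IntermediateField.adjoin ℂ (Set.range z))
    (hw : ∀ i, w i = ∑ j, f i j * x (i, j)) (i : ℕ) : payoffField x w i ≤ totalField z x i := by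
  rw [payoffField, IntermediateField.adjoin_le_iff]
  rintro _ ⟨⟨a, _ | j⟩, hq, rfl⟩
  · change w a ∈ _
    rw [hw]
    exact sum_mem fun j _ => mul_mem (mem_totalField_of_mem_adjoin (hf a j)) (mem_totalField hq)
  · exact mem_totalField hq

theorem algebraicIndependent_totalField (hind : AlgebraicIndependent ℂ (Sum.elim z x))
    (i : Fin n) : AlgebraicIndependent (totalField z x i.val) fun j => x (i, j) := by
  have h := hind.adjoin_of_disjoint (s := {o | ∀ q, o = Sum.inr q → q.1.val < i.val})
    (t := Set.range fun j => Sum.inr (i, j)) (by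
      rw [Set.disjoint_left]
      rintro _ h ⟨j, rfl⟩
      exact lt_irrefl _ (h _ rfl))
  refine algebraicIndependent_adjoin_field (h.comp
    (fun j => (⟨Sum.inr (i, j), j, rfl⟩ : Set.range fun j => (Sum.inr (i, j) : Fin m ⊕ Fin n × J)))
    fun a b hab => ?_)
  have := Sum.inr_injective (congrArg Subtype.val hab)
  exact (Prod.ext_iff.1 this).2

/-- The new free payoffs are independent over the larger field `totalField`, which contains the
coefficients. So one coefficient transcendental over `payoffField` makes `w i` and these payoffs
independent over `payoffField`. -/
theorem algebraicIndepOn_succ [Fintype J] (hind : AlgebraicIndependent ℂ (Sum.elim z x))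
    (hf : ∀ i j, f i j ∈ IntermediateField.adjoin ℂ (Set.range z))
    (hw : ∀ i, w i = ∑ j, f i j * x (i, j)) (i : Fin n)
    (hi : AlgebraicIndepOn ℂ (extendedFamily x w) {q | q.1.val < i.val}) (j₁ : J)
    (h₁ : Transcendental (payoffField x w i.val) (f i j₁)) :
    AlgebraicIndepOn ℂ (extendedFamily x w) {q | q.1.val < i.val + 1} := by
  classical
  let _ : Algebra (payoffField x w i.val) (totalField z x i.val) :=
    (IntermediateField.inclusion (payoffField_le_totalField hf hw i.val)).toRingHom.toAlgebra
  have : IsScalarTower (payoffField x w i.val) (totalField z x i.val) L :=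
    IsScalarTower.of_algebraMap_eq fun _ => rfl
  have h := algebraicIndependent_option_linear (k := payoffField x w i.val)
    (E := totalField z x i.val) (fun j => x (i, j)) (algebraicIndependent_totalField hind i)
    (fun j => ⟨f i j, mem_totalField_of_mem_adjoin (hf i j)⟩) j₁
    ((transcendental_algebraMap_iff (A := L) (algebraMap (totalField z x i.val) L).injective).1 h₁)
  have heq : (fun o : Option J => o.elim
      (∑ j, algebraMap (totalField z x i.val) L ⟨f i j, mem_totalField_of_mem_adjoin (hf i j)⟩ *
        x (i, j)) fun j => x (i, j)) = fun o => extendedFamily x w (i, o) := by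
    funext o
    cases o with
    | none => exact (hw i).symm
    | some j => rfl
  rw [heq] at h
  have h2 := AlgebraicIndependent.sumElim_of_tower (S := payoffField x w i.val)
    (x := fun q : {q : Fin n × Option J | q.1.val < i.val} => extendedFamily x w q) hi (by
      rintro _ ⟨q, rfl⟩
      exact ⟨⟨_, mem_payoffField q.2⟩, rfl⟩) h
  let g : {q : Fin n × Option J | q.1.val < i.val + 1} →
      Option J ⊕ {q : Fin n × Option J | q.1.val < i.val} :=
    fun q => if h : q.1.1.val < i.val then Sum.inr ⟨q.1, h⟩ else Sum.inl q.1.2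
  have hi' : ∀ q : {q : Fin n × Option J | q.1.val < i.val + 1}, ¬ q.1.1.val < i.val →
      q.1.1 = i := fun q hq => Fin.ext (by have : q.1.1.val < i.val + 1 := q.2; omega)
  have hg : Function.Injective g := by
    intro a b hab
    by_cases ha : a.1.1.val < i.val <;> by_cases hb : b.1.1.val < i.val <;>
      simp only [g, ha, hb, dif_pos, dif_neg, not_false_iff, reduceCtorEq] at hab
    · have h : (⟨a.1, ha⟩ : {q : Fin n × Option J | q.1.val < i.val}) = ⟨b.1, hb⟩ :=
        Sum.inr.inj hab
      exact Subtype.ext (Subtype.mk.inj h)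
    · exact Subtype.ext (Prod.ext ((hi' a ha).trans (hi' b hb).symm) (Sum.inl.inj hab))
  have h3 := h2.comp g hg
  have heq2 : (Sum.elim (fun o => extendedFamily x w (i, o))
      (fun q : {q : Fin n × Option J | q.1.val < i.val} => extendedFamily x w q)) ∘ g =
      fun q => extendedFamily x w q.1 := by
    funext q
    by_cases hq : q.1.1.val < i.val
    · simp only [Function.comp_apply, g, dif_pos hq, Sum.elim_inr]
    · simp only [Function.comp_apply, g, hq, dif_neg, not_false_iff, Sum.elim_inl]
      exact congrArg (extendedFamily x w) (Prod.ext (hi' q hq).symm rfl)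
  rw [heq2] at h3
  exact h3

/-- Regularity of the extension `K'/K` of intermediate fields. -/
def IsRegularExt (K K' : IntermediateField ℂ L) : Prop :=
  ∃ hle : K ≤ K', letI := (IntermediateField.inclusion hle).toRingHom.toAlgebra
    IsDomain (K' ⊗[K] K')

theorem IsRegularExt.mem_of_isAlgebraic {K K' : IntermediateField ℂ L} (h : IsRegularExt K K')
    {a : L} (ha : a ∈ K') (h' : IsAlgebraic K a) : a ∈ K := by
  obtain ⟨hle, hd⟩ := h
  let _ : Algebra K K' := (IntermediateField.inclusion hle).toRingHom.toAlgebra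
  have : IsScalarTower K K' L := IsScalarTower.of_algebraMap_eq fun _ => rfl
  have : IsDomain (K' ⊗[K] K') := hd
  obtain ⟨b, hb⟩ := mem_range_of_isAlgebraic (k := K) (⟨a, ha⟩ : K')
    ((isAlgebraic_algebraMap_iff (A := L) (algebraMap K' L).injective).1 h')
  have := congrArg Subtype.val hb
  rw [← show b.1 = a from this]
  exact b.2

theorem transcendental_adjoin_of_pair {k L ι : Type} [Field k] [Field L] [Algebra k L]
    {y : ι → L} (hy : AlgebraicIndependent k y) (a b : ι) (hab : a ≠ b) :
    Transcendental (IntermediateField.adjoin k {y a}) (y b) := by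
  have h := hy.adjoin_of_disjoint (s := {a}) (t := {b}) (by simpa using hab)
  rw [Set.image_singleton] at h
  exact transcendental_adjoin_field (h.transcendental ⟨b, rfl⟩)

theorem payoffField_succ (i : Fin n) : payoffField x w (i.val + 1) ≤
    IntermediateField.adjoin ℂ ((payoffField x w i.val : Set L) ∪
      insert (w i) (Set.range fun j => x (i, j))) := by
  rw [payoffField, IntermediateField.adjoin_le_iff]
  rintro _ ⟨⟨a, o⟩, hq, rfl⟩
  refine IntermediateField.subset_adjoin _ _ ?_
  by_cases ha : a.val < i.val
  · exact Or.inl (mem_payoffField ha)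
  · obtain rfl : a = i := Fin.ext (by have : a.val < i.val + 1 := hq; omega)
    cases o with
    | none => exact Or.inr (Or.inl rfl)
    | some j => exact Or.inr (Or.inr ⟨j, rfl⟩)

theorem totalField_succ (i : Fin n) : totalField z x (i.val + 1) ≤
    IntermediateField.adjoin ℂ ((totalField z x i.val : Set L) ∪
      Set.range fun j => x (i, j)) := by
  rw [totalField, IntermediateField.adjoin_le_iff]
  rintro _ ⟨l | ⟨a, j⟩, hq, rfl⟩
  · refine IntermediateField.subset_adjoin _ _ (Or.inl (mem_totalField_of_mem_adjoin ?_))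
    exact IntermediateField.subset_adjoin _ _ ⟨l, rfl⟩
  refine IntermediateField.subset_adjoin _ _ ?_
  by_cases ha : a.val < i.val
  · exact Or.inl (mem_totalField ha)
  · obtain rfl : a = i := Fin.ext (by have : a.val < i.val + 1 := hq _ rfl; omega)
    exact Or.inr ⟨j, rfl⟩

/-- Both fields receive the free payoffs of player `i`, the smaller one also the linear form `w i`.
Two independent coefficients in `V` are what `isDomain_tensor_adjoin` requires. -/
theorem isRegularExt_succ [Fintype J] (hind : AlgebraicIndependent ℂ (Sum.elim z x))
    (hf : ∀ i j, f i j ∈ IntermediateField.adjoin ℂ (Set.range z))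
    (hw : ∀ i, w i = ∑ j, f i j * x (i, j)) (i : Fin n)
    (hi : IsRegularExt (payoffField x w i.val) (totalField z x i.val)) {V : Set L}
    (hV : V ⊆ Set.range (f i)) (hcard : 1 < V.ncard)
    (hVind : AlgebraicIndependent (payoffField x w i.val) ((↑) : V → L)) :
    IsRegularExt (payoffField x w (i.val + 1)) (totalField z x (i.val + 1)) := by
  obtain ⟨a, ha, b, hb, hab⟩ := (Set.one_lt_ncard (Set.finite_of_ncard_pos (by omega))).1 hcard
  obtain ⟨j₁, rfl⟩ := hV ha
  obtain ⟨j₂, rfl⟩ := hV hb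
  obtain ⟨hle, hd⟩ := hi
  have hle' : payoffField x w (i.val + 1) ≤ totalField z x (i.val + 1) :=
    payoffField_le_totalField hf hw _
  have hk : payoffField x w i.val ≤ payoffField x w (i.val + 1) :=
    IntermediateField.adjoin.mono ℂ _ _ (Set.image_mono fun q (hq : q.1.val < i.val) =>
      (by omega : q.1.val < i.val + 1))
  have hE : totalField z x i.val ≤ totalField z x (i.val + 1) :=
    IntermediateField.adjoin.mono ℂ _ _ (Set.image_mono fun o ho q hq =>
      (ho q hq).trans (Nat.lt_succ_self _))
  let _ : Algebra (payoffField x w i.val) (totalField z x i.val) :=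
    (IntermediateField.inclusion hle).toRingHom.toAlgebra
  let _ : Algebra (payoffField x w (i.val + 1)) (totalField z x (i.val + 1)) :=
    (IntermediateField.inclusion hle').toRingHom.toAlgebra
  let _ : Algebra (payoffField x w i.val) (payoffField x w (i.val + 1)) :=
    (IntermediateField.inclusion hk).toRingHom.toAlgebra
  let _ : Algebra (totalField z x i.val) (totalField z x (i.val + 1)) :=
    (IntermediateField.inclusion hE).toRingHom.toAlgebra
  let _ : Algebra (payoffField x w i.val) (totalField z x (i.val + 1)) :=
    (IntermediateField.inclusion (hle.trans hE)).toRingHom.toAlgebra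
  have : IsScalarTower (payoffField x w i.val) (totalField z x i.val)
    (totalField z x (i.val + 1)) := IsScalarTower.of_algebraMap_eq fun _ => rfl
  have : IsScalarTower (payoffField x w i.val) (payoffField x w (i.val + 1))
    (totalField z x (i.val + 1)) := IsScalarTower.of_algebraMap_eq fun _ => rfl
  have : IsScalarTower (payoffField x w i.val) (totalField z x i.val) L :=
    IsScalarTower.of_algebraMap_eq fun _ => rfl
  have : IsScalarTower (totalField z x i.val) (totalField z x (i.val + 1)) L :=
    IsScalarTower.of_algebraMap_eq fun _ => rfl
  have : IsDomain (totalField z x i.val ⊗[payoffField x w i.val] totalField z x i.val) := hd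
  let x' : J → payoffField x w (i.val + 1) := fun j =>
    ⟨x (i, j), mem_payoffField (q := (i, some j)) (Nat.lt_succ_self _)⟩
  let w' : payoffField x w (i.val + 1) :=
    ⟨w i, mem_payoffField (q := (i, none)) (Nat.lt_succ_self _)⟩
  let f' : J → totalField z x i.val := fun j => ⟨f i j, mem_totalField_of_mem_adjoin (hf i j)⟩
  refine ⟨hle', isDomain_tensor_adjoin (k := payoffField x w i.val) x' w' f' ?_ ?_ ?_ ?_ j₁ j₂
    ?_ ?_ ?_⟩
  · refine Subtype.ext ((hw i).trans ?_)
    rw [← IntermediateField.coe_val, map_sum]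
    rfl
  · refine adjoin_preimage_eq_top hk _ ?_
    rw [Set.image_insert_eq, ← Set.range_comp]
    exact payoffField_succ i
  · exact ((IsScalarTower.toAlgHom (totalField z x i.val) (totalField z x (i.val + 1))
      L).algebraicIndependent_iff (algebraMap (totalField z x (i.val + 1)) L).injective).1
      (algebraicIndependent_totalField hind i)
  · refine adjoin_preimage_eq_top hE _ ?_
    rw [← Set.range_comp]
    exact totalField_succ i
  · rintro rfl
    exact hab rfl
  · refine (transcendental_algebraMap_iff (A := L)
      (algebraMap (totalField z x i.val) L).injective).1 ?_
    exact hVind.transcendental ⟨f i j₁, ha⟩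
  · have hVE : ∀ v : V, v.1 ∈ totalField z x i.val := fun v => by
      obtain ⟨j, hj⟩ := hV v.2
      rw [← hj]
      exact (f' j).2
    have h : AlgebraicIndependent (payoffField x w i.val)
        fun v : V => (⟨v.1, hVE v⟩ : totalField z x i.val) :=
      ((IsScalarTower.toAlgHom (payoffField x w i.val) (totalField z x i.val)
        L).algebraicIndependent_iff (algebraMap (totalField z x i.val) L).injective).1 hVind
    exact transcendental_adjoin_of_pair h ⟨_, ha⟩ ⟨_, hb⟩ fun h => hab (Subtype.mk.inj h)

theorem payoffField_zero : payoffField x w 0 = ⊥ := by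
  simp [payoffField]

/-- Without payoffs the extension is the purely transcendental `ℂ(z) / ℂ`. -/
theorem isRegularExt_zero (hind : AlgebraicIndependent ℂ (Sum.elim z x)) :
    IsRegularExt (payoffField x w 0) (totalField z x 0) := by
  have hle : payoffField x w 0 ≤ totalField z x 0 := by
    rw [payoffField_zero]
    exact bot_le
  let _ : Algebra (payoffField x w 0) (totalField z x 0) :=
    (IntermediateField.inclusion hle).toRingHom.toAlgebra
  let z' : Fin m → totalField z x 0 := fun l => ⟨z l, mem_totalField_of_mem_adjoin
    (IntermediateField.subset_adjoin _ _ ⟨l, rfl⟩)⟩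
  refine ⟨hle, isDomain_tensor_of_purelyTranscendental z' ?_ ?_⟩
  · have : IsScalarTower (payoffField x w 0) (totalField z x 0) L :=
      IsScalarTower.of_algebraMap_eq fun _ => rfl
    refine ((IsScalarTower.toAlgHom (payoffField x w 0) (totalField z x 0)
      L).algebraicIndependent_iff (algebraMap (totalField z x 0) L).injective).1 ?_
    have hz : AlgebraicIndependent ℂ z := hind.comp Sum.inl Sum.inl_injective
    have := hz.adjoin_of_disjoint (s := ∅) (t := Set.univ) (by simp)
    rw [Set.image_empty] at this
    have h0 := algebraicIndependent_adjoin_field (this.comp (fun l => ⟨l, trivial⟩)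
      fun a b h => congrArg Subtype.val h)
    have hp : payoffField x w 0 = IntermediateField.adjoin ℂ ∅ := by simp [payoffField]
    rw [← hp] at h0
    exact h0
  · refine adjoin_preimage_eq_top hle _ ?_
    refine IntermediateField.adjoin.mono ℂ _ _ ?_
    rintro _ ⟨l | q, hq, rfl⟩
    · exact Or.inr ⟨z' l, ⟨l, rfl⟩, rfl⟩
    · exact absurd (hq q rfl) (Nat.not_lt_zero _)

/-- Each step has `m + 1 - n` independent coefficients at its disposal. One suffices for
independence of the payoffs; regularity needs two, hence `n < m`. -/
theorem tower_induction [Fintype J] (hn : n ≠ 1)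
    (hind : AlgebraicIndependent ℂ (Sum.elim z x))
    (hgen : IntermediateField.adjoin ℂ (Set.range (Sum.elim z x)) = ⊤)
    (hf : ∀ i j, f i j ∈ IntermediateField.adjoin ℂ (Set.range z))
    (hw : ∀ i, w i = ∑ j, f i j * x (i, j))
    (hrank : ∀ i, ∃ t, (∀ l, IsAlgebraic (Algebra.adjoin ℂ (Set.range (f i) ∪ {t})) (z l)) ∧
      (0 < i.val → IsAlgebraic (Algebra.adjoin ℂ
        (extendedFamily x w '' {q | q.1.val < i.val} ∪ Set.range (f i))) t))
    (hm : n ≤ m) (i : ℕ) (hin : i ≤ n) :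
    AlgebraicIndepOn ℂ (extendedFamily x w) {q | q.1.val < i} ∧
      (n < m → IsRegularExt (payoffField x w i) (totalField z x i)) := by
  induction i with
  | zero =>
    refine ⟨?_, fun _ => isRegularExt_zero hind⟩
    have : {q : Fin n × Option J | q.1.val < 0} = ∅ := by simp
    rw [this]
    exact algebraicIndependent_empty_type_iff.2 (algebraMap ℂ L).injective
  | succ i ih =>
    obtain ⟨h1, h2⟩ := ih (by omega)
    obtain ⟨V, hV, hcard, hVind⟩ := exists_independent_coeffs hn hind hgen hrank ⟨i, hin⟩ h1
    refine ⟨?_, fun hm' => isRegularExt_succ hind hf hw ⟨i, hin⟩ (h2 hm') hV (by omega) hVind⟩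
    obtain ⟨a, ha⟩ := (Set.ncard_pos (Set.finite_of_ncard_pos (s := V) (by omega))).1
      (by omega : 0 < V.ncard)
    obtain ⟨j, rfl⟩ := hV ha
    exact algebraicIndepOn_succ hind hf hw ⟨i, hin⟩ h1 j (hVind.transcendental ⟨_, ha⟩)

theorem algebraicIndependent_extendedFamily [Fintype J] (hn : n ≠ 1)
    (hind : AlgebraicIndependent ℂ (Sum.elim z x))
    (hgen : IntermediateField.adjoin ℂ (Set.range (Sum.elim z x)) = ⊤)
    (hf : ∀ i j, f i j ∈ IntermediateField.adjoin ℂ (Set.range z))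
    (hw : ∀ i, w i = ∑ j, f i j * x (i, j))
    (hrank : ∀ i, ∃ t, (∀ l, IsAlgebraic (Algebra.adjoin ℂ (Set.range (f i) ∪ {t})) (z l)) ∧
      (0 < i.val → IsAlgebraic (Algebra.adjoin ℂ
        (extendedFamily x w '' {q | q.1.val < i.val} ∪ Set.range (f i))) t))
    (hm : n ≤ m) :
    AlgebraicIndependent ℂ (extendedFamily x w) ∧
      (n < m → ∀ a, IsAlgebraic (IntermediateField.adjoin ℂ (Set.range (extendedFamily x w))) a →
        a ∈ IntermediateField.adjoin ℂ (Set.range (extendedFamily x w))) := by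
  obtain ⟨h1, h2⟩ := tower_induction hn hind hgen hf hw hrank hm n le_rfl
  have huniv : {q : Fin n × Option J | q.1.val < n} = Set.univ := by simp
  rw [huniv] at h1
  have hp : payoffField x w n = IntermediateField.adjoin ℂ (Set.range (extendedFamily x w)) := by
    rw [payoffField, huniv, Set.image_univ]
  refine ⟨h1.comp (fun q => ⟨q, trivial⟩) fun a b hab => congrArg Subtype.val hab,
    fun hm' a ha => ?_⟩
  rw [← hp] at ha ⊢
  refine (h2 hm').mem_of_isAlgebraic ?_ ha
  have : totalField z x n = ⊤ := by
    rw [totalField, ← hgen, ← Set.image_univ]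
    congr 2
    ext o
    simp
  rw [this]
  trivial

end tower

end SpohnCI

namespace SpohnCI

/-! ### The payoffs on a parametrized family of distributions -/

section payoffs

theorem range_extendedFamily_payoffs {n : ℕ} {T : Type} {x : Fin n × State n → T} :
    Set.range (extendedFamily (fun q : Fin n × {j : State n // j ≠ 0} => x (q.1, q.2.1))
      fun i => x (i, 0)) = Set.range x := by
  ext a
  constructor
  · rintro ⟨⟨i, _ | j⟩, rfl⟩
    · exact ⟨(i, 0), rfl⟩
    · exact ⟨(i, j.1), rfl⟩
  · rintro ⟨⟨i, j⟩, rfl⟩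
    by_cases h : j = 0
    · exact ⟨(i, none), by rw [h]; rfl⟩
    · exact ⟨(i, some ⟨j, h⟩), rfl⟩

variable {L : Type} [Field L] {n m : ℕ} {z : Fin m → L} {π : State n → L}
  {x : Fin n × State n → L}

/-- The coefficients which express the payoff at the state `0` through the other payoffs. -/
noncomputable def payoffCoeff (π : State n → L) (i : Fin n) (j : State n) : L :=
  if j i = 0 then -(π j / π 0)
  else (∑ k with k i = 0, π k) * π j / ((∑ k with k i = 1, π k) * π 0)

theorem sum_filter_eq_zero_add_one {M : Type} [AddCommMonoid M] (i : Fin n) (s : Finset (State n))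
    (F : State n → M) : ∑ j ∈ s, F j = (∑ j ∈ s with j i = 0, F j) + ∑ j ∈ s with j i = 1, F j := by
  rw [← Finset.sum_filter_add_sum_filter_not s (fun j => j i = 0)]
  congr 2
  ext j
  simp only [Finset.mem_filter, and_congr_right_iff]
  intro
  omega

/-- The Spohn equation of player `i`, divided by the marginal of choice `1` and by `π 0`. This
normalizes the coefficient at the state `0` to `-1`. -/
theorem sum_payoffCoeff_mul (hπ : ∀ s : Finset (State n), s.Nonempty → ∑ j ∈ s, π j ≠ 0)
    (i : Fin n) (hq : (∑ j with j i = 0, π j) * (∑ j with j i = 1, x (i, j) * π j) =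
      (∑ j with j i = 1, π j) * ∑ j with j i = 0, x (i, j) * π j) :
    ∑ j, payoffCoeff π i j * x (i, j) = 0 := by
  have h0 : π 0 ≠ 0 := by simpa using hπ {0} (Finset.singleton_nonempty _)
  have h1 : ∑ k with k i = 1, π k ≠ 0 := hπ _ ⟨1, by simp⟩
  rw [sum_filter_eq_zero_add_one i]
  have e0 : ∑ j with j i = 0, payoffCoeff π i j * x (i, j) =
      -(∑ j with j i = 0, x (i, j) * π j) / π 0 := by
    rw [neg_div, Finset.sum_div, ← Finset.sum_neg_distrib]
    refine Finset.sum_congr rfl fun j hj => ?_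
    rw [payoffCoeff, if_pos (Finset.mem_filter.1 hj).2]
    ring
  have e1 : ∑ j with j i = 1, payoffCoeff π i j * x (i, j) =
      (∑ k with k i = 0, π k) * (∑ j with j i = 1, x (i, j) * π j) /
        ((∑ k with k i = 1, π k) * π 0) := by
    rw [Finset.mul_sum, Finset.sum_div]
    refine Finset.sum_congr rfl fun j hj => ?_
    rw [payoffCoeff, if_neg (by rw [(Finset.mem_filter.1 hj).2]; exact one_ne_zero)]
    ring
  rw [e0, e1, hq]
  field_simp
  ring

theorem payoffCoeff_zero (hπ : ∀ s : Finset (State n), s.Nonempty → ∑ j ∈ s, π j ≠ 0)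
    (i : Fin n) : payoffCoeff π i 0 = -1 := by
  have h0 : π 0 ≠ 0 := by simpa using hπ {0} (Finset.singleton_nonempty _)
  rw [payoffCoeff, if_pos (show (0 : State n) i = 0 from rfl), div_self h0]

theorem payoff_zero_eq (hπ : ∀ s : Finset (State n), s.Nonempty → ∑ j ∈ s, π j ≠ 0)
    (i : Fin n) (hq : (∑ j with j i = 0, π j) * (∑ j with j i = 1, x (i, j) * π j) =
      (∑ j with j i = 1, π j) * ∑ j with j i = 0, x (i, j) * π j) :
    x (i, 0) = ∑ j : {j : State n // j ≠ 0}, payoffCoeff π i j * x (i, j.1) := by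
  have h := sum_payoffCoeff_mul hπ i hq
  rw [Fintype.sum_eq_add_sum_subtype_ne _ 0, payoffCoeff_zero hπ] at h
  linear_combination -h

/-- The ratio of the two marginals of player `i`. -/
noncomputable def marginalRatio (π : State n → L) (i : Fin n) : L :=
  (∑ k with k i = 1, π k) / ∑ k with k i = 0, π k

/-- Coefficients at states with `j i = 0` give the ratios `π j / π 0` directly, the others up to the
common factor `marginalRatio`. So a single further quantity recovers the distribution up to scaling.
-/
theorem div_eq_payoffCoeff (hπ : ∀ s : Finset (State n), s.Nonempty → ∑ j ∈ s, π j ≠ 0)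
    (i : Fin n) (j : State n) :
    π j / π 0 = if j i = 0 then -payoffCoeff π i j else marginalRatio π i * payoffCoeff π i j := by
  have h0 : π 0 ≠ 0 := by simpa using hπ {0} (Finset.singleton_nonempty _)
  have h1 : ∑ k with k i = 1, π k ≠ 0 := hπ _ ⟨1, by simp⟩
  have h2 : ∑ k with k i = 0, π k ≠ 0 := hπ _ ⟨0, by simp⟩
  by_cases h : j i = 0
  · rw [payoffCoeff, if_pos h, if_pos h, neg_neg]
  · rw [payoffCoeff, if_neg h, if_neg h, marginalRatio]
    field_simp

theorem mem_adjoin_payoffCoeff [Algebra ℂ L]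
    (hπ : ∀ s : Finset (State n), s.Nonempty → ∑ j ∈ s, π j ≠ 0)
    (hz : ∀ l, ∃ b c : State n → ℂ, ∑ j, algebraMap ℂ L (b j) * π j ≠ 0 ∧
      z l * ∑ j, algebraMap ℂ L (b j) * π j = ∑ j, algebraMap ℂ L (c j) * π j)
    (i : Fin n) (l : Fin m) :
    z l ∈ IntermediateField.adjoin ℂ
      (Set.range (fun j : {j : State n // j ≠ 0} => payoffCoeff π i j) ∪ {marginalRatio π i}) := by
  set K := IntermediateField.adjoin ℂ
      (Set.range (fun j : {j : State n // j ≠ 0} => payoffCoeff π i j) ∪ {marginalRatio π i})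
  have h0 : π 0 ≠ 0 := by simpa using hπ {0} (Finset.singleton_nonempty _)
  have hc : ∀ j, payoffCoeff π i j ∈ K := fun j => by
    by_cases h : j = 0
    · rw [h, payoffCoeff_zero hπ]
      exact neg_mem (one_mem K)
    · exact IntermediateField.subset_adjoin _ _ (Or.inl ⟨⟨j, h⟩, rfl⟩)
  have hr : ∀ j, π j / π 0 ∈ K := fun j => by
    rw [div_eq_payoffCoeff hπ i]
    split_ifs
    · exact neg_mem (hc j)
    · exact mul_mem (IntermediateField.subset_adjoin _ _ (Or.inr rfl)) (hc j)
  have hs : ∀ b : State n → ℂ, (∑ j, algebraMap ℂ L (b j) * π j) / π 0 ∈ K := fun b => by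
    rw [Finset.sum_div]
    refine sum_mem fun j _ => ?_
    rw [mul_div_assoc]
    exact mul_mem (IntermediateField.algebraMap_mem K (b j)) (hr j)
  obtain ⟨b, c, hb, hbc⟩ := hz l
  have : z l = ((∑ j, algebraMap ℂ L (c j) * π j) / π 0) /
      ((∑ j, algebraMap ℂ L (b j) * π j) / π 0) := by
    rw [← hbc]
    field_simp
  rw [this]
  exact div_mem (hs c) (hs b)

/-- The payoffs at the states `j ≠ 0` are independent over `ℂ(z)`, so a linear form over `ℂ(z)` not
involving the state `0` vanishes only if its coefficients do. -/
theorem linear_form_ne_zero [Algebra ℂ L]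
    (hind : AlgebraicIndependent ℂ
      (Sum.elim z fun q : Fin n × {j : State n // j ≠ 0} => x (q.1, q.2.1)))
    (i : Fin n) (c : State n → L) (hc : ∀ j, c j ∈ IntermediateField.adjoin ℂ (Set.range z))
    (h0 : c 0 = 0) (j₁ : State n) (h1 : c j₁ ≠ 0) : ∑ j, c j * x (i, j) ≠ 0 := by
  intro hsum
  have h := hind.adjoin_of_disjoint (s := Set.range Sum.inl)
    (t := Set.range fun j => Sum.inr (i, j)) (by
      rw [Set.disjoint_left]
      rintro _ ⟨l, rfl⟩ ⟨j, hj⟩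
      exact Sum.inr_ne_inl hj)
  have h2 := algebraicIndependent_adjoin_field (h.comp
    (fun j => (⟨Sum.inr (i, j), j, rfl⟩ : Set.range fun j => (Sum.inr (i, j) :
      Fin m ⊕ Fin n × {j : State n // j ≠ 0}))) fun a b hab => by
        have := Sum.inr.inj (Subtype.mk.inj hab)
        exact (Prod.ext_iff.1 this).2)
  rw [← Set.range_comp] at h2
  have h3 : LinearIndependent (IntermediateField.adjoin ℂ (Set.range z))
      fun j : {j : State n // j ≠ 0} => x (i, j.1) := h2.linearIndependent
  rw [Fintype.linearIndependent_iff] at h3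
  have h4 := h3 (fun j => ⟨c j, hc j⟩) (by
    rw [Fintype.sum_eq_add_sum_subtype_ne _ 0, h0, zero_mul, zero_add] at hsum
    exact hsum) ⟨j₁, fun h => h1 (h ▸ h0)⟩
  exact h1 (congrArg Subtype.val h4)

theorem isAlgebraic_of_quadratic {k : Type} [Field k] [Algebra k L] {K : IntermediateField k L}
    {a b c t : L} (ha : a ∈ K) (hb : b ∈ K) (hc : c ∈ K) (ha0 : a ≠ 0)
    (h : a * t ^ 2 + b * t + c = 0) : IsAlgebraic K t := by
  open Polynomial in
  refine ⟨C ⟨a, ha⟩ * X ^ 2 + C ⟨b, hb⟩ * X + C ⟨c, hc⟩, fun h0 => ?_, ?_⟩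
  · have := congrArg (fun p => coeff p 2) h0
    simp at this
    exact ha0 (congrArg Subtype.val this)
  · simpa using h

theorem payoffCoeff_mem [Algebra ℂ L] {K : IntermediateField ℂ L} (hK : ∀ j, π j ∈ K) (i : Fin n)
    (j : State n) : payoffCoeff π i j ∈ K := by
  rw [payoffCoeff]
  split_ifs
  · exact neg_mem (div_mem (hK j) (hK 0))
  · exact div_mem (mul_mem (sum_mem fun k _ => hK k) (hK j))
      (mul_mem (sum_mem fun k _ => hK k) (hK 0))

theorem sum_mul_div_eq (hπ : ∀ s : Finset (State n), s.Nonempty → ∑ j ∈ s, π j ≠ 0)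
    (i : Fin n) (s : Finset (State n)) (F : State n → L) :
    (∑ j ∈ s, F j * π j) / π 0 = -(∑ j ∈ s with j i = 0, F j * payoffCoeff π i j) +
      marginalRatio π i * ∑ j ∈ s with j i = 1, F j * payoffCoeff π i j := by
  rw [Finset.sum_div, sum_filter_eq_zero_add_one i, Finset.mul_sum, ← Finset.sum_neg_distrib]
  refine congrArg₂ (· + ·) (Finset.sum_congr rfl fun j hj => ?_)
    (Finset.sum_congr rfl fun j hj => ?_)
  · rw [mul_div_assoc, div_eq_payoffCoeff hπ i, if_pos (Finset.mem_filter.1 hj).2, mul_neg]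
  · rw [mul_div_assoc, div_eq_payoffCoeff hπ i,
      if_neg (by rw [(Finset.mem_filter.1 hj).2]; exact one_ne_zero)]
    ring

theorem payoffCoeff_sum_ne_zero (hπ : ∀ s : Finset (State n), s.Nonempty → ∑ j ∈ s, π j ≠ 0)
    (i : Fin n) (s : Finset (State n)) (hs : s.Nonempty) (h1 : ∀ j ∈ s, j i = 1) :
    ∑ j ∈ s, payoffCoeff π i j ≠ 0 := by
  have h0 : π 0 ≠ 0 := by simpa using hπ {0} (Finset.singleton_nonempty _)
  have e : ∑ j ∈ s, payoffCoeff π i j = (∑ k with k i = 0, π k) * (∑ j ∈ s, π j) /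
      ((∑ k with k i = 1, π k) * π 0) := by
    rw [Finset.mul_sum, Finset.sum_div]
    refine Finset.sum_congr rfl fun j hj => ?_
    rw [payoffCoeff, if_neg (by rw [h1 j hj]; exact one_ne_zero)]
  rw [e]
  exact div_ne_zero (mul_ne_zero (hπ _ ⟨0, by simp⟩) (hπ s hs))
    (mul_ne_zero (hπ _ ⟨1, by simp⟩) h0)

/-- By `sum_mul_div_eq` every sum in the equation of player `o`, divided by `π 0`, is affine-linear
in the marginal ratio of player `i` with coefficients in `K`. The equation is thus quadratic in the
ratio. Its leading coefficient is a linear form in the payoffs of `o` at states with `j i = 1`; the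
state `0` does not occur, so the form is nonzero. -/
theorem isAlgebraic_marginalRatio [Algebra ℂ L]
    (hπ : ∀ s : Finset (State n), s.Nonempty → ∑ j ∈ s, π j ≠ 0)
    (hind : AlgebraicIndependent ℂ
      (Sum.elim z fun q : Fin n × {j : State n // j ≠ 0} => x (q.1, q.2.1)))
    (hπz : ∀ j, π j ∈ IntermediateField.adjoin ℂ (Set.range z)) (o i : Fin n) (hoi : o ≠ i)
    (hq : (∑ j with j o = 0, π j) * (∑ j with j o = 1, x (o, j) * π j) =
      (∑ j with j o = 1, π j) * ∑ j with j o = 0, x (o, j) * π j)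
    {K : IntermediateField ℂ L} (hx : ∀ j, x (o, j) ∈ K) (hf : ∀ j, payoffCoeff π i j ∈ K) :
    IsAlgebraic K (marginalRatio π i) := by
  have h0 : π 0 ≠ 0 := by simpa using hπ {0} (Finset.singleton_nonempty _)
  let S : Fin 2 → Fin 2 → (State n → L) → L := fun c d F =>
    ∑ j with j o = c ∧ j i = d, F j * payoffCoeff π i j
  have hS : ∀ c F, (∑ j with j o = c, F j * π j) / π 0 =
      -S c 0 F + marginalRatio π i * S c 1 F := fun c F => by
    rw [sum_mul_div_eq hπ i]
    simp only [Finset.filter_filter, S]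
  have hSK : ∀ c d F, (∀ j, F j ∈ K) → S c d F ∈ K := fun c d F hF =>
    sum_mem fun j _ => mul_mem (hF j) (hf j)
  have h1K : ∀ j : State n, (1 : L) ∈ K := fun _ => one_mem K
  have hq' : (∑ j with j o = 0, (1 : L) * π j) / π 0 *
      ((∑ j with j o = 1, x (o, j) * π j) / π 0) =
      (∑ j with j o = 1, (1 : L) * π j) / π 0 * ((∑ j with j o = 0, x (o, j) * π j) / π 0) := by
    simp only [one_mul]
    rw [div_mul_div_comm, div_mul_div_comm, hq]
  rw [hS 0 fun _ => 1, hS 1 fun j => x (o, j), hS 1 fun _ => 1, hS 0 fun j => x (o, j)] at hq'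
  refine isAlgebraic_of_quadratic (K := K)
    (a := S 0 1 (fun _ => 1) * S 1 1 (fun j => x (o, j)) -
      S 1 1 (fun _ => 1) * S 0 1 (fun j => x (o, j)))
    (b := -(S 0 0 (fun _ => 1) * S 1 1 (fun j => x (o, j))) -
      S 0 1 (fun _ => 1) * S 1 0 (fun j => x (o, j)) +
      S 1 0 (fun _ => 1) * S 0 1 (fun j => x (o, j)) +
      S 1 1 (fun _ => 1) * S 0 0 (fun j => x (o, j)))
    (c := S 0 0 (fun _ => 1) * S 1 0 (fun j => x (o, j)) -
      S 1 0 (fun _ => 1) * S 0 0 (fun j => x (o, j)))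
    (sub_mem (mul_mem (hSK _ _ _ h1K) (hSK _ _ _ hx)) (mul_mem (hSK _ _ _ h1K) (hSK _ _ _ hx)))
    (add_mem (add_mem (sub_mem (neg_mem (mul_mem (hSK _ _ _ h1K) (hSK _ _ _ hx)))
      (mul_mem (hSK _ _ _ h1K) (hSK _ _ _ hx))) (mul_mem (hSK _ _ _ h1K) (hSK _ _ _ hx)))
      (mul_mem (hSK _ _ _ h1K) (hSK _ _ _ hx)))
    (sub_mem (mul_mem (hSK _ _ _ h1K) (hSK _ _ _ hx)) (mul_mem (hSK _ _ _ h1K) (hSK _ _ _ hx)))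
    ?_ (by linear_combination hq')
  have hSz : ∀ c, S c 1 (fun _ => 1) ∈ IntermediateField.adjoin ℂ (Set.range z) := fun c =>
    -- The form below is the leading coefficient, written as a single sum. Its coefficient at the
    -- state `1` is a product of two nonzero coefficient sums.
    sum_mem fun j _ => mul_mem (one_mem _) (payoffCoeff_mem hπz i j)
  have hne := linear_form_ne_zero hind o
    (fun j => if j i = 1 then (if j o = 1 then S 0 1 (fun _ => 1) * payoffCoeff π i j else
      -(S 1 1 (fun _ => 1) * payoffCoeff π i j)) else 0) (fun j => by
        split_ifs
        · exact mul_mem (hSz 0) (payoffCoeff_mem hπz i j)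
        · exact neg_mem (mul_mem (hSz 1) (payoffCoeff_mem hπz i j))
        · exact zero_mem _) (if_neg (show ¬ (0 : State n) i = 1 from zero_ne_one)) 1 (by
        simp only [Pi.one_apply, if_true]
        refine mul_ne_zero ?_ ?_
        · simp only [S, one_mul]
          refine payoffCoeff_sum_ne_zero hπ i _ ⟨Function.update 0 i 1, ?_⟩ fun j hj =>
            (Finset.mem_filter.1 hj).2.2
          simp [Function.update_of_ne hoi]
        · simpa using payoffCoeff_sum_ne_zero hπ i {1} (Finset.singleton_nonempty _) (by simp))
  intro h
  refine hne (Eq.trans ?_ h)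
  rw [sum_filter_eq_zero_add_one o, sum_filter_eq_zero_add_one i, sum_filter_eq_zero_add_one i
    (Finset.filter (fun j : State n => j o = 1) Finset.univ)]
  simp only [Finset.filter_filter]
  have e00 : ∀ c : Fin 2, (∑ j : State n with j o = c ∧ j i = 0,
      (if j i = 1 then (if j o = 1 then S 0 1 (fun _ => 1) * payoffCoeff π i j else
      -(S 1 1 (fun _ => 1) * payoffCoeff π i j)) else 0) * x (o, j)) = 0 := fun c =>
    Finset.sum_eq_zero fun j hj => by
      rw [if_neg (by rw [(Finset.mem_filter.1 hj).2.2]; exact zero_ne_one), zero_mul]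
  rw [e00, e00, zero_add, zero_add, add_comm, sub_eq_add_neg, ← neg_mul]
  refine congrArg₂ (· + ·) ?_ ?_
  · rw [Finset.mul_sum]
    refine Finset.sum_congr rfl fun j hj => ?_
    obtain ⟨-, h1, h2⟩ := Finset.mem_filter.1 hj
    rw [if_pos h2, if_pos h1]
    ring
  · rw [Finset.mul_sum]
    refine Finset.sum_congr rfl fun j hj => ?_
    obtain ⟨-, h1, h2⟩ := Finset.mem_filter.1 hj
    rw [if_pos h2, if_neg (by rw [h1]; exact zero_ne_one)]
    ring

theorem algebraicIndependent_payoffs [Algebra ℂ L] (hn : n ≠ 1) (hnm : n ≤ m)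
    (hπ : ∀ s : Finset (State n), s.Nonempty → ∑ j ∈ s, π j ≠ 0)
    (hind : AlgebraicIndependent ℂ
      (Sum.elim z fun q : Fin n × {j : State n // j ≠ 0} => x (q.1, q.2.1)))
    (hgen : IntermediateField.adjoin ℂ (Set.range
      (Sum.elim z fun q : Fin n × {j : State n // j ≠ 0} => x (q.1, q.2.1))) = ⊤)
    (hπz : ∀ j, π j ∈ IntermediateField.adjoin ℂ (Set.range z))
    (hz : ∀ l, ∃ b c : State n → ℂ, ∑ j, algebraMap ℂ L (b j) * π j ≠ 0 ∧
      z l * ∑ j, algebraMap ℂ L (b j) * π j = ∑ j, algebraMap ℂ L (c j) * π j)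
    (hq : ∀ i, (∑ j with j i = 0, π j) * (∑ j with j i = 1, x (i, j) * π j) =
      (∑ j with j i = 1, π j) * ∑ j with j i = 0, x (i, j) * π j) :
    AlgebraicIndependent ℂ x ∧
      (n < m → ∀ a, IsAlgebraic (IntermediateField.adjoin ℂ (Set.range x)) a →
        a ∈ IntermediateField.adjoin ℂ (Set.range x)) := by
  have hza : ∀ i l, IsAlgebraic (Algebra.adjoin ℂ (Set.range
      (fun j : {j : State n // j ≠ 0} => payoffCoeff π i j.1) ∪ {marginalRatio π i})) (z l) :=
    fun i l => isAlgebraic_adjoin_of_mem (mem_adjoin_payoffCoeff hπ hz i l)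
  have h := algebraicIndependent_extendedFamily
    (x := fun q : Fin n × {j : State n // j ≠ 0} => x (q.1, q.2.1)) (w := fun i => x (i, 0))
    (f := fun i j => payoffCoeff π i j.1) hn hind hgen (fun i j => payoffCoeff_mem hπz i j.1)
    (fun i => payoff_zero_eq hπ i (hq i)) (fun i => ⟨marginalRatio π i, hza i, fun hi => ?_⟩) hnm
  · rw [range_extendedFamily_payoffs] at h
    refine ⟨?_, h.2⟩
    let e : Fin n × State n → Fin n × Option {j : State n // j ≠ 0} := fun q =>
      (q.1, if h : q.2 = 0 then none else some ⟨q.2, h⟩)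
    have he : Function.Injective e := by
      rintro ⟨i, j⟩ ⟨i', j'⟩ hij
      obtain ⟨rfl, h2⟩ := Prod.ext_iff.1 hij
      refine Prod.ext rfl ?_
      by_cases hj : j = 0 <;> by_cases hj' : j' = 0 <;> simp [e, hj, hj'] at h2 ⊢
      exact h2
    suffices hx : extendedFamily (fun q : Fin n × {j : State n // j ≠ 0} => x (q.1, q.2.1))
        (fun i => x (i, 0)) ∘ e = x by
      rw [← hx]
      exact h.1.comp e he
    funext ⟨i, j⟩
    by_cases hj : j = 0
    · simp [e, hj, extendedFamily]
    · simp [e, hj, extendedFamily]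
  · set s := extendedFamily (fun q : Fin n × {j : State n // j ≠ 0} => x (q.1, q.2.1))
      (fun i => x (i, 0)) '' {q | q.1.val < i.val} ∪
        Set.range fun j : {j : State n // j ≠ 0} => payoffCoeff π i j.1
    -- The first player precedes `i`, so all payoffs of this player are among the generators.
    let o : Fin n := ⟨0, by omega⟩
    have ha := isAlgebraic_marginalRatio hπ hind hπz o i (fun h => by
      rw [← h] at hi; exact lt_irrefl _ hi) (hq o) (K := IntermediateField.adjoin ℂ s)
      (fun j => IntermediateField.subset_adjoin _ _ (Or.inl (by
        by_cases hj : j = 0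
        · exact ⟨(o, none), hi, by rw [hj]; rfl⟩
        · exact ⟨(o, some ⟨j, hj⟩), hi, rfl⟩)))
      (fun j => by
        by_cases hj : j = 0
        · rw [hj, payoffCoeff_zero hπ]
          exact neg_mem (one_mem _)
        · exact IntermediateField.subset_adjoin _ _ (Or.inr ⟨⟨j, hj⟩, rfl⟩))
    open scoped IntermediateField.algebraAdjoinAdjoin in
    exact ha.restrictScalars (Algebra.adjoin ℂ s)

end payoffs

end SpohnCI

namespace SpohnCI

/-! ### Coordinate rings of parametrized families -/

section coordRing

variable {n m : ℕ}

/-- `R` is a ring of functions of the parameters `z` for which the distribution `π z` lies outside of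
all special hyperplanes and in `Q`. -/
structure IsCoordRing (π : State n → MvPolynomial (Fin m) ℂ) (Q : Set (State n → ℂ)) (R : Type)
    [CommRing R] [Algebra ℂ R] (z : Fin m → R) : Prop where
  finiteType : Algebra.FiniteType ℂ R
  isUnit_coord : ∀ j, IsUnit (MvPolynomial.aeval z (π j))
  isUnit_sum : IsUnit (MvPolynomial.aeval z (∑ j, π j))
  mem : ∀ χ : R →ₐ[ℂ] ℂ, (fun j => MvPolynomial.eval (fun l => χ (z l)) (π j)) ∈ Q
  exists_hom : ∀ y : Fin m → ℂ, (∀ j, MvPolynomial.eval y (π j) ≠ 0) →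
    MvPolynomial.eval y (∑ j, π j) ≠ 0 → (fun j => MvPolynomial.eval y (π j)) ∈ Q →
    ∃ χ : R →ₐ[ℂ] ℂ, ∀ l, χ (z l) = y l
  isAlgebraic : IsDomain R → ∀ r : R, IsAlgebraic (Algebra.adjoin ℂ (Set.range z)) r

/-- The equation of the Spohn variety for player `i`, evaluated at a distribution. -/
def spohnEquations (x : Fin n × State n → ℂ) : Set (State n → ℂ) :=
  {v | ∀ i, (∑ j with j i = 0, v j) * (∑ j with j i = 1, x (i, j) * v j) =
    (∑ j with j i = 1, v j) * ∑ j with j i = 0, x (i, j) * v j}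

theorem isAlgebraic_of_isUnit_mul {R : Type} [CommRing R] [IsDomain R] [Algebra ℂ R]
    {S : Subalgebra ℂ R} {a b : R} (hu : IsUnit a) (ha : IsAlgebraic S a)
    (hab : IsAlgebraic S (a * b)) : IsAlgebraic S b :=
  IsAlgebraic.of_mul hu.mem_nonZeroDivisors ha hab

/-- The polynomial which has to be inverted to get into the complement of the special
hyperplanes. -/
noncomputable def specialProduct {σ : Type} (π : State n → MvPolynomial σ ℂ) : MvPolynomial σ ℂ :=
  (∏ j, π j) * ∑ j, π j

theorem eval_specialProduct_ne_zero {σ : Type} {π : State n → MvPolynomial σ ℂ} {y : σ → ℂ} :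
    MvPolynomial.eval y (specialProduct π) ≠ 0 ↔
      (∀ j, MvPolynomial.eval y (π j) ≠ 0) ∧ MvPolynomial.eval y (∑ j, π j) ≠ 0 := by
  rw [specialProduct, map_mul, mul_ne_zero_iff, map_prod, Finset.prod_ne_zero_iff]
  simp

/-- One point with positive real coordinates ensures that no partial sum of coordinates vanishes
identically, so all denominators occurring above are nonzero. -/
theorem specialProduct_ne_zero {π : State n → MvPolynomial (Fin m) ℂ} {z₀ : Fin m → ℂ}
    (hpos : ∀ j, ∃ r : ℝ, 0 < r ∧ MvPolynomial.eval z₀ (π j) = r) (s : Finset (State n))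
    (hs : s.Nonempty) : MvPolynomial.eval z₀ (∑ j ∈ s, π j) ≠ 0 := by
  choose r hr hr' using hpos
  rw [map_sum, Finset.sum_congr rfl fun j _ => hr' j, ← Complex.ofReal_sum]
  exact_mod_cast (Finset.sum_pos (fun j _ => hr j) hs).ne'

section localization

variable {σ : Type} {π : State n → MvPolynomial σ ℂ} {A : Type} [CommRing A]
  [Algebra (MvPolynomial σ ℂ) A] [IsLocalization.Away (specialProduct π) A]

theorem isUnit_coord_of_away (j : State n) :
    IsUnit (algebraMap (MvPolynomial σ ℂ) A (π j)) := by
  have h := IsLocalization.Away.algebraMap_isUnit (S := A) (specialProduct π)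
  rw [specialProduct, map_mul, IsUnit.mul_iff, map_prod] at h
  exact isUnit_of_dvd_unit (Finset.dvd_prod_of_mem (fun k => algebraMap (MvPolynomial σ ℂ) A (π k))
    (Finset.mem_univ j)) h.1

theorem isUnit_sum_of_away :
    IsUnit (algebraMap (MvPolynomial σ ℂ) A (∑ j, π j)) := by
  have h := IsLocalization.Away.algebraMap_isUnit (S := A) (specialProduct π)
  rw [specialProduct, map_mul, IsUnit.mul_iff] at h
  exact h.2

theorem exists_hom_of_away [Algebra ℂ A] [IsScalarTower ℂ (MvPolynomial σ ℂ) A] (y : σ → ℂ)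
    (hy : MvPolynomial.eval y (specialProduct π) ≠ 0) :
    ∃ χ : A →ₐ[ℂ] ℂ, ∀ f, χ (algebraMap (MvPolynomial σ ℂ) A f) = MvPolynomial.eval y f := by
  have hu : IsUnit (MvPolynomial.aeval (R := ℂ) y (specialProduct π)) := by
    exact IsUnit.mk0 _ hy
  have hu' : ∀ a : Submonoid.powers (specialProduct π),
      IsUnit ((MvPolynomial.aeval y : MvPolynomial σ ℂ →ₐ[ℂ] ℂ) a) := by
    rintro ⟨_, k, rfl⟩
    rw [map_pow]
    exact hu.pow k
  refine ⟨IsLocalization.liftAlgHom (M := Submonoid.powers (specialProduct π)) hu', fun f => ?_⟩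
  rw [IsLocalization.liftAlgHom_apply, IsLocalization.lift_eq]
  rfl

end localization

theorem isAlgebraic_of_away {σ : Type} (π : State n → MvPolynomial σ ℂ) {A : Type} [CommRing A]
    [Algebra (MvPolynomial σ ℂ) A] [IsLocalization.Away (specialProduct π) A]
    [Algebra ℂ A] [IsScalarTower ℂ (MvPolynomial σ ℂ) A]
    {R : Type} [CommRing R] [IsDomain R] [Algebra ℂ R] (φ : A →ₐ[ℂ] R)
    (hφ : Function.Surjective φ) (S : Subalgebra ℂ R)
    (hS : ∀ l, IsAlgebraic S (φ (algebraMap (MvPolynomial σ ℂ) A (MvPolynomial.X l)))) (r : R) :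
    IsAlgebraic S r := by
  have hB : ∀ f : MvPolynomial σ ℂ, IsAlgebraic S (φ (algebraMap (MvPolynomial σ ℂ) A f)) := by
    intro f
    induction f using MvPolynomial.induction_on with
    | C c =>
      rw [← MvPolynomial.algebraMap_eq, ← IsScalarTower.algebraMap_apply, AlgHom.commutes]
      exact isAlgebraic_algebraMap (algebraMap ℂ S c)
    | add f g hf hg =>
      rw [map_add, map_add]
      exact hf.add hg
    | mul_X f l hf =>
      rw [map_mul, map_mul]
      exact hf.mul (hS l)
  obtain ⟨a, rfl⟩ := hφ r
  obtain ⟨k, f, hf⟩ := IsLocalization.Away.surj (specialProduct π) a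
  refine isAlgebraic_of_isUnit_mul (a := φ (algebraMap (MvPolynomial σ ℂ) A
    (specialProduct π) ^ k)) ?_ ?_ ?_
  · exact ((IsLocalization.Away.algebraMap_isUnit (S := A) (specialProduct π)).pow k).map φ
  · rw [← map_pow]
    exact hB _
  · rw [← map_mul, mul_comm, hf]
    exact hB _

theorem isCoordRing_away (π : State n → MvPolynomial (Fin m) ℂ) :
    IsCoordRing π Set.univ (Localization.Away (specialProduct π))
      fun l => algebraMap (MvPolynomial (Fin m) ℂ) _ (MvPolynomial.X l) := by
  have hz : ∀ f : MvPolynomial (Fin m) ℂ, MvPolynomial.aeval (fun l => algebraMap (MvPolynomial (Fin m) ℂ)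
      (Localization.Away (specialProduct π)) (MvPolynomial.X l)) f = algebraMap _ _ f := by
    intro f
    have := MvPolynomial.aeval_algebraMap_apply (Localization.Away (specialProduct π))
      (MvPolynomial.X : Fin m → MvPolynomial (Fin m) ℂ) f
    rw [MvPolynomial.aeval_X_left_apply] at this
    exact this
  refine ⟨?_, fun j => ?_, ?_, fun _ => trivial, fun y h1 h2 _ => ?_, fun _ r => ?_⟩
  · exact Algebra.FiniteType.trans (S := MvPolynomial (Fin m) ℂ) inferInstance
      (IsLocalization.finiteType_of_monoid_fg (Submonoid.powers (specialProduct π)) _)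
  · rw [hz]
    exact isUnit_coord_of_away j
  · rw [hz]
    exact isUnit_sum_of_away
  · obtain ⟨χ, hχ⟩ := exists_hom_of_away (π := π) (A := Localization.Away (specialProduct π)) y
      (eval_specialProduct_ne_zero.2 ⟨h1, h2⟩)
    exact ⟨χ, fun l => by rw [hχ, MvPolynomial.eval_X]⟩
  · refine isAlgebraic_of_away π (AlgHom.id ℂ (Localization.Away (specialProduct π)))
      Function.surjective_id _ (fun l => ?_) r
    exact isAlgebraic_algebraMap (⟨_, Algebra.subset_adjoin ⟨l, rfl⟩⟩ :
      Algebra.adjoin ℂ (Set.range fun l => algebraMap (MvPolynomial (Fin m) ℂ)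
        (Localization.Away (specialProduct π)) (MvPolynomial.X l)))

/-! ### The universal game -/

section solvedPayoff

variable {R : Type} [CommRing R]

/-- The payoffs at the constant states are determined by the conditional expected payoffs `K` and
the remaining payoffs. -/
noncomputable def solvedPayoff (P : State n → R) (Y : Fin n → State n → R) (K : Fin n → R)
    (q : Fin n × State n) : R :=
  if ∀ k, q.2 k = q.2 q.1 then Ring.inverse (P q.2) *
    (K q.1 * (∑ k with k q.1 = q.2 q.1, P k) -
      ∑ k with k q.1 = q.2 q.1 ∧ k ≠ q.2, Y q.1 k * P k)
  else Y q.1 q.2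

/-- Among the states where player `i` chooses `c` exactly one is constant, and the payoff there was
chosen to make the conditional expected payoff equal to `K i`. Equality of the two conditional
payoffs then holds identically. -/
theorem sum_solvedPayoff {P : State n → R} (hP : ∀ j, IsUnit (P j)) (Y : Fin n → State n → R)
    (K : Fin n → R) (i : Fin n) (c : Fin 2) :
    ∑ j with j i = c, solvedPayoff P Y K (i, j) * P j = K i * ∑ j with j i = c, P j := by
  classical
  have hc : (Function.const (Fin n) c) ∈ Finset.univ.filter fun j : State n => j i = c := by simp
  rw [← Finset.add_sum_erase _ _ hc]
  have h1 : solvedPayoff P Y K (i, Function.const (Fin n) c) * P (Function.const (Fin n) c) =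
      K i * (∑ k with k i = c, P k) -
      ∑ k with k i = c ∧ k ≠ Function.const (Fin n) c, Y i k * P k := by
    rw [solvedPayoff, if_pos (by simp), mul_comm, ← mul_assoc,
      Ring.mul_inverse_cancel _ (hP _), one_mul]
    rfl
  have h2 : ∑ j ∈ (Finset.univ.filter fun j : State n => j i = c).erase (Function.const (Fin n) c),
      solvedPayoff P Y K (i, j) * P j =
      ∑ k with k i = c ∧ k ≠ Function.const (Fin n) c, Y i k * P k := by
    refine Finset.sum_congr ?_ fun j hj => ?_
    · ext j
      simp [and_comm]
    · have hj' : j i = c ∧ j ≠ Function.const (Fin n) c := by simpa using hj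
      rw [solvedPayoff, if_neg]
      intro h
      exact hj'.2 (funext fun k => (h k).trans hj'.1)
  rw [h1, h2]
  ring

end solvedPayoff

end coordRing

end SpohnCI

namespace SpohnCI

/-! ### The universal game and its fibres -/

section universalGame

variable {n m : ℕ}

variable (n m) in
/-- The variables of the universal game with distributions parametrized by `Fin m`: the payoff of
player `i` at the state `1` is replaced by the expected payoff of player `i`. -/
abbrev GameVar : Type := Fin m ⊕ Fin n × {j : State n // j ≠ 0}

/-- The distribution of the universal game. -/
noncomputable def gameDistribution (π : State n → MvPolynomial (Fin m) ℂ) (j : State n) :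
    MvPolynomial (GameVar n m) ℂ :=
  MvPolynomial.rename Sum.inl (π j)

/-- The ring of functions on the space of games with a Spohn point. -/
abbrev GameRing (π : State n → MvPolynomial (Fin m) ℂ) : Type :=
  Localization.Away (specialProduct (gameDistribution π))

variable (π : State n → MvPolynomial (Fin m) ℂ)

/-- The coordinates of the universal distribution. -/
noncomputable def gameCoord (j : State n) : GameRing π :=
  algebraMap (MvPolynomial (GameVar n m) ℂ) _ (gameDistribution π j)

/-- The free payoffs of the universal game. -/
noncomputable def gameFree (i : Fin n) (j : State n) : GameRing π :=
  if h : j ≠ 0 then algebraMap (MvPolynomial (GameVar n m) ℂ) _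
    (MvPolynomial.X (Sum.inr (i, ⟨j, h⟩))) else 0

/-- The parameters of the universal distribution. -/
noncomputable def gameParam (l : Fin m) : GameRing π :=
  algebraMap (MvPolynomial (GameVar n m) ℂ) _ (MvPolynomial.X (Sum.inl l))

/-- The payoffs of the universal game. -/
noncomputable def gamePayoff (q : Fin n × State n) : GameRing π :=
  solvedPayoff (gameCoord π) (gameFree π) (fun i => gameFree π i 1) q

theorem aeval_gameParam (f : MvPolynomial (Fin m) ℂ) : MvPolynomial.aeval (gameParam π) f =
    algebraMap (MvPolynomial (GameVar n m) ℂ) (GameRing π) (MvPolynomial.rename Sum.inl f) := by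
  have h := MvPolynomial.aeval_algebraMap_apply (GameRing π)
    (fun l => (MvPolynomial.X (Sum.inl l) : MvPolynomial (GameVar n m) ℂ)) f
  refine h.trans ?_
  have h' : MvPolynomial.aeval (fun l => (MvPolynomial.X (Sum.inl l) :
      MvPolynomial (GameVar n m) ℂ)) = MvPolynomial.rename (R := ℂ) Sum.inl :=
    MvPolynomial.algHom_ext fun l => by simp
  rw [h']

theorem aeval_gameParam_coord (j : State n) :
    MvPolynomial.aeval (gameParam π) (π j) = gameCoord π j :=
  aeval_gameParam π (π j)

theorem isUnit_gameCoord (j : State n) : IsUnit (gameCoord π j) := isUnit_coord_of_away j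

theorem isUnit_sum_gameCoord : IsUnit (∑ j, gameCoord π j) := by
  have := isUnit_sum_of_away (π := gameDistribution π) (A := GameRing π)
  rwa [map_sum] at this

theorem sum_gamePayoff (i : Fin n) (c : Fin 2) :
    ∑ j with j i = c, gamePayoff π (i, j) * gameCoord π j =
      gameFree π i 1 * ∑ j with j i = c, gameCoord π j :=
  sum_solvedPayoff (isUnit_gameCoord π) _ _ i c

theorem one_ne_zero_state (i : Fin n) : (1 : State n) ≠ 0 := fun h =>
  one_ne_zero (α := Fin 2) (congrFun h i)

theorem gamePayoff_eq_of_ne {q : Fin n × State n} (h0 : q.2 ≠ 0) (h1 : q.2 ≠ 1) :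
    gamePayoff π q = gameFree π q.1 q.2 := by
  rw [gamePayoff, solvedPayoff, if_neg]
  intro h
  obtain hc | hc : q.2 q.1 = 0 ∨ q.2 q.1 = 1 := by omega
  · exact h0 (funext fun k => (h k).trans hc)
  · exact h1 (funext fun k => (h k).trans hc)

theorem eval_specialProduct_game {y : GameVar n m → ℂ} :
    MvPolynomial.eval y (specialProduct (gameDistribution π)) =
      MvPolynomial.eval (fun l => y (Sum.inl l)) (specialProduct π) := by
  simp only [specialProduct, gameDistribution, map_mul, map_prod, map_sum,
    MvPolynomial.eval_rename, Function.comp_def]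

theorem isDomain_gameRing (h : specialProduct π ≠ 0) : IsDomain (GameRing π) := by
  refine IsLocalization.isDomain_localization (powers_le_nonZeroDivisors_of_noZeroDivisors ?_)
  have : specialProduct (gameDistribution π) = MvPolynomial.rename Sum.inl (specialProduct π) := by
    simp only [specialProduct, gameDistribution, map_mul, map_prod, map_sum]
  rw [this]
  exact fun h0 => h (MvPolynomial.rename_injective _ Sum.inl_injective (h0.trans (map_zero _).symm))

theorem algebraMap_gameRing_injective (h : specialProduct π ≠ 0) :
    Function.Injective (algebraMap (MvPolynomial (GameVar n m) ℂ) (GameRing π)) := by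
  refine IsLocalization.injective _ (M := Submonoid.powers (specialProduct (gameDistribution π)))
    (powers_le_nonZeroDivisors_of_noZeroDivisors ?_)
  have : specialProduct (gameDistribution π) = MvPolynomial.rename Sum.inl (specialProduct π) := by
    simp only [specialProduct, gameDistribution, map_mul, map_prod, map_sum]
  rw [this]
  exact fun h0 => h (MvPolynomial.rename_injective _ Sum.inl_injective (h0.trans (map_zero _).symm))

theorem finiteType_gameRing : Algebra.FiniteType ℂ (GameRing π) :=
  Algebra.FiniteType.trans (S := MvPolynomial (GameVar n m) ℂ) inferInstance
    (IsLocalization.finiteType_of_monoid_fg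
      (Submonoid.powers (specialProduct (gameDistribution π))) _)

/-- Setting the universal payoffs equal to `x` leaves the ring of distributions in the family
satisfying the equations of the game `x`. A point determines all variables of the universal game,
since the auxiliary one is the expected payoff. -/
theorem isCoordRing_game (x : Fin n × State n → ℂ) (I : Ideal (GameRing π))
    (hI : I = Ideal.span (Set.range fun q => gamePayoff π q - algebraMap ℂ _ (x q))) :
    IsCoordRing π (spohnEquations x) (GameRing π ⧸ I)
      fun l => Ideal.Quotient.mk I (gameParam π l) := by
  have hz : ∀ f : MvPolynomial (Fin m) ℂ, MvPolynomial.aeval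
      (fun l => Ideal.Quotient.mk I (gameParam π l)) f =
        Ideal.Quotient.mk I (MvPolynomial.aeval (gameParam π) f) := fun f =>
    MvPolynomial.aeval_algebraMap_apply (GameRing π ⧸ I) (gameParam π) f
  have hx : ∀ q, Ideal.Quotient.mk I (gamePayoff π q) = algebraMap ℂ _ (x q) := fun q => by
    refine (Ideal.Quotient.eq (I := I) (y := algebraMap ℂ _ (x q))).2 ?_
    rw [hI]
    exact Ideal.subset_span ⟨q, rfl⟩
  have hfin := finiteType_gameRing π
  refine ⟨?_, fun j => ?_, ?_, fun χ i => ?_, fun y h1 h2 hQ => ?_, fun _ r => ?_⟩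
  · exact Algebra.FiniteType.of_surjective (Ideal.Quotient.mkₐ ℂ I) Ideal.Quotient.mk_surjective
  · rw [hz, aeval_gameParam_coord]
    exact (isUnit_gameCoord π j).map _
  · rw [hz, map_sum]
    simp only [aeval_gameParam_coord]
    exact (isUnit_sum_gameCoord π).map _
  · have hv : ∀ j, MvPolynomial.eval (fun l => χ (Ideal.Quotient.mk I (gameParam π l))) (π j) =
        χ (Ideal.Quotient.mk I (gameCoord π j)) := fun j => by
      rw [← aeval_gameParam_coord, ← hz]
      exact (MvPolynomial.comp_aeval_apply _ χ (π j)).symm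
    simp only [hv]
    have hs : ∀ c, ∑ j with j i = c, x (i, j) * χ (Ideal.Quotient.mk I (gameCoord π j)) =
        χ (Ideal.Quotient.mk I (gameFree π i 1)) *
          ∑ j with j i = c, χ (Ideal.Quotient.mk I (gameCoord π j)) := fun c => by
      have := congrArg (fun a => χ (Ideal.Quotient.mk I a)) (sum_gamePayoff π i c)
      simp only [map_sum, map_mul, hx, AlgHom.commutes] at this
      exact this
    rw [hs, hs]
    ring
  · set v : State n → ℂ := fun j => MvPolynomial.eval y (π j) with hv
    rw [map_sum] at h2
    -- The variable at the state `1` must be the common value of the two conditional expected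
    -- payoffs, hence the total expected payoff divided by the total mass.
    let pt : GameVar n m → ℂ := Sum.elim y fun q =>
      if q.2.1 = 1 then (∑ j, x (q.1, j) * v j) / ∑ j, v j else x (q.1, q.2.1)
    obtain ⟨χ, hχ⟩ := exists_hom_of_away (π := gameDistribution π) (A := GameRing π) pt (by
      rw [eval_specialProduct_game]
      exact eval_specialProduct_ne_zero.2 ⟨h1, by rwa [map_sum]⟩)
    have hcoord : ∀ j, χ (gameCoord π j) = v j := fun j => by
      rw [gameCoord, hχ, gameDistribution, MvPolynomial.eval_rename]
      rfl
    have hK : ∀ i, χ (gameFree π i 1) = (∑ j, x (i, j) * v j) / ∑ j, v j := fun i => by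
      rw [gameFree, dif_pos (one_ne_zero_state i), hχ, MvPolynomial.eval_X]
      exact if_pos rfl
    have hfree : ∀ q : Fin n × State n, q.2 ≠ 0 → q.2 ≠ 1 → χ (gamePayoff π q) = x q := by
      intro q h0 h1
      rw [gamePayoff_eq_of_ne π h0 h1, gameFree, dif_pos h0, hχ, MvPolynomial.eval_X]
      exact if_neg h1
    have hsum : ∀ i c, ∑ j with j i = c, χ (gamePayoff π (i, j)) * v j =
        ∑ j with j i = c, x (i, j) * v j := by
      intro i c
      have h3 := congrArg χ (sum_gamePayoff π i c)
      simp only [map_sum, map_mul, hcoord, hK] at h3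
      rw [h3, div_mul_eq_mul_div, div_eq_iff h2]
      have hq : (∑ j with j i = 0, v j) * (∑ j with j i = 1, x (i, j) * v j) =
        (∑ j with j i = 1, v j) * ∑ j with j i = 0, x (i, j) * v j := hQ i
      rw [sum_filter_eq_zero_add_one i Finset.univ v,
        sum_filter_eq_zero_add_one i Finset.univ fun j => x (i, j) * v j]
      obtain rfl | rfl : c = 0 ∨ c = 1 := by omega
      · linear_combination hq
      · linear_combination -hq
    have hall : ∀ q, χ (gamePayoff π q) = x q := by
      rintro ⟨i, j⟩
      have h3 := hsum i (j i)
      have hj : j ∈ Finset.univ.filter fun k : State n => k i = j i := by simp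
      rw [← Finset.add_sum_erase _ _ hj, ← Finset.add_sum_erase _ _ hj] at h3
      -- At the constant states the payoff is forced: it is the only unknown in a sum whose value is
      -- correct, and its coefficient `v j` is nonzero.
      by_cases hj0 : j = 0 ∨ j = 1
      · have h4 : ∀ k ∈ (Finset.univ.filter fun k : State n => k i = j i).erase j,
            χ (gamePayoff π (i, k)) * v k = x (i, k) * v k := by
          intro k hk
          have hk' : k ≠ j ∧ k i = j i := by simpa using hk
          rw [hfree (i, k)]
          · rintro rfl
            rcases hj0 with rfl | rfl
            · exact hk'.1 rfl
            · exact absurd hk'.2 (by simp)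
          · rintro rfl
            rcases hj0 with rfl | rfl
            · exact absurd hk'.2 (by simp)
            · exact hk'.1 rfl
        rw [Finset.sum_congr rfl h4] at h3
        exact mul_right_cancel₀ (h1 j) (add_right_cancel h3)
      · rw [not_or] at hj0
        exact hfree (i, j) hj0.1 hj0.2
    refine ⟨Ideal.Quotient.liftₐ I χ ?_, fun l => ?_⟩
    · have : I ≤ RingHom.ker χ := by
        rw [hI, Ideal.span_le]
        rintro _ ⟨q, rfl⟩
        simp [hall q]
      exact fun a ha => this ha
    · refine (Ideal.Quotient.liftₐ_apply I χ _ _).trans ?_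
      refine (Ideal.Quotient.lift_mk I _ _).trans ?_
      change χ (gameParam π l) = y l
      rw [gameParam, hχ, MvPolynomial.eval_X]
      rfl
  · set S := Algebra.adjoin ℂ (Set.range fun l => Ideal.Quotient.mk I (gameParam π l)) with hS
    have hcS : ∀ j, Ideal.Quotient.mk I (gameCoord π j) ∈ S := fun j => by
      rw [← aeval_gameParam_coord, ← hz, hS, Algebra.adjoin_range_eq_range_aeval]
      exact ⟨_, rfl⟩
    have halg : ∀ a ∈ S, IsAlgebraic S a := fun a ha => isAlgebraic_algebraMap (⟨a, ha⟩ : S)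
    refine isAlgebraic_of_away (gameDistribution π) (Ideal.Quotient.mkₐ ℂ I)
      Ideal.Quotient.mk_surjective S ?_ r
    rintro (l | ⟨i, j, hj⟩)
    · exact halg _ (Algebra.subset_adjoin ⟨l, rfl⟩)
    · have hfree : algebraMap (MvPolynomial (GameVar n m) ℂ) (GameRing π)
          (MvPolynomial.X (Sum.inr (i, ⟨j, hj⟩))) = gameFree π i j := by
        rw [gameFree, dif_pos hj]
      rw [hfree]
      change IsAlgebraic S (Ideal.Quotient.mk I (gameFree π i j))
      by_cases hj1 : j = 1
      · rw [hj1]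
        refine isAlgebraic_of_isUnit_mul ((isUnit_sum_gameCoord π).map (Ideal.Quotient.mk I)) ?_ ?_
        · rw [map_sum]
          exact halg _ (sum_mem fun j _ => hcS j)
        · rw [← map_mul, mul_comm, sum_filter_eq_zero_add_one i, mul_add, ← sum_gamePayoff,
            ← sum_gamePayoff, ← sum_filter_eq_zero_add_one i Finset.univ, map_sum]
          refine halg _ (sum_mem fun j _ => ?_)
          rw [map_mul, hx]
          exact mul_mem (S.algebraMap_mem _) (hcS j)
      · rw [← gamePayoff_eq_of_ne π (q := (i, j)) hj hj1, hx]
        exact halg _ (S.algebraMap_mem _)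

/-- The universal game ring has transcendence degree `n * 2 ^ n + (m - n)`, and its payoffs are `n *
2 ^ n` independent elements. So the fibres over general games are nontrivial, finite if `n = m`, and
domains of transcendence degree `m - n` if `n < m`. -/
theorem exists_coordRing (hn : n ≠ 1) (hnm : n ≤ m) {z₀ : Fin m → ℂ}
    (hpos : ∀ j, ∃ r : ℝ, 0 < r ∧ MvPolynomial.eval z₀ (π j) = r)
    (hz : ∀ l, ∃ b c : State n → ℂ, ∑ j, MvPolynomial.C (b j) * π j ≠ 0 ∧
      MvPolynomial.X l * ∑ j, MvPolynomial.C (b j) * π j = ∑ j, MvPolynomial.C (c j) * π j) :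
    ∃ F : MvPolynomial (Fin n × State n) ℂ, F ≠ 0 ∧ ∀ x, MvPolynomial.eval x F ≠ 0 →
      ∃ (R : Type) (_ : CommRing R) (_ : Algebra ℂ R) (z : Fin m → R),
        IsCoordRing π (spohnEquations x) R z ∧ Nontrivial R ∧ (n = m → Module.Finite ℂ R) ∧
        (n < m → IsDomain R ∧ Algebra.trdeg ℂ R = (m - n : ℕ)) := by
  have hsum : ∀ s : Finset (State n), s.Nonempty → ∑ j ∈ s, π j ≠ 0 := fun s hs h0 =>
    specialProduct_ne_zero hpos s hs (by rw [h0, map_zero])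
  have hsp : specialProduct π ≠ 0 := mul_ne_zero
    (Finset.prod_ne_zero_iff.2 fun j _ => by simpa using hsum {j} (Finset.singleton_nonempty j))
    (hsum _ Finset.univ_nonempty)
  have hinjA := algebraMap_gameRing_injective π hsp
  have := isDomain_gameRing π hsp
  have := finiteType_gameRing π
  let L := FractionRing (GameRing π)
  let ι := algebraMap (GameRing π) L
  have hι : Function.Injective ι := IsFractionRing.injective (GameRing π) L
  let ιz : MvPolynomial (Fin m) ℂ →ₐ[ℂ] L := MvPolynomial.aeval fun l => ι (gameParam π l)
  have hιz : ∀ f, ιz f = ι (MvPolynomial.aeval (gameParam π) f) := fun f =>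
    MvPolynomial.aeval_algebraMap_apply L (gameParam π) f
  have hιz' : Function.Injective ιz := by
    intro f g hfg
    rw [hιz, hιz, aeval_gameParam, aeval_gameParam] at hfg
    exact MvPolynomial.rename_injective _ Sum.inl_injective (hinjA (hι hfg))
  have hιπ : ∀ j, ιz (π j) = ι (gameCoord π j) := fun j => by
    rw [hιz, aeval_gameParam_coord]
  let y : Fin m ⊕ Fin n × {j : State n // j ≠ 0} → L :=
    Sum.elim (fun l => ι (gameParam π l)) fun q => ι (gamePayoff π (q.1, q.2.1))
  have hcard : Nat.card (Fin n × State n) + (m - n) = Fintype.card (GameVar n m) := by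
    have h2 : 0 < Fintype.card (State n) := Fintype.card_pos
    rw [Nat.card_eq_fintype_card, Fintype.card_sum, Fintype.card_prod, Fintype.card_prod,
      Fintype.card_fin, Fintype.card_fin, Fintype.card_subtype_compl, Fintype.card_subtype_eq,
      Nat.mul_sub, mul_one]
    have := Nat.le_mul_of_pos_right n h2
    omega
  have htrA : Algebra.trdeg ℂ (GameRing π) = (Nat.card (Fin n × State n) + (m - n) : ℕ) := by
    have : FaithfulSMul (MvPolynomial (GameVar n m) ℂ) (GameRing π) :=
      (faithfulSMul_iff_algebraMap_injective _ _).2 hinjA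
    have : Algebra.IsAlgebraic (MvPolynomial (GameVar n m) ℂ) (GameRing π) :=
      IsLocalization.isAlgebraic _ (Submonoid.powers (specialProduct (gameDistribution π)))
    have h := _root_.trdeg_add_eq ℂ (MvPolynomial (GameVar n m) ℂ) (A := GameRing π)
    rw [_root_.trdeg_eq_zero (R := MvPolynomial (GameVar n m) ℂ) (A := GameRing π),
      MvPolynomial.trdeg_of_isDomain, add_zero, Cardinal.mk_fintype] at h
    rw [← h, hcard, Cardinal.lift_natCast]
  have htrL : Algebra.trdeg ℂ L = Fintype.card (GameVar n m) := by
    have : FaithfulSMul (GameRing π) L := (faithfulSMul_iff_algebraMap_injective _ _).2 hι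
    have : Algebra.IsAlgebraic (GameRing π) L := IsLocalization.isAlgebraic _
      (nonZeroDivisors (GameRing π))
    have h := _root_.trdeg_add_eq ℂ (GameRing π) (A := L)
    rw [_root_.trdeg_eq_zero (R := GameRing π) (A := L), add_zero, htrA, hcard] at h
    exact h.symm
  have hπ : ∀ s : Finset (State n), s.Nonempty → ∑ j ∈ s, ι (gameCoord π j) ≠ 0 := by
    intro s hs h0
    simp only [← hιπ] at h0
    rw [← map_sum] at h0
    exact hsum s hs (hιz' (h0.trans (map_zero _).symm))
  have hq : ∀ i c, ∑ j with j i = c, ι (gamePayoff π (i, j)) * ι (gameCoord π j) =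
      ι (gameFree π i 1) * ∑ j with j i = c, ι (gameCoord π j) := by
    intro i c
    have := congrArg ι (sum_gamePayoff π i c)
    simpa only [map_sum, map_mul] using this
  have hzK : ∀ K : IntermediateField ℂ L, (∀ l, ι (gameParam π l) ∈ K) → ∀ f, ιz f ∈ K := by
    intro K hK f
    have : ιz f ∈ Algebra.adjoin ℂ (Set.range fun l => ι (gameParam π l)) := by
      rw [Algebra.adjoin_range_eq_range_aeval]
      exact ⟨f, rfl⟩
    refine Algebra.adjoin_le (S := K.toSubalgebra) ?_ this
    rintro _ ⟨l, rfl⟩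
    exact hK l
  have hgen : IntermediateField.adjoin ℂ (Set.range y) = ⊤ := by
    set K := IntermediateField.adjoin ℂ (Set.range y) with hK
    have hKz : ∀ l, ι (gameParam π l) ∈ K := fun l =>
      IntermediateField.subset_adjoin _ _ ⟨Sum.inl l, rfl⟩
    have hKπ : ∀ j, ι (gameCoord π j) ∈ K := fun j => by
      rw [← hιπ]
      exact hzK K hKz _
    have hKx : ∀ (i : Fin n) (j : State n), j ≠ 0 → ι (gamePayoff π (i, j)) ∈ K := fun i j hj =>
      IntermediateField.subset_adjoin _ _ ⟨Sum.inr (i, ⟨j, hj⟩), rfl⟩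
    -- The expected payoff is recovered from the states where player `i` chooses `1`. These do not
    -- include the state `0`, whose payoff is not among the generators.
    have hKf : ∀ (i : Fin n) (j : State n), j ≠ 0 → ι (gameFree π i j) ∈ K := by
      intro i j hj
      by_cases hj1 : j = 1
      · have h1 : ∑ j with j i = 1, ι (gameCoord π j) ≠ 0 := hπ _ ⟨1, by simp⟩
        rw [hj1, ← mul_div_cancel_right₀ (ι (gameFree π i 1)) h1, ← hq]
        refine div_mem (sum_mem fun k hk => mul_mem (hKx i k ?_) (hKπ k))
          (sum_mem fun k _ => hKπ k)
        rintro rfl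
        simp at hk
      · rw [← gamePayoff_eq_of_ne π (q := (i, j)) hj hj1]
        exact hKx i j hj
    have hKB : ∀ f : MvPolynomial (GameVar n m) ℂ, ι (algebraMap _ (GameRing π) f) ∈ K := by
      intro f
      induction f using MvPolynomial.induction_on with
      | C c =>
        rw [← MvPolynomial.algebraMap_eq, ← IsScalarTower.algebraMap_apply]
        exact K.algebraMap_mem c
      | add f g hf hg =>
        rw [map_add, map_add]
        exact add_mem hf hg
      | mul_X f l hf =>
        rw [map_mul, map_mul]
        refine mul_mem hf ?_
        rcases l with l | ⟨i, j, hj⟩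
        · exact hKz l
        · have := hKf i j hj
          rwa [gameFree, dif_pos hj] at this
    have hKA : ∀ a, ι a ∈ K := by
      intro a
      obtain ⟨k, f, hf⟩ := IsLocalization.Away.surj (specialProduct (gameDistribution π)) a
      have hu := ((IsLocalization.Away.algebraMap_isUnit (S := GameRing π)
        (specialProduct (gameDistribution π))).pow k).map ι
      rw [← mul_div_cancel_right₀ (ι a) hu.ne_zero, ← map_mul, hf, ← map_pow]
      exact div_mem (hKB _) (hKB _)
    rw [eq_top_iff]
    rintro a -
    obtain ⟨b, c, -, rfl⟩ := IsFractionRing.div_surjective (A := GameRing π) a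
    exact div_mem (hKA b) (hKA c)
  -- The generating family `y` has as many members as the transcendence degree, so it is
  -- independent.
  have hind : AlgebraicIndependent ℂ y := by
    have : Algebra.IsAlgebraic (Algebra.adjoin ℂ (Set.range y)) L :=
      ⟨fun a => isAlgebraic_adjoin_of_mem (by rw [hgen]; trivial)⟩
    refine (Algebra.IsAlgebraic.isTranscendenceBasis_of_le_trdeg_of_finite ℂ y ?_).1
    rw [htrL, Cardinal.mk_fintype]
  have hmain := algebraicIndependent_payoffs (z := fun l => ι (gameParam π l))
    (π := fun j => ι (gameCoord π j)) (x := fun q => ι (gamePayoff π q)) hn hnm hπ hind hgen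
    (fun j => by
      rw [← hιπ]
      exact hzK _ (fun l => IntermediateField.subset_adjoin _ _ (Set.mem_range_self l)) _)
    (fun l => by
      obtain ⟨b, c, h1, h2⟩ := hz l
      have e : ∀ b : State n → ℂ, ιz (∑ j, MvPolynomial.C (b j) * π j) =
          ∑ j, algebraMap ℂ L (b j) * ι (gameCoord π j) := fun b => by
        rw [map_sum]
        refine Finset.sum_congr rfl fun j _ => ?_
        rw [map_mul, hιπ, ← MvPolynomial.algebraMap_eq, AlgHom.commutes]
      refine ⟨b, c, ?_, ?_⟩
      · rw [← e]
        exact fun h0 => h1 (hιz' (h0.trans (map_zero _).symm))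
      · rw [← e, ← e, ← h2, map_mul]
        congr 1
        exact (MvPolynomial.aeval_X (fun l => ι (gameParam π l)) l).symm)
    (fun i => by
      rw [hq, hq]
      ring)
  have hX : AlgebraicIndependent ℂ (gamePayoff π) :=
    ((IsScalarTower.toAlgHom ℂ (GameRing π) L).algebraicIndependent_iff hι).1 hmain.1
  obtain ⟨F, hF, hFx⟩ := exists_generic_specialization (gamePayoff π) hX (m - n) htrA
  refine ⟨F, hF, fun x hx => ?_⟩
  obtain ⟨h1, h2, h3⟩ := hFx x hx
  refine ⟨_, inferInstance, inferInstance, _, isCoordRing_game π x _ rfl,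
    Ideal.Quotient.nontrivial_iff.2 h1, fun h => h2 (by omega), fun h => ?_⟩
  obtain ⟨h4, h5⟩ := h3 (hmain.2 h)
  exact ⟨Ideal.Quotient.isDomain_iff_prime _ |>.2 h4, h5⟩

end universalGame

end SpohnCI

namespace SpohnCI

/-! ### Projective closures of parametrized families -/

section projective

open MvPolynomial

variable {σ : Type}

theorem mk_smul (v : σ → ℂ) (hv : v ≠ 0) (t : ℂ) (ht : t ≠ 0) :
    PSpace.mk (t • v) (smul_ne_zero ht hv) = PSpace.mk v hv :=
  (Projectivization.mk_eq_mk_iff' ℂ _ _ _ _).2 ⟨t, rfl⟩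

theorem smul_mem_cone {V : Set (PSpace σ)} {v : σ → ℂ} (hv : v ∈ cone V) {t : ℂ} (ht : t ≠ 0) :
    t • v ∈ cone V := by
  obtain ⟨h, hV⟩ := hv
  exact ⟨smul_ne_zero ht h, by rwa [mk_smul v h t ht]⟩

theorem mk_coords (P : PSpace σ) : PSpace.mk P.coords P.coords_ne_zero = P :=
  Projectivization.mk_rep P

theorem coords_mem_cone {V : Set (PSpace σ)} {P : PSpace σ} : P.coords ∈ cone V ↔ P ∈ V :=
  ⟨fun ⟨_, h⟩ => by rwa [mk_coords] at h, fun h => ⟨P.coords_ne_zero, by rwa [mk_coords]⟩⟩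

theorem eval_smul_homogeneous {f : MvPolynomial σ ℂ} {d : ℕ} (hf : f.IsHomogeneous d) (t : ℂ)
    (v : σ → ℂ) : eval (t • v) f = t ^ d * eval v f := by
  rw [eval_eq, eval_eq, Finset.mul_sum]
  refine Finset.sum_congr rfl fun m hm => ?_
  have hdeg : ∑ i ∈ m.support, m i = d := by
    have := hf (mem_support_iff.mp hm)
    simpa [Finsupp.weight_apply, Finsupp.sum] using this
  simp only [Pi.smul_apply, smul_eq_mul, mul_pow, Finset.prod_mul_distrib,
    Finset.prod_pow_eq_pow_sum, hdeg]
  ring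

theorem polynomial_eq_zero_of_eval {q : Polynomial ℂ} (h : ∀ t ≠ 0, q.eval t = 0) : q = 0 := by
  refine Polynomial.eq_zero_of_infinite_isRoot q ?_
  refine Set.Infinite.mono (s := ({0} : Set ℂ)ᶜ) (fun t ht => h t ht) ?_
  exact (Set.finite_singleton 0).infinite_compl

/-- The cone is stable under scaling by `t ≠ 0`, so the polynomial in `t` whose coefficients are the
values of the homogeneous components vanishes identically. -/
theorem homogeneousComponent_mem {V : Set (PSpace σ)} {f : MvPolynomial σ ℂ}
    (hf : f ∈ homogeneousIdeal V) (d : ℕ) : homogeneousComponent d f ∈ homogeneousIdeal V := by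
  rw [homogeneousIdeal, mem_vanishingIdeal_iff] at hf ⊢
  intro v hv
  let q : Polynomial ℂ := ∑ e ∈ Finset.range (f.totalDegree + 1),
    Polynomial.monomial e (eval v (homogeneousComponent e f))
  have hq : q = 0 := by
    refine polynomial_eq_zero_of_eval fun t ht => ?_
    have h1 := hf _ (smul_mem_cone hv ht)
    have h2 : eval (t • v) f = 0 := h1
    rw [← sum_homogeneousComponent f, map_sum] at h2
    rw [← h2, Polynomial.eval_finsetSum]
    refine Finset.sum_congr rfl fun e _ => ?_
    rw [Polynomial.eval_monomial,
      eval_smul_homogeneous (homogeneousComponent_isHomogeneous e f), mul_comm]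
  by_cases hd : d ∈ Finset.range (f.totalDegree + 1)
  · have h3 := congrArg (fun p => Polynomial.coeff p d) hq
    simp only [q, Polynomial.finsetSum_coeff, Polynomial.coeff_monomial, Finset.sum_ite_eq', hd,
      if_true, Polynomial.coeff_zero] at h3
    exact h3
  · rw [homogeneousComponent_eq_zero _ _ (by simpa [Nat.lt_succ_iff] using hd), map_zero]

theorem homogeneousIdeal_closure (V : Set (PSpace σ)) :
    homogeneousIdeal (closure V) = homogeneousIdeal V := by
  refine le_antisymm ?_ fun f hf => ?_
  · exact vanishingIdeal_anti_mono fun v ⟨hv, h⟩ => ⟨hv, subset_closure h⟩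
  let S : Set (MvPolynomial σ ℂ) := Set.range fun d => homogeneousComponent d f
  have hS : ∀ g ∈ S, ∃ d, g.IsHomogeneous d := by
    rintro _ ⟨d, rfl⟩
    exact ⟨d, homogeneousComponent_isHomogeneous d f⟩
  have hcl : closure V ⊆ zeros S := by
    refine closure_minimal (fun P hP => ?_) ((isClosed_iff _).2 ⟨S, hS, rfl⟩)
    rintro _ ⟨d, rfl⟩
    exact (mem_vanishingIdeal_iff.1 (homogeneousComponent_mem hf d)) _ (coords_mem_cone.2 hP)
  refine mem_vanishingIdeal_iff.2 fun v hv => ?_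
  obtain ⟨h, hV⟩ := hv
  have := (mk_mem_zeros hS v h).1 (hcl hV)
  change eval v f = 0
  rw [← sum_homogeneousComponent f, map_sum]
  exact Finset.sum_eq_zero fun d _ => this _ ⟨d, rfl⟩

/-- The Nullstellensatz: a nonzero function on an affine variety is nonzero at some `ℂ`-point. -/
theorem exists_algHom_ne_zero {R : Type} [CommRing R] [IsDomain R] [Algebra ℂ R]
    [Algebra.FiniteType ℂ R] {c : R} (hc : c ≠ 0) : ∃ χ : R →ₐ[ℂ] ℂ, χ c ≠ 0 := by
  obtain ⟨s, f, hf⟩ := Algebra.FiniteType.iff_quotient_mvPolynomial''.1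
    (inferInstance : Algebra.FiniteType ℂ R)
  obtain ⟨g, rfl⟩ := hf c
  have hJ : (RingHom.ker f).IsPrime := RingHom.ker_isPrime f
  have hg : g ∉ vanishingIdeal ℂ (zeroLocus ℂ (RingHom.ker f)) := by
    rw [IsPrime.vanishingIdeal_zeroLocus]
    exact hc
  rw [mem_vanishingIdeal_iff] at hg
  push Not at hg
  obtain ⟨y, hy, hgy⟩ := hg
  have hker : RingHom.ker f ≤ RingHom.ker (aeval y : MvPolynomial (Fin s) ℂ →ₐ[ℂ] ℂ) :=
    fun a ha => hy a ha
  refine ⟨(Ideal.Quotient.liftₐ (RingHom.ker f) (aeval y) fun a ha => hker ha).comp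
    (Ideal.quotientKerAlgEquivOfSurjective hf).symm.toAlgHom, ?_⟩
  have h1 : (Ideal.quotientKerAlgEquivOfSurjective hf).symm (f g) =
      Ideal.Quotient.mk (RingHom.ker f) g := by
    rw [AlgEquiv.symm_apply_eq]
    rfl
  change Ideal.Quotient.liftₐ (RingHom.ker f) (aeval y) (fun a ha => hker ha)
    ((Ideal.quotientKerAlgEquivOfSurjective hf).symm (f g)) ≠ 0
  rw [h1]
  exact hgy

/-- The cone over the `ℂ`-points of a family `P` of elements of a ring. -/
def pointCone {R : Type} [CommRing R] [Algebra ℂ R] (P : σ → R) : Set (σ → ℂ) :=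
  {v | ∃ (χ : R →ₐ[ℂ] ℂ) (t : ℂ), t ≠ 0 ∧ v = fun j => t * χ (P j)}

/-- The coordinate map of the cone over the family `P`. -/
noncomputable def coneMap {R : Type} [CommRing R] [Algebra ℂ R] (P : σ → R) :
    MvPolynomial σ ℂ →ₐ[ℂ] Polynomial R :=
  aeval fun j => Polynomial.C (P j) * Polynomial.X

theorem eval_coneMap {R : Type} [CommRing R] [Algebra ℂ R] (P : σ → R) (χ : R →ₐ[ℂ] ℂ) (t : ℂ)
    (f : MvPolynomial σ ℂ) :
    eval (fun j => t * χ (P j)) f = (Polynomial.map χ.toRingHom (coneMap P f)).eval t := by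
  induction f using MvPolynomial.induction_on with
  | C c =>
    rw [eval_C, ← algebraMap_eq, AlgHom.commutes, Polynomial.algebraMap_apply, Polynomial.map_C,
      Polynomial.eval_C]
    exact (χ.commutes c).symm
  | add f g hf hg => rw [map_add, hf, hg, map_add, Polynomial.map_add, Polynomial.eval_add]
  | mul_X f j hf =>
    rw [map_mul, hf, map_mul, Polynomial.map_mul, Polynomial.eval_mul, eval_X, coneMap, aeval_X,
      Polynomial.map_mul, Polynomial.map_C, Polynomial.map_X, Polynomial.eval_mul,
      Polynomial.eval_C, Polynomial.eval_X, mul_comm t]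
    rfl

/-- A polynomial vanishing on the cone gives an element of `R[T]` which vanishes at every point of
`R` and every `t ≠ 0`. Its coefficients vanish at every point of the affine domain `R`, so they are
zero. -/
theorem homogeneousIdeal_eq_ker {R : Type} [CommRing R] [IsDomain R] [Algebra ℂ R]
    [Algebra.FiniteType ℂ R] (P : σ → R) {W : Set (PSpace σ)} (hW : cone W = pointCone P) :
    homogeneousIdeal W = RingHom.ker (coneMap P) := by
  ext f
  rw [homogeneousIdeal, mem_vanishingIdeal_iff, hW, RingHom.mem_ker]
  constructor
  · intro h
    ext k
    by_contra hk
    obtain ⟨χ, hχ⟩ := exists_algHom_ne_zero hk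
    have h0 : Polynomial.map χ.toRingHom (coneMap P f) = 0 :=
      polynomial_eq_zero_of_eval fun t ht => by
        rw [← eval_coneMap]
        exact h _ ⟨χ, t, ht, rfl⟩
    have := congrArg (fun p => Polynomial.coeff p k) h0
    rw [Polynomial.coeff_map] at this
    exact hχ this
  · rintro h _ ⟨χ, t, -, rfl⟩
    have := eval_coneMap P χ t f
    rw [h, Polynomial.map_zero, Polynomial.eval_zero] at this
    exact this

theorem isIrreducible_of_cone {R : Type} [CommRing R] [IsDomain R] [Algebra ℂ R]
    [Algebra.FiniteType ℂ R] (P : σ → R) {W : Set (PSpace σ)} (hW : cone W = pointCone P) :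
    IsIrreducible (closure W) := by
  rw [isIrreducible_iff_closure]
  refine ⟨?_, isPreirreducible_iff_isClosed_union_isClosed.2 fun Z₁ Z₂ h1 h2 h12 => ?_⟩
  · obtain ⟨χ, -⟩ := exists_algHom_ne_zero (R := R) one_ne_zero
    have : (fun j => 1 * χ (P j)) ∈ cone W := by
      rw [hW]
      exact ⟨χ, 1, one_ne_zero, rfl⟩
    exact ⟨_, this.2⟩
  obtain ⟨S, hS, rfl⟩ := (isClosed_iff _).1 h1
  obtain ⟨T, hT, rfl⟩ := (isClosed_iff _).1 h2
  by_contra hcon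
  rw [not_or, Set.not_subset, Set.not_subset] at hcon
  obtain ⟨⟨A, hA, hA'⟩, ⟨B, hB, hB'⟩⟩ := hcon
  have hmem : ∀ f, f ∈ homogeneousIdeal W → ∀ A ∈ W, eval A.coords f = 0 := fun f hf A hA =>
    (mem_vanishingIdeal_iff.1 hf) _ (coords_mem_cone.2 hA)
  simp only [zeros, Set.mem_ofPred_eq, not_forall] at hA' hB'
  obtain ⟨f, hf, hfA⟩ := hA'
  obtain ⟨g, hg, hgB⟩ := hB'
  have hprime : (homogeneousIdeal W).IsPrime := by
    rw [homogeneousIdeal_eq_ker P hW]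
    exact RingHom.ker_isPrime _
  have hfg : f * g ∈ homogeneousIdeal W := by
    refine mem_vanishingIdeal_iff.2 fun v hv => ?_
    obtain ⟨hv0, hvW⟩ := hv
    change eval v (f * g) = 0
    rw [map_mul, mul_eq_zero]
    rcases h12 hvW with h | h
    · exact Or.inl ((mk_mem_zeros hS v hv0).1 h f hf)
    · exact Or.inr ((mk_mem_zeros hT v hv0).1 h g hg)
  rcases hprime.mem_or_mem hfg with h | h
  · exact hfA (hmem f h A hA)
  · exact hgB (hmem g h B hB)

/-- The homogeneous coordinate ring is the image of `coneMap` in `R[T]`. Since `R[T]` is algebraic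
over it, its transcendence degree is `d + 1`. -/
theorem hasDim_of_cone [Finite σ] {R : Type} [CommRing R] [IsDomain R] [Algebra ℂ R]
    [Algebra.FiniteType ℂ R] (P : σ → R) {W : Set (PSpace σ)} (hW : cone W = pointCone P) (d : ℕ)
    (hd : Algebra.trdeg ℂ R = d)
    (halg : ∀ r : Polynomial R, IsAlgebraic (coneMap P).range r) : HasDim (closure W) d := by
  rw [HasDim, homogeneousIdeal_closure, homogeneousIdeal_eq_ker P hW]
  refine (ringKrullDim_eq_of_ringEquiv (Ideal.quotientKerEquivRange (coneMap P)).toRingEquiv).trans ?_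
  change ringKrullDim (coneMap P).range = _
  have : Algebra.FiniteType ℂ (coneMap P).range :=
    Algebra.FiniteType.of_surjective (coneMap P).rangeRestrict (coneMap P).rangeRestrict_surjective
  refine ringKrullDim_eq_trdeg ℂ (coneMap P).range (d + 1) ?_
  have h1 := _root_.trdeg_add_eq ℂ R (A := Polynomial R)
  rw [Polynomial.trdeg_of_isDomain, hd] at h1
  have : Algebra.IsAlgebraic (coneMap P).range (Polynomial R) := ⟨halg⟩
  have : FaithfulSMul ℂ (coneMap P).range :=
    (faithfulSMul_iff_algebraMap_injective _ _).2 (algebraMap ℂ (coneMap P).range).injective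
  have h2 := _root_.trdeg_add_eq ℂ (coneMap P).range (A := Polynomial R)
  rw [_root_.trdeg_eq_zero (R := (coneMap P).range) (A := Polynomial R), add_zero, ← h1] at h2
  rw [h2]
  push_cast
  rfl

/-- Multiplied by `T`, elements in the span of the `P j` lie in the image of `coneMap`. Hence `z l`
is a quotient `(b T) / (a T)`, all of `R` is algebraic over the image, and then `T` is, because `P
j₀ * T` lies in the image and `P j₀` is a unit. -/
theorem isAlgebraic_coneMap {R : Type} [CommRing R] [IsDomain R] [Algebra ℂ R] (P : σ → R)
    {m : ℕ} (z : Fin m → R) (j₀ : σ) (hj₀ : IsUnit (P j₀))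
    (hz : ∀ l, ∃ a b : R, IsUnit a ∧ a ∈ Submodule.span ℂ (Set.range P) ∧
      b ∈ Submodule.span ℂ (Set.range P) ∧ z l * a = b)
    (hR : ∀ r : R, IsAlgebraic (Algebra.adjoin ℂ (Set.range z)) r) (r : Polynomial R) :
    IsAlgebraic (coneMap P).range r := by
  set S := (coneMap P).range with hS
  let D := Subalgebra.algebraicClosure S (Polynomial R)
  have hSalg : ∀ a ∈ S, IsAlgebraic S a := fun a ha => isAlgebraic_algebraMap (⟨a, ha⟩ : S)
  have hspan : ∀ a ∈ Submodule.span ℂ (Set.range P), Polynomial.C a * Polynomial.X ∈ S := by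
    intro a ha
    induction ha using Submodule.span_induction with
    | mem a ha =>
      obtain ⟨j, rfl⟩ := ha
      exact ⟨X j, aeval_X _ _⟩
    | zero => rw [map_zero, zero_mul]; exact zero_mem S
    | add a b _ _ ha hb => rw [map_add, add_mul]; exact add_mem ha hb
    | smul c a _ ha =>
      rw [← Polynomial.smul_C, smul_mul_assoc]
      exact S.smul_mem ha c
  have hzD : ∀ l, IsAlgebraic S (Polynomial.C (z l)) := by
    intro l
    obtain ⟨a, b, hu, ha, hb, hab⟩ := hz l
    have hne : Polynomial.C a * Polynomial.X ≠ 0 := mul_ne_zero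
      (Polynomial.C_ne_zero.2 hu.ne_zero) Polynomial.X_ne_zero
    refine IsAlgebraic.of_mul (mem_nonZeroDivisors_of_ne_zero hne) (hSalg _ (hspan a ha)) ?_
    rw [mul_comm, ← mul_assoc, ← Polynomial.C_mul, hab]
    exact hSalg _ (hspan b hb)
  have hadj : ∀ a ∈ Algebra.adjoin ℂ (Set.range z), Polynomial.C a ∈ D := by
    intro a ha
    induction ha using Algebra.adjoin_induction with
    | mem a ha =>
      obtain ⟨l, rfl⟩ := ha
      exact hzD l
    | algebraMap c => exact hSalg _ (S.algebraMap_mem c)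
    | add a b _ _ ha hb => rw [map_add]; exact add_mem ha hb
    | mul a b _ _ ha hb => rw [map_mul]; exact mul_mem ha hb
  have hC : ∀ a : R, IsAlgebraic S (Polynomial.C a) := by
    intro a
    let g : Algebra.adjoin ℂ (Set.range z) →+* D :=
      { toFun := fun b => ⟨Polynomial.C b.1, hadj b.1 b.2⟩
        map_one' := rfl
        map_zero' := Subtype.ext (map_zero _)
        map_add' := fun b c => Subtype.ext (map_add _ _ _)
        map_mul' := fun b c => Subtype.ext (map_mul _ _ _) }
    have hg : Function.Injective g := fun b c hbc =>
      Subtype.ext (Polynomial.C_injective (congrArg Subtype.val hbc))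
    have h1 : IsAlgebraic D (Polynomial.C a) :=
      (hR a).ringHom_of_comp_eq g (Polynomial.C : R →+* Polynomial R) hg rfl
    exact h1.restrictScalars S
  have hX : IsAlgebraic S (Polynomial.X : Polynomial R) :=
    isAlgebraic_of_isUnit_mul (hj₀.map Polynomial.C) (hC _)
      (hSalg _ (hspan _ (Submodule.subset_span ⟨j₀, rfl⟩)))
  induction r using Polynomial.induction_on' with
  | add p q hp hq => exact hp.add hq
  | monomial k a =>
    rw [← Polynomial.C_mul_X_pow_eq_monomial]
    exact (hC a).mul (hX.pow k)

/-- Here `R` need not be a domain. The coordinate ring is an integral extension of `ℂ[s]` with `s =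
∑ j, X j`: no polynomial in `s` vanishes on the line over a point of `R`, and the ratios `P j / ∑ P`
are integral over `ℂ`. -/
theorem hasDim_zero_of_cone [Fintype σ] {R : Type} [CommRing R] [Nontrivial R] [Algebra ℂ R]
    [Module.Finite ℂ R] (P : σ → R) {W : Set (PSpace σ)} (hW : cone W = pointCone P)
    (hP : IsUnit (∑ j, P j)) : HasDim (closure W) 0 := by
  rw [HasDim, homogeneousIdeal_closure]
  set I := homogeneousIdeal W with hI
  have hmem : ∀ f, f ∈ I ↔ ∀ (χ : R →ₐ[ℂ] ℂ) (t : ℂ), t ≠ 0 →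
      eval (fun j => t * χ (P j)) f = 0 := by
    intro f
    rw [hI, homogeneousIdeal, mem_vanishingIdeal_iff, hW]
    exact ⟨fun h χ t ht => h _ ⟨χ, t, ht, rfl⟩, by rintro h _ ⟨χ, t, ht, rfl⟩; exact h χ t ht⟩
  have hev : ∀ (v : σ → ℂ) (q : Polynomial ℂ),
      eval v (Polynomial.aeval (∑ j, (X j : MvPolynomial σ ℂ)) q) = q.eval (∑ j, v j) := by
    intro v q
    have h := Polynomial.map_aeval_eq_aeval_map (φ := RingHom.id ℂ) (ψ := eval v)
      (by ext; simp) q (∑ j, (X j : MvPolynomial σ ℂ))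
    rw [h, Polynomial.map_id, map_sum]
    simp only [eval_X]
    rfl
  let φ : Polynomial ℂ →+* MvPolynomial σ ℂ ⧸ I := (Ideal.Quotient.mk I).comp
    (Polynomial.aeval (∑ j, (X j : MvPolynomial σ ℂ)) : Polynomial ℂ →ₐ[ℂ] _).toRingHom
  let _ : Algebra (Polynomial ℂ) (MvPolynomial σ ℂ ⧸ I) := φ.toAlgebra
  have hinj : Function.Injective (algebraMap (Polynomial ℂ) (MvPolynomial σ ℂ ⧸ I)) := by
    rw [injective_iff_map_eq_zero]
    intro q hq
    have hq' := (hmem _).1 (Ideal.Quotient.eq_zero_iff_mem.1 hq)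
    obtain ⟨M, hM⟩ := Ideal.exists_maximal R
    obtain ⟨χ', -⟩ := exists_algHom_ne_zero (R := R ⧸ M) one_ne_zero
    let χ : R →ₐ[ℂ] ℂ := χ'.comp (Ideal.Quotient.mkₐ ℂ M)
    have hc : χ (∑ j, P j) ≠ 0 := (hP.map χ).ne_zero
    refine polynomial_eq_zero_of_eval fun u hu => ?_
    have h1 := hq' χ (u / χ (∑ j, P j)) (div_ne_zero hu hc)
    refine (Eq.trans ?_ (hev _ q).symm).trans h1
    congr 1
    rw [← Finset.mul_sum, ← map_sum, div_mul_cancel₀ _ hc]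
  have hint : Algebra.IsIntegral (Polynomial ℂ) (MvPolynomial σ ℂ ⧸ I) := by
    refine ⟨fun r => ?_⟩
    obtain ⟨f, rfl⟩ := Ideal.Quotient.mk_surjective r
    induction f using MvPolynomial.induction_on with
    | C c =>
      have : Ideal.Quotient.mk I (C c) = algebraMap (Polynomial ℂ) _ (Polynomial.C c) := by
        change _ = Ideal.Quotient.mk I (Polynomial.aeval _ (Polynomial.C c))
        rw [Polynomial.aeval_C]
        rfl
      rw [this]
      exact isIntegral_algebraMap
    | add f g hf hg => rw [map_add]; exact hf.add hg
    | mul_X f j hf =>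
      rw [map_mul]
      refine hf.mul ?_
      obtain ⟨u, hu⟩ := hP
      -- Homogenizing the equation `g` of `P j / ∑ P` by means of `s` (`scaleRoots`) gives a monic
      -- equation for `X j` over `ℂ[s]`.
      obtain ⟨g, hg, hg0⟩ := Algebra.IsIntegral.isIntegral (R := ℂ) (P j * (u⁻¹ : Rˣ))
      refine ⟨(g.map Polynomial.C).scaleRoots Polynomial.X,
        (Polynomial.monic_scaleRoots_iff _).2 (hg.map _), ?_⟩
      change Polynomial.eval₂ ((Ideal.Quotient.mk I).comp _) _ _ = 0
      rw [← Polynomial.hom_eval₂, Ideal.Quotient.eq_zero_iff_mem, hmem]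
      intro χ t ht
      rw [Polynomial.hom_eval₂, eval_X]
      have hc : χ (∑ j, P j) ≠ 0 := by
        rw [← hu]
        exact (u.isUnit.map χ).ne_zero
      have hX : ((eval fun j => t * χ (P j)).comp
          (Polynomial.aeval (∑ j, (X j : MvPolynomial σ ℂ)) :
            Polynomial ℂ →ₐ[ℂ] _).toRingHom) Polynomial.X = t * χ (∑ j, P j) := by
        refine (hev _ Polynomial.X).trans ?_
        rw [Polynomial.eval_X, ← Finset.mul_sum, map_sum]
      have hj : t * χ (P j) = t * χ (∑ j, P j) * χ (P j * (u⁻¹ : Rˣ)) := by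
        rw [map_mul, ← hu]
        have : χ u * χ (u⁻¹ : Rˣ) = 1 := by rw [← map_mul, Units.mul_inv, map_one]
        linear_combination (-t * χ (P j)) * this
      rw [hj, ← hX, Polynomial.scaleRoots_eval₂_mul, Polynomial.eval₂_map]
      have h0 : Polynomial.eval₂ (algebraMap ℂ ℂ) (χ (P j * (u⁻¹ : Rˣ))) g = 0 := by
        refine (Polynomial.aeval_algHom_apply χ (P j * (u⁻¹ : Rˣ)) g).trans ?_
        rw [Polynomial.aeval_def, hg0, map_zero]
      have hcomp : (((eval fun j => t * χ (P j)).comp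
          (Polynomial.aeval (∑ j, (X j : MvPolynomial σ ℂ)) :
            Polynomial ℂ →ₐ[ℂ] _).toRingHom).comp Polynomial.C) = algebraMap ℂ ℂ := by
        ext c
        exact (hev _ (Polynomial.C c)).trans (Polynomial.eval_C)
      rw [hcomp, h0, mul_zero]
  rw [ringKrullDim_eq_of_isIntegral (Polynomial ℂ) _ hinj]
  exact ringKrullDim_eq_trdeg ℂ (Polynomial ℂ) 1 (by
    rw [Polynomial.trdeg_of_isDomain, Nat.cast_one])

end projective

end SpohnCI

namespace SpohnCI

/-! ### From a parametrization to the dimension statements -/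

section model

open MvPolynomial

variable {n m : ℕ}

/-- `π` is a parametrization, up to scaling, of the part of the model of `𝒞` outside of the special
hyperplanes, whose parameters are quotients of linear forms in the coordinates. -/
structure IsModelParam (𝒞 : Set (CIStatement n)) (π : State n → MvPolynomial (Fin m) ℂ) : Prop where
  exists_pos : ∃ z₀ : Fin m → ℂ, ∀ j, ∃ r : ℝ, 0 < r ∧ eval z₀ (π j) = r
  exists_linear : ∀ l, ∃ u : MvPolynomial (Fin m) ℂ, ((∃ j, u = π j) ∨ u = ∑ j, π j) ∧
    ∃ c : State n → ℂ, X l * u = ∑ j, C (c j) * π j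
  mem_iff : ∀ v : State n → ℂ, (∀ j, v j ≠ 0) → ∑ j, v j ≠ 0 →
    ((∀ f ∈ ⋃ s ∈ 𝒞, s.quadrics, eval v f = 0) ↔
      ∃ (z : Fin m → ℂ) (t : ℂ), t ≠ 0 ∧ v = fun j => t * eval z (π j))

variable {𝒞 : Set (CIStatement n)} {π : State n → MvPolynomial (Fin m) ℂ}

theorem coords_mk (v : State n → ℂ) (hv : v ≠ 0) :
    ∃ a : ℂ, a ≠ 0 ∧ (PSpace.mk v hv).coords = fun j => a * v j := by
  obtain ⟨a, ha⟩ := Projectivization.exists_smul_eq_mk_rep ℂ v hv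
  exact ⟨a, a.ne_zero, ha.symm⟩

/-- The points off the hyperplanes that satisfy the quadrics and lie in `Q` correspond, up to
scaling, to parameters `y` with `π y` in `Q`, which are the `ℂ`-points of `R`. -/
theorem IsModelParam.cone_eq (h : IsModelParam 𝒞 π) {Q : Set (State n → ℂ)}
    (hQ : ∀ v ∈ Q, ∀ t : ℂ, t ≠ 0 → (fun j => t * v j) ∈ Q) {R : Type} [CommRing R] [Algebra ℂ R]
    {z : Fin m → R} (hR : IsCoordRing π Q R z) :
    cone ({P | P.coords ∈ Q} ∩ zeros (⋃ s ∈ 𝒞, s.quadrics) ∩ offHyperplanes n) =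
      pointCone fun j => aeval z (π j) := by
  have hχ : ∀ (χ : R →ₐ[ℂ] ℂ) f, χ (aeval z f) = eval (fun l => χ (z l)) f := fun χ f =>
    MvPolynomial.comp_aeval_apply _ χ f
  ext v
  constructor
  · rintro ⟨hv, ⟨hvQ, hvC⟩, hv1, hv2⟩
    obtain ⟨a, ha, hav⟩ := coords_mk v hv
    obtain ⟨y, t, ht, hy⟩ := (h.mem_iff _ hv1 hv2).1 hvC
    have hv3 := hv2
    simp only [hy, ← Finset.mul_sum] at hv1 hv2
    rw [Set.mem_ofPred_eq, hy] at hvQ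
    have hyQ := hQ _ hvQ t⁻¹ (inv_ne_zero ht)
    simp only [inv_mul_cancel_left₀ ht] at hyQ
    obtain ⟨χ, hχy⟩ := hR.exists_hom y (fun j => right_ne_zero_of_mul (hv1 j))
      (by rw [map_sum]; exact right_ne_zero_of_mul hv2) hyQ
    refine ⟨χ, a⁻¹ * t, mul_ne_zero (inv_ne_zero ha) ht, ?_⟩
    funext j
    have h1 := congrFun (hav.symm.trans hy) j
    simp only [hχ, hχy]
    rw [mul_assoc, ← h1, inv_mul_cancel_left₀ ha]
  · rintro ⟨χ, t, ht, rfl⟩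
    have hne : ∀ j, χ (aeval z (π j)) ≠ 0 := fun j => ((hR.isUnit_coord j).map χ).ne_zero
    have hne' : ∑ j, χ (aeval z (π j)) ≠ 0 := by
      rw [← map_sum, ← map_sum]
      exact (hR.isUnit_sum.map χ).ne_zero
    have hv : (fun j => t * χ (aeval z (π j))) ≠ 0 := fun h0 =>
      mul_ne_zero ht (hne 0) (congrFun h0 0)
    obtain ⟨a, ha, hav⟩ := coords_mk _ hv
    have hoff : PSpace.mk _ hv ∈ offHyperplanes n := by
      constructor
      · intro j
        rw [hav]
        exact mul_ne_zero ha (mul_ne_zero ht (hne j))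
      · rw [hav, ← Finset.mul_sum, ← Finset.mul_sum]
        exact mul_ne_zero ha (mul_ne_zero ht hne')
    refine ⟨hv, ⟨?_, (h.mem_iff _ hoff.1 hoff.2).2 ⟨fun l => χ (z l), a * t, mul_ne_zero ha ht, ?_⟩⟩,
      hoff⟩
    · rw [Set.mem_ofPred_eq, hav]
      refine hQ _ (hQ _ ?_ t ht) a ha
      simp only [hχ]
      exact hR.mem χ
    · rw [hav]
      funext j
      rw [hχ, mul_assoc]

theorem IsModelParam.hasDim (h : IsModelParam 𝒞 π) {Q : Set (State n → ℂ)}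
    (hQ : ∀ v ∈ Q, ∀ t : ℂ, t ≠ 0 → (fun j => t * v j) ∈ Q) {R : Type} [CommRing R] [Algebra ℂ R]
    [IsDomain R] {z : Fin m → R} (hR : IsCoordRing π Q R z) {d : ℕ} (hd : Algebra.trdeg ℂ R = d) :
    HasDim (closure ({P | P.coords ∈ Q} ∩ zeros (⋃ s ∈ 𝒞, s.quadrics) ∩ offHyperplanes n)) d ∧
    IsIrreducible
      (closure ({P | P.coords ∈ Q} ∩ zeros (⋃ s ∈ 𝒞, s.quadrics) ∩ offHyperplanes n)) := by
  have := hR.finiteType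
  refine ⟨hasDim_of_cone _ (h.cone_eq hQ hR) d hd ?_, isIrreducible_of_cone _ (h.cone_eq hQ hR)⟩
  refine isAlgebraic_coneMap _ z 0 (hR.isUnit_coord 0) (fun l => ?_) (hR.isAlgebraic inferInstance)
  have hspan : ∀ j, aeval z (π j) ∈ Submodule.span ℂ (Set.range fun j => aeval z (π j)) :=
    fun j => Submodule.subset_span ⟨j, rfl⟩
  obtain ⟨u, hu, c, huc⟩ := h.exists_linear l
  refine ⟨aeval z u, ∑ j, c j • aeval z (π j), ?_, ?_,
    sum_mem fun j _ => Submodule.smul_mem _ _ (hspan j), ?_⟩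
  · rcases hu with ⟨j, rfl⟩ | rfl
    · exact hR.isUnit_coord j
    · exact hR.isUnit_sum
  · rcases hu with ⟨j, rfl⟩ | rfl
    · exact hspan j
    · rw [map_sum]
      exact sum_mem fun j _ => hspan j
  · have := congrArg (aeval z) huc
    rw [map_mul, aeval_X, map_sum] at this
    rw [this]
    refine Finset.sum_congr rfl fun j _ => ?_
    rw [map_mul, aeval_C, Algebra.smul_def]

theorem trdeg_away (h : specialProduct π ≠ 0) :
    IsDomain (Localization.Away (specialProduct π)) ∧
      Algebra.trdeg ℂ (Localization.Away (specialProduct π)) = m := by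
  have hle := powers_le_nonZeroDivisors_of_noZeroDivisors h
  have hdom : IsDomain (Localization.Away (specialProduct π)) :=
    IsLocalization.isDomain_localization hle
  refine ⟨hdom, ?_⟩
  have : FaithfulSMul (MvPolynomial (Fin m) ℂ) (Localization.Away (specialProduct π)) :=
    (faithfulSMul_iff_algebraMap_injective _ _).2
      (IsLocalization.injective _ (M := Submonoid.powers (specialProduct π)) hle)
  have : Algebra.IsAlgebraic (MvPolynomial (Fin m) ℂ) (Localization.Away (specialProduct π)) :=
    IsLocalization.isAlgebraic _ (Submonoid.powers (specialProduct π))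
  have h := _root_.trdeg_add_eq ℂ (MvPolynomial (Fin m) ℂ)
    (A := Localization.Away (specialProduct π))
  rw [_root_.trdeg_eq_zero (R := MvPolynomial (Fin m) ℂ)
    (A := Localization.Away (specialProduct π)), MvPolynomial.trdeg_of_isDomain, add_zero,
    Cardinal.mk_fin] at h
  rw [← h, Cardinal.lift_natCast]

/-- Apply the real or the imaginary part to the coefficients of `F`, whichever gives a nonzero
polynomial. At a real point the result is the real or imaginary part of the value of `F`. -/
theorem exists_real_polynomial {τ : Type} {F : MvPolynomial τ ℂ} (hF : F ≠ 0) :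
    ∃ G : MvPolynomial τ ℝ, G ≠ 0 ∧
      ∀ x : τ → ℝ, eval x G ≠ 0 → eval (fun q => (x q : ℂ)) F ≠ 0 := by
  have key : ∀ L : ℂ →ₗ[ℝ] ℝ, (∃ e, L (coeff e F) ≠ 0) → ∃ G : MvPolynomial τ ℝ, G ≠ 0 ∧
      ∀ x : τ → ℝ, eval x G ≠ 0 → eval (fun q => (x q : ℂ)) F ≠ 0 := by
    rintro L ⟨e, he⟩
    refine ⟨∑ k ∈ F.support, monomial k (L (coeff k F)), fun h0 => he ?_, fun x hx hF0 => hx ?_⟩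
    · classical
      have := congrArg (coeff e) h0
      simp only [coeff_sum, coeff_monomial, Finset.sum_ite_eq', coeff_zero] at this
      by_cases hm : e ∈ F.support
      · rwa [if_pos hm] at this
      · rw [notMem_support_iff.1 hm, map_zero]
    · have := congrArg L hF0
      rw [eval_eq, map_sum, map_zero] at this
      rw [map_sum, ← this]
      refine Finset.sum_congr rfl fun k _ => ?_
      rw [eval_monomial, mul_comm (coeff k F)]
      have h1 : ∏ i ∈ k.support, (x i : ℂ) ^ k i = ((∏ i ∈ k.support, x i ^ k i : ℝ) : ℂ) := by
        push_cast
        rfl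
      rw [h1, ← Complex.real_smul, map_smul, smul_eq_mul, mul_comm]
      rfl
  obtain ⟨e, he⟩ := ne_zero_iff.1 hF
  by_cases hre : (coeff e F).re = 0
  · exact key Complex.imLm ⟨e, fun him => he (Complex.ext hre him)⟩
  · exact key Complex.reLm ⟨e, hre⟩

theorem marginal_isHomogeneous (S : Finset (Fin n)) (x : State n) :
    (marginal S x).IsHomogeneous 1 :=
  IsHomogeneous.sum _ _ _ fun y _ => isHomogeneous_X ℂ y

theorem quadrics_isHomogeneous : ∀ f ∈ ⋃ s ∈ 𝒞, s.quadrics, ∃ d, f.IsHomogeneous d := by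
  intro f hf
  simp only [Set.mem_iUnion] at hf
  obtain ⟨s, -, x, y, -, rfl⟩ := hf
  exact ⟨1 + 1, ((marginal_isHomogeneous _ _).mul (marginal_isHomogeneous _ _)).sub
    ((marginal_isHomogeneous _ _).mul (marginal_isHomogeneous _ _))⟩

/-- Off the special hyperplanes the model coincides with the zero set of its quadrics, as that set
is closed. The closure inside the definition of the model can thus be dropped. -/
theorem spohnCIVariety_eq (X : Fin n → State n → ℝ) (𝒞 : Set (CIStatement n)) :
    spohnCIVariety X 𝒞 = closure ({P | P.coords ∈ spohnEquations fun q => (X q.1 q.2 : ℂ)} ∩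
      zeros (⋃ s ∈ 𝒞, s.quadrics) ∩ offHyperplanes n) := by
  have hX : spohnVariety X = {P | P.coords ∈ spohnEquations fun q => (X q.1 q.2 : ℂ)} := by
    ext P
    have hdet : ∀ i, eval P.coords (spohnMatrix X i).det =
        (∑ j with j i = 0, P.coords j) * (∑ j with j i = 1, (X i j : ℂ) * P.coords j) -
        (∑ j with j i = 0, (X i j : ℂ) * P.coords j) * ∑ j with j i = 1, P.coords j := by
      intro i
      simp [Matrix.det_fin_two, spohnMatrix]
    constructor
    · intro hP i
      have := hP _ ⟨i, rfl⟩
      rw [hdet] at this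
      linear_combination this
    · rintro hP _ ⟨i, rfl⟩
      rw [hdet]
      linear_combination hP i
  rw [spohnCIVariety, removeSpecial, hX]
  congr 1
  ext P
  constructor
  · rintro ⟨⟨h1, h2⟩, h3⟩
    refine ⟨⟨h1, ?_⟩, h3⟩
    have hcl : IsClosed (zeros (⋃ s ∈ 𝒞, s.quadrics)) :=
      (isClosed_iff _).2 ⟨_, quadrics_isHomogeneous, rfl⟩
    exact closure_minimal Set.inter_subset_left hcl h2
  · rintro ⟨⟨h1, h2⟩, h3⟩
    exact ⟨⟨h1, subset_closure ⟨h2, h3⟩⟩, h3⟩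

theorem IsModelParam.generic (h : IsModelParam 𝒞 π) (hn : n ≠ 1) (hnm : n ≤ m) :
    ∃ F : MvPolynomial (Fin n × State n) ℝ, F ≠ 0 ∧
      ∀ X : Fin n → State n → ℝ, eval (fun q => X q.1 q.2) F ≠ 0 →
        HasDim (ciModel 𝒞) m ∧ HasDim (spohnCIVariety X 𝒞) (m - n) ∧
          (n < m → IsIrreducible (spohnCIVariety X 𝒞)) := by
  obtain ⟨z₀, hpos⟩ := h.exists_pos
  have hsum : ∀ s : Finset (State n), s.Nonempty → ∑ j ∈ s, π j ≠ 0 := fun s hs h0 =>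
    specialProduct_ne_zero hpos s hs (by rw [h0, map_zero])
  have hsp : specialProduct π ≠ 0 := mul_ne_zero
    (Finset.prod_ne_zero_iff.2 fun j _ => by simpa using hsum {j} (Finset.singleton_nonempty j))
    (hsum _ Finset.univ_nonempty)
  have hM : HasDim (ciModel 𝒞) m := by
    obtain ⟨hdom, htr⟩ := trdeg_away hsp
    have := (h.hasDim (Q := Set.univ) (fun _ _ _ _ => trivial) (isCoordRing_away π) htr).1
    have huniv : {P : PSpace (State n) | P.coords ∈ (Set.univ : Set (State n → ℂ))} = Set.univ :=
      Set.eq_univ_of_forall fun _ => trivial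
    rwa [huniv, Set.univ_inter] at this
  obtain ⟨F, hF, hFx⟩ := exists_coordRing π hn hnm hpos fun l => by
    obtain ⟨u, hu, c, huc⟩ := h.exists_linear l
    obtain ⟨b, hb⟩ : ∃ b : State n → ℂ, u = ∑ j, C (b j) * π j := by
      classical
      rcases hu with ⟨k, rfl⟩ | rfl
      · refine ⟨Pi.single k 1, ?_⟩
        rw [Finset.sum_eq_single k]
        · simp
        · intro j _ hj
          simp [Pi.single_eq_of_ne hj]
        · simp
      · exact ⟨1, by simp⟩
    refine ⟨b, c, ?_, by rw [← hb, huc]⟩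
    rw [← hb]
    rcases hu with ⟨k, rfl⟩ | rfl
    · simpa using hsum {k} (Finset.singleton_nonempty k)
    · exact hsum _ Finset.univ_nonempty
  obtain ⟨G, hG, hGx⟩ := exists_real_polynomial hF
  refine ⟨G, hG, fun X hX => ⟨hM, ?_⟩⟩
  rw [spohnCIVariety_eq]
  obtain ⟨R, _, _, z, hR, hnt, h0, h1⟩ := hFx _ (hGx _ hX)
  have hQ : ∀ v ∈ spohnEquations fun q : Fin n × State n => (X q.1 q.2 : ℂ), ∀ t : ℂ, t ≠ 0 →
      (fun j => t * v j) ∈ spohnEquations fun q : Fin n × State n => (X q.1 q.2 : ℂ) := by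
    intro v hv t _ i
    have := hv i
    simp only [mul_left_comm _ t, ← Finset.mul_sum]
    linear_combination t * t * this
  -- For `n = m` the fibre is only known to be a nonempty finite scheme; for `n < m` it is a
  -- variety.
  rcases hnm.eq_or_lt with hm | hm
  · refine ⟨?_, fun h2 => absurd hm h2.ne⟩
    have := h0 hm
    rw [show m - n = 0 by omega]
    refine hasDim_zero_of_cone _ (h.cone_eq hQ hR) ?_
    rw [← map_sum]
    exact hR.isUnit_sum
  · obtain ⟨hdom, htr⟩ := h1 hm
    have := h.hasDim hQ hR htr
    exact ⟨this.1, fun _ => this.2⟩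

end model

end SpohnCI

namespace SpohnCI

/-! ### Quadrics of independence statements and d-separation -/

section independence

open MvPolynomial

variable {n : ℕ}

theorem eval_marginal (S : Finset (Fin n)) (v : State n → ℂ) (y : State n) :
    eval v (marginal S y) = ∑ y' : State n with ∀ i ∈ S, y' i = y i, v y' := by
  rw [marginal, map_sum]
  simp only [eval_X]

/-- Expanding the products of marginals, the swap of the coordinates in `D` matches the terms of the
two products. Any `D` between `A` and the complement of `B` will do, since on `C` the two states
agree and the variables outside `A ∪ B ∪ C` are summed. -/
theorem eval_quadric_eq_zero (s : CIStatement n) (v : State n → ℂ) (D : Finset (Fin n))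
    (hA : s.A ⊆ D) (hB : Disjoint D s.B)
    (hv : ∀ x y : State n, (∀ i ∈ s.C, x i = y i) →
      v x * v y = v (D.piecewise x y) * v (D.piecewise y x)) :
    ∀ f ∈ s.quadrics, eval v f = 0 := by
  rintro _ ⟨x, y, hxy, rfl⟩
  rw [map_sub, map_mul, map_mul, sub_eq_zero]
  simp only [marginal, map_sum, eval_X]
  rw [Finset.sum_mul_sum, Finset.sum_mul_sum, ← Finset.sum_product', ← Finset.sum_product']
  have hval : ∀ x' y' x y : State n, (∀ i ∈ s.C, x i = y i) →
      (∀ i ∈ s.A ∪ s.B ∪ s.C, x' i = x i) → (∀ i ∈ s.A ∪ s.B ∪ s.C, y' i = y i) →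
      ∀ i ∈ s.A ∪ s.B ∪ s.C, D.piecewise x' y' i = s.A.piecewise x y i := by
    intro x' y' x y hxy hx hy i hi
    have hi' := hi
    simp only [Finset.mem_union] at hi'
    by_cases hiA : i ∈ s.A
    · rw [Finset.piecewise_eq_of_mem _ _ _ (hA hiA), Finset.piecewise_eq_of_mem _ _ _ hiA, hx i hi]
    · rw [Finset.piecewise_eq_of_notMem _ _ _ hiA]
      by_cases hiD : i ∈ D
      · rw [Finset.piecewise_eq_of_mem _ _ _ hiD, hx i hi]
        rcases hi' with (h | h) | h
        · exact absurd h hiA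
        · exact absurd h (Finset.disjoint_left.1 hB hiD)
        · exact hxy i h
      · rw [Finset.piecewise_eq_of_notMem _ _ _ hiD, hy i hi]
  have hval' : ∀ x' y' x y : State n,
      (∀ i ∈ s.A ∪ s.B ∪ s.C, x' i = s.A.piecewise x y i) →
      (∀ i ∈ s.A ∪ s.B ∪ s.C, y' i = s.A.piecewise y x i) → (∀ i ∈ s.C, x i = y i) →
      ∀ i ∈ s.A ∪ s.B ∪ s.C, D.piecewise x' y' i = x i := by
    intro x' y' x y hx hy hxy i hi
    have hi' := hi
    simp only [Finset.mem_union] at hi'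
    by_cases hiD : i ∈ D
    · rw [Finset.piecewise_eq_of_mem _ _ _ hiD, hx i hi]
      by_cases hiA : i ∈ s.A
      · rw [Finset.piecewise_eq_of_mem _ _ _ hiA]
      · rw [Finset.piecewise_eq_of_notMem _ _ _ hiA]
        rcases hi' with (h | h) | h
        · exact absurd h hiA
        · exact absurd h (Finset.disjoint_left.1 hB hiD)
        · exact (hxy i h).symm
    · rw [Finset.piecewise_eq_of_notMem _ _ _ hiD, hy i hi,
        Finset.piecewise_eq_of_notMem _ _ _ fun h => hiD (hA h)]
  have hinv : ∀ x y : State n, D.piecewise (D.piecewise x y) (D.piecewise y x) = x := by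
    intro x y
    funext i
    by_cases hi : i ∈ D <;> simp [hi]
  refine Finset.sum_nbij' (fun q => (D.piecewise q.1 q.2, D.piecewise q.2 q.1))
    (fun q => (D.piecewise q.1 q.2, D.piecewise q.2 q.1)) ?_ ?_ ?_ ?_ ?_
  · rintro ⟨x', y'⟩ h
    simp only [Finset.mem_product, Finset.mem_filter, Finset.mem_univ, true_and] at h ⊢
    exact ⟨hval x' y' x y hxy h.1 h.2, hval y' x' y x (fun i hi => (hxy i hi).symm) h.2 h.1⟩
  · rintro ⟨x', y'⟩ h
    simp only [Finset.mem_product, Finset.mem_filter, Finset.mem_univ, true_and] at h ⊢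
    exact ⟨hval' x' y' x y h.1 h.2 hxy, hval' y' x' y x h.2 h.1 fun i hi => (hxy i hi).symm⟩
  · rintro ⟨x', y'⟩ -
    exact Prod.ext (hinv x' y') (hinv y' x')
  · rintro ⟨x', y'⟩ -
    exact Prod.ext (hinv x' y') (hinv y' x')
  · rintro ⟨x', y'⟩ h
    simp only [Finset.mem_product, Finset.mem_filter, Finset.mem_univ, true_and] at h
    refine hv x' y' fun i hi => ?_
    have hi' : i ∈ s.A ∪ s.B ∪ s.C := Finset.mem_union_right _ hi
    rw [h.1 i hi', h.2 i hi', hxy i hi]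

theorem eval_quadric_eq_zero_of_left_empty (s : CIStatement n) (v : State n → ℂ) (hs : s.A = ∅) :
    ∀ f ∈ s.quadrics, eval v f = 0 :=
  eval_quadric_eq_zero s v ∅ (by rw [hs]) (Finset.disjoint_empty_left _) fun x y _ => by
    rw [Finset.piecewise_empty, Finset.piecewise_empty, mul_comm]

theorem eval_quadric_eq_zero_of_right_empty (s : CIStatement n) (v : State n → ℂ) (hs : s.B = ∅) :
    ∀ f ∈ s.quadrics, eval v f = 0 :=
  eval_quadric_eq_zero s v Finset.univ (Finset.subset_univ _)
    (by rw [hs]; exact Finset.disjoint_empty_right _) fun x y _ => by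
    rw [Finset.piecewise_univ, Finset.piecewise_univ]

theorem marginal_of_union_eq_univ {S : Finset (Fin n)} (hS : S = Finset.univ) (x : State n) :
    marginal S x = p x := by
  rw [marginal, hS]
  have : (Finset.univ.filter fun y : State n => ∀ i ∈ Finset.univ, y i = x i) = {x} := by
    ext y
    simp [funext_iff]
  rw [this, Finset.sum_singleton]

theorem mul_eq_of_quadrics {s : CIStatement n} {v : State n → ℂ}
    (h : ∀ f ∈ s.quadrics, eval v f = 0) (hs : s.A ∪ s.B ∪ s.C = Finset.univ) {x y : State n}
    (hxy : ∀ i ∈ s.C, x i = y i) :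
    v x * v y = v (s.A.piecewise x y) * v (s.A.piecewise y x) := by
  have := h _ ⟨x, y, hxy, rfl⟩
  simpa only [marginal_of_union_eq_univ hs, map_sub, map_mul, eval_X, sub_eq_zero] using this

variable {G : Digraph (Fin n)}

/-- An edge is a path without inner vertices, so it cannot be blocked. -/
theorem not_adj_of_mem_globalMarkov {s : CIStatement n} (hs : s ∈ globalMarkov G) {a b : Fin n}
    (ha : a ∈ s.A) (hb : b ∈ s.B) : ¬ (G.Adj a b ∨ G.Adj b a) := by
  intro hadj
  have hab : a ≠ b := fun h => Finset.disjoint_left.1 s.disjoint_AB ha (h ▸ hb)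
  obtain ⟨u, v, w, h, -⟩ := hs a ha b hb [a, b] ⟨by simpa using hab, by simpa using hadj, rfl, rfl⟩
  have := h.length_le
  simp at this

theorem isBlocked_triple {C : Finset (Fin n)} {a c b : Fin n} (h : IsBlocked G C [a, c, b]) :
    (c ∈ C ∧ ¬ (G.Adj a c ∧ G.Adj b c)) ∨ ((G.Adj a c ∧ G.Adj b c) ∧ c ∉ C) := by
  obtain ⟨u, v, w, h, h'⟩ := h
  have h2 : [u, v, w] = [a, c, b] := h.sublist.eq_of_length rfl
  obtain ⟨rfl, rfl, rfl⟩ : u = a ∧ v = c ∧ w = b := by simpa using h2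
  exact h'.imp id fun h3 => ⟨h3.1, fun hc => h3.2 _ hc Relation.ReflTransGen.refl⟩

theorem isBlocked_triple_of_mem {s : CIStatement n} (hs : s ∈ globalMarkov G) {a c b : Fin n}
    (ha : a ∈ s.A) (hb : b ∈ s.B) (hac : a ≠ c) (hbc : b ≠ c) (h1 : G.Adj a c ∨ G.Adj c a)
    (h2 : G.Adj b c ∨ G.Adj c b) :
    (c ∈ s.C ∧ ¬ (G.Adj a c ∧ G.Adj b c)) ∨ ((G.Adj a c ∧ G.Adj b c) ∧ c ∉ s.C) := by
  have hab : a ≠ b := fun h => Finset.disjoint_left.1 s.disjoint_AB ha (h ▸ hb)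
  exact isBlocked_triple (hs a ha b hb [a, c, b] ⟨by simp [hac, hab, hbc.symm],
    by simp [h1, h2.symm], rfl, rfl⟩)

/-- The independence of a variable from all others. -/
def singletonStatement (i : Fin n) : CIStatement n where
  A := {i}
  B := {i}ᶜ
  C := ∅
  disjoint_AB := disjoint_compl_right
  disjoint_AC := Finset.disjoint_empty_right _
  disjoint_BC := Finset.disjoint_empty_right _

/-- No path leaves an isolated vertex, so the separation is vacuous. -/
theorem singletonStatement_mem {i : Fin n} (hi : ∀ k ≠ i, ¬ (G.Adj i k ∨ G.Adj k i)) :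
    singletonStatement i ∈ globalMarkov G := by
  intro a ha b hb l hl
  obtain rfl : a = i := by simpa [singletonStatement] using ha
  have hba : b ≠ a := by simpa [singletonStatement] using hb
  obtain ⟨h1, h2, h3, h4⟩ := hl
  exfalso
  match l, h1, h2, h3, h4 with
  | [], _, _, h3, _ => simp at h3
  | [c], _, _, h3, h4 =>
    simp at h3 h4
    exact hba (h4.symm.trans h3)
  | c :: d :: l, h1, h2, h3, _ =>
    obtain rfl : c = a := by simpa using h3
    have hcd : d ≠ c := by
      rintro rfl
      simp at h1
    exact hi d hcd (by simpa using (List.isChain_cons_cons.1 h2).1)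

theorem singletonStatement_union (i : Fin n) : (singletonStatement i).A ∪ (singletonStatement i).B ∪
    (singletonStatement i).C = Finset.univ := by
  simp [singletonStatement]

theorem exists_linear_of_mul_eq {m : ℕ} {π : State n → MvPolynomial (Fin m) ℂ} {l : Fin m}
    {u : MvPolynomial (Fin m) ℂ} {j : State n} (h : X l * u = π j) :
    ∃ c : State n → ℂ, X l * u = ∑ j, C (c j) * π j := by
  classical
  refine ⟨Pi.single j 1, ?_⟩
  rw [Finset.sum_eq_single j]
  · simpa using h
  · intro k _ hk
    simp [Pi.single_eq_of_ne hk]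
  · simp

/-! ### The saturated model -/

open Classical in
/-- The parametrization of all distributions. -/
noncomputable def saturatedParam (n : ℕ) (j : State n) :
    MvPolynomial (Fin (Fintype.card {j : State n // j ≠ 0})) ℂ :=
  if h : j = 0 then 1 else X (Fintype.equivFin _ ⟨j, h⟩)

/-- When any two vertices are adjacent, every d-separation statement has an empty side and imposes
no condition. The parameters are the coordinates divided by the one at the state `0`. -/
theorem isModelParam_saturated (hG : ∀ u v, u ≠ v → G.Adj u v ∨ G.Adj v u) :
    IsModelParam (globalMarkov G) (saturatedParam n) := by
  have h0 : saturatedParam n 0 = 1 := dif_pos rfl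
  refine ⟨⟨1, fun j => ⟨1, one_pos, ?_⟩⟩, fun l => ?_, fun v hv _ => ⟨fun _ => ?_, fun _ => ?_⟩⟩
  · rw [saturatedParam]
    split_ifs <;> simp
  · let j := (Fintype.equivFin {j : State n // j ≠ 0}).symm l
    refine ⟨_, Or.inl ⟨0, rfl⟩, exists_linear_of_mul_eq (j := j.1) ?_⟩
    rw [h0, mul_one, saturatedParam, dif_neg j.2]
    simp [j]
  · refine ⟨fun l => v ((Fintype.equivFin {j : State n // j ≠ 0}).symm l).1 / v 0, v 0, hv 0, ?_⟩
    funext j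
    by_cases h : j = 0
    · rw [h, h0, map_one, mul_one]
    · rw [saturatedParam, dif_neg h, eval_X, Equiv.symm_apply_apply]
      field_simp [hv 0]
  · intro f hf
    simp only [Set.mem_iUnion] at hf
    obtain ⟨s, hs, hf⟩ := hf
    rcases s.A.eq_empty_or_nonempty with hA | ⟨a, ha⟩
    · exact eval_quadric_eq_zero_of_left_empty s v hA f hf
    rcases s.B.eq_empty_or_nonempty with hB | ⟨b, hb⟩
    · exact eval_quadric_eq_zero_of_right_empty s v hB f hf
    · exact absurd (hG a b fun h => Finset.disjoint_left.1 s.disjoint_AB ha (h ▸ hb))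
        (not_adj_of_mem_globalMarkov hs ha hb)

/-! ### The model of complete independence -/

/-- The parametrization of the product distributions. -/
noncomputable def productParam (n : ℕ) (j : State n) : MvPolynomial (Fin n) ℂ :=
  ∏ i, if j i = 0 then 1 else X i

/-- All vertices are isolated, so each one is independent of the rest, and these statements alone
force the product form. Conversely, swapping the coordinates in `A` permutes the factors of a
product distribution. -/
theorem isModelParam_product (hG : ∀ u v, u ≠ v → ¬ G.Adj u v) :
    IsModelParam (globalMarkov G) (productParam n) := by
  have h0 : productParam n 0 = 1 := Finset.prod_eq_one fun i _ => if_pos rfl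
  refine ⟨⟨1, fun j => ⟨1, one_pos, ?_⟩⟩, fun l => ?_, fun v hv _ => ⟨fun h => ?_, ?_⟩⟩
  · rw [productParam, map_prod]
    refine (Finset.prod_eq_one fun i _ => ?_).trans Complex.ofReal_one.symm
    split_ifs <;> simp
  · refine ⟨_, Or.inl ⟨0, rfl⟩, exists_linear_of_mul_eq (j := Pi.single l 1) ?_⟩
    rw [h0, mul_one, productParam, Finset.prod_eq_single l]
    · simp
    · intro i _ hi
      simp [Pi.single_eq_of_ne hi]
    · simp
  · have hsplit : ∀ (i : Fin n) (x : State n), v x * v 0 =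
        v (Pi.single i (x i)) * v (Function.update x i 0) := by
      intro i x
      have hs : singletonStatement i ∈ globalMarkov G := singletonStatement_mem fun k hk =>
        not_or.2 ⟨hG _ _ hk.symm, hG _ _ hk⟩
      have := mul_eq_of_quadrics (s := singletonStatement i) (v := v)
        (fun f hf => h f (Set.mem_biUnion hs hf)) (singletonStatement_union i) (x := x) (y := 0)
        (by simp [singletonStatement])
      rw [this]
      congr 2
      · funext k
        by_cases hk : k = i
        · subst hk
          rw [Finset.piecewise_eq_of_mem _ _ _ (by simp [singletonStatement])]
          simp
        · rw [Finset.piecewise_eq_of_notMem _ _ _ (by simpa [singletonStatement] using hk)]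
          simp [hk]
      · funext k
        by_cases hk : k = i
        · subst hk
          rw [Finset.piecewise_eq_of_mem _ _ _ (by simp [singletonStatement])]
          simp
        · rw [Finset.piecewise_eq_of_notMem _ _ _ (by simpa [singletonStatement] using hk)]
          simp [hk]
    refine ⟨fun i => v (Pi.single i 1) / v 0, v 0, hv 0, ?_⟩
    -- The nonzero coordinates of a state are split off one at a time by `hsplit`.
    have key : ∀ (s : Finset (Fin n)) (x : State n), (∀ i ∉ s, x i = 0) →
        v x = v 0 * ∏ i ∈ s, if x i = 0 then 1 else v (Pi.single i 1) / v 0 := by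
      intro s
      induction s using Finset.induction_on with
      | empty =>
        intro x hx
        rw [Finset.prod_empty, mul_one, show x = 0 from funext fun i => hx i (Finset.notMem_empty i)]
      | insert i s hi ih =>
        intro x hx
        have h1 := ih (Function.update x i 0) fun k hk => by
          by_cases hki : k = i
          · subst hki; simp
          · rw [Function.update_of_ne hki]
            exact hx k (by simp [hki, hk])
        have h2 : ∀ k ∈ s, (if Function.update x i 0 k = 0 then (1 : ℂ) else
            v (Pi.single k 1) / v 0) = if x k = 0 then 1 else v (Pi.single k 1) / v 0 := by
          intro k hk
          rw [Function.update_of_ne fun h : k = i => hi (h ▸ hk)]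
        rw [Finset.prod_congr rfl h2] at h1
        rw [Finset.prod_insert hi]
        have h3 := hsplit i x
        rw [h1] at h3
        by_cases hxi : x i = 0
        · rw [hxi, Pi.single_zero] at h3
          rw [if_pos hxi, one_mul]
          exact mul_right_cancel₀ (hv 0) (h3.trans (mul_comm _ _))
        · have hxi1 : x i = 1 := by omega
          rw [hxi1] at h3
          rw [if_neg hxi]
          refine mul_right_cancel₀ (hv 0) (h3.trans ?_)
          field_simp [hv 0]
    funext x
    rw [key Finset.univ x (by simp), productParam, map_prod]
    refine congrArg _ (Finset.prod_congr rfl fun i _ => ?_)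
    split_ifs <;> simp
  · rintro ⟨z, t, -, rfl⟩ f hf
    simp only [Set.mem_iUnion] at hf
    obtain ⟨s, hs, hf⟩ := hf
    refine eval_quadric_eq_zero s _ s.A subset_rfl s.disjoint_AB (fun x y _ => ?_) f hf
    simp only [productParam, map_prod]
    rw [mul_mul_mul_comm, mul_mul_mul_comm t _ t, ← Finset.prod_mul_distrib,
      ← Finset.prod_mul_distrib]
    refine congrArg _ (Finset.prod_congr rfl fun i _ => ?_)
    by_cases hi : i ∈ s.A
    · simp [hi]
    · simp [hi, mul_comm]

end independence

end SpohnCI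

namespace SpohnCI

/-! ### Networks on three variables -/

section three

open MvPolynomial

variable {a b c : Fin 3}

/-- The state with values `α`, `β`, `γ` at `a`, `b` and the remaining vertex. -/
def tripleState (a b : Fin 3) (α β γ : Fin 2) : State 3 :=
  fun i => if i = a then α else if i = b then β else γ

@[simp]
theorem tripleState_left (a b : Fin 3) (α β γ : Fin 2) : tripleState a b α β γ a = α := if_pos rfl

@[simp]
theorem tripleState_middle (hab : a ≠ b) (α β γ : Fin 2) : tripleState a b α β γ b = β :=
  (if_neg hab.symm).trans (if_pos rfl)

@[simp]
theorem tripleState_right (hac : a ≠ c) (hbc : b ≠ c) (α β γ : Fin 2) :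
    tripleState a b α β γ c = γ :=
  (if_neg hac.symm).trans (if_neg hbc.symm)

theorem eq_or_eq_or_eq (hab : a ≠ b) (hac : a ≠ c) (hbc : b ≠ c) (i : Fin 3) :
    i = a ∨ i = b ∨ i = c := by
  omega

theorem eq_tripleState (hab : a ≠ b) (hac : a ≠ c) (hbc : b ≠ c) {j : State 3} {α β γ : Fin 2}
    (ha : j a = α) (hb : j b = β) (hc : j c = γ) : j = tripleState a b α β γ := by
  funext i
  rcases eq_or_eq_or_eq hab hac hbc i with rfl | rfl | rfl
  · rw [ha, tripleState_left]
  · rw [hb, tripleState_middle hab]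
  · rw [hc, tripleState_right hac hbc]

theorem sum_tripleState (hab : a ≠ b) (hac : a ≠ c) (hbc : b ≠ c) {M : Type} [AddCommMonoid M]
    (F : State 3 → M) : ∑ j, F j = ∑ α, ∑ β, ∑ γ, F (tripleState a b α β γ) := by
  let e : State 3 ≃ Fin 2 × Fin 2 × Fin 2 :=
    { toFun := fun j => (j a, j b, j c)
      invFun := fun q => tripleState a b q.1 q.2.1 q.2.2
      left_inv := fun j => (eq_tripleState hab hac hbc rfl rfl rfl).symm
      right_inv := fun q => by simp [hab, hac, hbc] }
  rw [← e.symm.sum_comp, Fintype.sum_prod_type]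
  refine Finset.sum_congr rfl fun α _ => ?_
  rw [Fintype.sum_prod_type]
  rfl

variable {G : Digraph (Fin 3)}

/-! #### One edge -/

/-- The parametrization of the distributions for which the third vertex is independent of the first
two. -/
noncomputable def edgeParam (a b c : Fin 3) (j : State 3) : MvPolynomial (Fin 4) ℂ :=
  (if j a = 0 then (if j b = 0 then 1 else X 0) else (if j b = 0 then X 1 else X 2)) *
    if j c = 0 then 1 else X 3

/-- The vertex `c` is isolated, which gives the product form. Conversely, a nontrivial separation
statement cannot have `a` and `b` on different sides, so one of its sides is exactly `{c}`, and the
swap is performed at `c` or at its complement. -/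
theorem isModelParam_edge (hab : a ≠ b) (hac : a ≠ c) (hbc : b ≠ c)
    (h1 : G.Adj a b ∨ G.Adj b a) (h2 : ¬ (G.Adj a c ∨ G.Adj c a))
    (h3 : ¬ (G.Adj b c ∨ G.Adj c b)) : IsModelParam (globalMarkov G) (edgeParam a b c) := by
  have hcs : singletonStatement c ∈ globalMarkov G := by
    refine singletonStatement_mem fun k hk => ?_
    rcases eq_or_eq_or_eq hab hac hbc k with rfl | rfl | rfl
    · rwa [or_comm]
    · rwa [or_comm]
    · exact absurd rfl hk
  refine ⟨⟨1, fun j => ⟨1, one_pos, ?_⟩⟩, fun l => ⟨_, Or.inl ⟨0, rfl⟩, ?_⟩,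
    fun v hv _ => ⟨fun h => ?_, ?_⟩⟩
  · rw [edgeParam]
    split_ifs <;> simp
  · fin_cases l
    · exact exists_linear_of_mul_eq (j := tripleState a b 0 1 0) (by simp [edgeParam, *])
    · exact exists_linear_of_mul_eq (j := tripleState a b 1 0 0) (by simp [edgeParam, *])
    · exact exists_linear_of_mul_eq (j := tripleState a b 1 1 0) (by simp [edgeParam, *])
    · exact exists_linear_of_mul_eq (j := tripleState a b 0 0 1) (by simp [edgeParam, *])
  · have hmul : ∀ α β γ, v (tripleState a b α β γ) * v (tripleState a b 0 0 0) =
        v (tripleState a b 0 0 γ) * v (tripleState a b α β 0) := by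
      intro α β γ
      have := mul_eq_of_quadrics (s := singletonStatement c) (v := v)
        (fun f hf => h f (Set.mem_biUnion hcs hf)) (singletonStatement_union c)
        (x := tripleState a b α β γ) (y := tripleState a b 0 0 0) (by simp [singletonStatement])
      rw [this]
      congr 2 <;> refine eq_tripleState hab hac hbc ?_ ?_ ?_ <;>
        simp [Finset.piecewise, singletonStatement, *]
    have hv0 := hv (tripleState a b 0 0 0)
    refine ⟨![v (tripleState a b 0 1 0) / v (tripleState a b 0 0 0),
      v (tripleState a b 1 0 0) / v (tripleState a b 0 0 0),
      v (tripleState a b 1 1 0) / v (tripleState a b 0 0 0),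
      v (tripleState a b 0 0 1) / v (tripleState a b 0 0 0)],
      v (tripleState a b 0 0 0), hv0, ?_⟩
    funext j
    obtain ⟨α, hα⟩ : ∃ α, j a = α := ⟨_, rfl⟩
    obtain ⟨β, hβ⟩ : ∃ β, j b = β := ⟨_, rfl⟩
    obtain ⟨γ, hγ⟩ : ∃ γ, j c = γ := ⟨_, rfl⟩
    have hm := hmul α β γ
    rw [edgeParam, hα, hβ, hγ, eq_tripleState hab hac hbc hα hβ hγ]
    refine mul_right_cancel₀ hv0 (hm.trans ?_)
    fin_cases α <;> fin_cases β <;> fin_cases γ <;> simp <;> field_simp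
    simp
  · rintro ⟨z, t, -, rfl⟩ f hf
    simp only [Set.mem_iUnion] at hf
    obtain ⟨s, hs, hf⟩ := hf
    rcases s.A.eq_empty_or_nonempty with hA | ⟨i, hi⟩
    · exact eval_quadric_eq_zero_of_left_empty s _ hA f hf
    rcases s.B.eq_empty_or_nonempty with hB | ⟨k, hk⟩
    · exact eval_quadric_eq_zero_of_right_empty s _ hB f hf
    have hadj : ∀ i ∈ s.A, ∀ k ∈ s.B, ¬ (G.Adj i k ∨ G.Adj k i) := fun i hi k hk =>
      not_adj_of_mem_globalMarkov hs hi hk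
    have hdis : ∀ i ∈ s.A, i ∉ s.B := fun i hi => Finset.disjoint_left.1 s.disjoint_AB hi
    have hAB : (a ∈ s.A → b ∉ s.B) ∧ (b ∈ s.A → a ∉ s.B) :=
      ⟨fun h h' => hadj a h b h' h1, fun h h' => hadj b h a h' h1.symm⟩
    by_cases hcA : c ∈ s.A
    · refine eval_quadric_eq_zero s _ {c} (fun l hl => ?_) ?_ (fun x y _ => ?_) f hf
      · rw [Finset.mem_singleton]
        have hkc : k ≠ c := fun h => hdis c hcA (h ▸ hk)
        rcases eq_or_eq_or_eq hab hac hbc l with rfl | rfl | rfl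
        · rcases eq_or_eq_or_eq hab hac hbc k with rfl | rfl | rfl
          · exact absurd hk (hdis _ hl)
          · exact absurd hk (hAB.1 hl)
          · exact absurd rfl hkc
        · rcases eq_or_eq_or_eq hab hac hbc k with rfl | rfl | rfl
          · exact absurd hk (hAB.2 hl)
          · exact absurd hk (hdis _ hl)
          · exact absurd rfl hkc
        · rfl
      · rw [Finset.disjoint_singleton_left]
        exact hdis c hcA
      · simp only [edgeParam, Finset.piecewise_singleton, Function.update_self,
          Function.update_of_ne hac, Function.update_of_ne hbc, map_mul]
        ring
    -- Otherwise the two nonempty disjoint sides would separate the adjacent vertices `a` and `b`.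
    · have hcB : c ∈ s.B := by
        by_contra hcB
        rcases eq_or_eq_or_eq hab hac hbc i with rfl | rfl | rfl
        · rcases eq_or_eq_or_eq hab hac hbc k with rfl | rfl | rfl
          · exact hdis _ hi hk
          · exact hAB.1 hi hk
          · exact hcB hk
        · rcases eq_or_eq_or_eq hab hac hbc k with rfl | rfl | rfl
          · exact hAB.2 hi hk
          · exact hdis _ hi hk
          · exact hcB hk
        · exact hcA hi
      refine eval_quadric_eq_zero s _ {c}ᶜ (fun l hl => ?_) ?_ (fun x y _ => ?_) f hf
      · rw [Finset.mem_compl, Finset.mem_singleton]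
        rintro rfl
        exact hcA hl
      · rw [disjoint_compl_left_iff]
        intro l hl
        rw [Finset.mem_singleton]
        rcases eq_or_eq_or_eq hab hac hbc l with rfl | rfl | rfl
        · rcases eq_or_eq_or_eq hab hac hbc i with rfl | rfl | rfl
          · exact absurd hl (hdis _ hi)
          · exact absurd hl (hAB.2 hi)
          · exact absurd hi hcA
        · rcases eq_or_eq_or_eq hab hac hbc i with rfl | rfl | rfl
          · exact absurd hl (hAB.1 hi)
          · exact absurd hl (hdis _ hi)
          · exact absurd hi hcA
        · rfl
      · simp only [edgeParam, Finset.piecewise_compl, Finset.piecewise_singleton,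
          Function.update_self, Function.update_of_ne hac, Function.update_of_ne hbc, map_mul]
        ring

/-! #### Two edges -/

/-- The statement that `a` and `b` are independent given `C`. -/
def pairStatement (hab : a ≠ b) (C : Finset (Fin 3)) (haC : a ∉ C) (hbC : b ∉ C) :
    CIStatement 3 where
  A := {a}
  B := {b}
  C := C
  disjoint_AB := Finset.disjoint_singleton.2 hab
  disjoint_AC := Finset.disjoint_singleton_left.2 haC
  disjoint_BC := Finset.disjoint_singleton_left.2 hbC

theorem path_eq (hab : a ≠ b) (hac : a ≠ c) (hbc : b ≠ c) (h : ¬ (G.Adj a b ∨ G.Adj b a))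
    {l : List (Fin 3)} (hl : IsPath G a b l) : l = [a, c, b] := by
  obtain ⟨h1, h2, h3, h4⟩ := hl
  match l, h1, h2, h3, h4 with
  | [], _, _, h3, _ => simp at h3
  | [x], _, _, h3, h4 =>
    simp at h3 h4
    exact absurd (h3.symm.trans h4) hab
  | [x, y], _, h2, h3, h4 =>
    simp at h3 h4
    subst h3 h4
    exact absurd (by simpa using h2) h
  | [x, y, w], h1, _, h3, h4 =>
    simp at h3 h4
    subst h3 h4
    simp at h1
    rcases eq_or_eq_or_eq hab hac hbc y with rfl | rfl | rfl
    · exact absurd rfl h1.1.1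
    · exact absurd rfl h1.2
    · rfl
  | x :: y :: w :: u :: l, h1, _, _, _ =>
    have := h1.length_le_card
    simp at this
    omega

theorem pairStatement_mem (hab : a ≠ b) (hac : a ≠ c) (hbc : b ≠ c)
    (h : ¬ (G.Adj a b ∨ G.Adj b a)) (C : Finset (Fin 3)) (haC : a ∉ C) (hbC : b ∉ C)
    (hC : IsBlocked G C [a, c, b]) : pairStatement hab C haC hbC ∈ globalMarkov G := by
  intro i hi k hk l hl
  obtain rfl : i = a := by simpa [pairStatement] using hi
  obtain rfl : k = b := by simpa [pairStatement] using hk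
  rw [path_eq hab hac hbc h hl]
  exact hC

/-- The separation statements in a network in which `a` and `b` are joined to `c` but not to each
other. -/
theorem two_edges_cases (hab : a ≠ b) (hac : a ≠ c) (hbc : b ≠ c)
    (h1 : G.Adj a c ∨ G.Adj c a) (h2 : G.Adj b c ∨ G.Adj c b) {s : CIStatement 3}
    (hs : s ∈ globalMarkov G) (hA : s.A.Nonempty) (hB : s.B.Nonempty) :
    ((s.A = {a} ∧ s.B = {b}) ∨ (s.A = {b} ∧ s.B = {a})) ∧
      ((c ∈ s.C ∧ ¬ (G.Adj a c ∧ G.Adj b c)) ∨ ((G.Adj a c ∧ G.Adj b c) ∧ c ∉ s.C)) := by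
  have hadj : ∀ i ∈ s.A, ∀ k ∈ s.B, ¬ (G.Adj i k ∨ G.Adj k i) := fun i hi k hk =>
    not_adj_of_mem_globalMarkov hs hi hk
  have hdis : ∀ i ∈ s.A, i ∉ s.B := fun i hi => Finset.disjoint_left.1 s.disjoint_AB hi
  have hcA : c ∉ s.A := by
    intro hc
    obtain ⟨k, hk⟩ := hB
    rcases eq_or_eq_or_eq hab hac hbc k with rfl | rfl | rfl
    · exact hadj _ hc _ hk h1.symm
    · exact hadj _ hc _ hk h2.symm
    · exact hdis _ hc hk
  have hcB : c ∉ s.B := by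
    intro hc
    obtain ⟨k, hk⟩ := hA
    rcases eq_or_eq_or_eq hab hac hbc k with rfl | rfl | rfl
    · exact hadj _ hk _ hc h1
    · exact hadj _ hk _ hc h2
    · exact hcA hk
  have hsub : ∀ {S : Finset (Fin 3)} {i k : Fin 3}, i ∈ S → k ∉ S → c ∉ S →
      (∀ l, l = i ∨ l = k ∨ l = c) → S = {i} := by
    intro S i k hi hk hc hl
    refine Finset.eq_singleton_iff_unique_mem.2 ⟨hi, fun l hlS => ?_⟩
    rcases hl l with rfl | rfl | rfl
    · rfl
    · exact absurd hlS hk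
    · exact absurd hlS hc
  obtain ⟨i, hi⟩ := hA
  obtain ⟨k, hk⟩ := hB
  have hl := eq_or_eq_or_eq hab hac hbc
  have hl' := eq_or_eq_or_eq hab.symm hbc hac
  have hdis' : ∀ i ∈ s.B, i ∉ s.A := fun i hi hi' => hdis i hi' hi
  rcases hl i with rfl | rfl | rfl
  · rcases hl k with rfl | rfl | rfl
    · exact absurd hk (hdis _ hi)
    · exact ⟨Or.inl ⟨hsub hi (hdis' _ hk) hcA hl, hsub hk (hdis _ hi) hcB hl'⟩,
        isBlocked_triple_of_mem hs hi hk hac hbc h1 h2⟩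
    · exact absurd hk hcB
  · rcases hl k with rfl | rfl | rfl
    · refine ⟨Or.inr ⟨hsub hi (hdis' _ hk) hcA hl', hsub hk (hdis _ hi) hcB hl⟩, ?_⟩
      rw [and_comm (a := G.Adj k c)]
      exact isBlocked_triple_of_mem hs hi hk hbc hac h2 h1
    · exact absurd hk (hdis _ hi)
    · exact absurd hk hcB
  · exact absurd hi hcA

/-- The parametrization of the distributions for which the first two vertices are independent given
the third one. -/
noncomputable def forkParam (a b c : Fin 3) (j : State 3) : MvPolynomial (Fin 5) ℂ :=
  (if j c = 0 then 1 else X 4) * (if j a = 0 then 1 else if j c = 0 then X 0 else X 1) *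
    if j b = 0 then 1 else if j c = 0 then X 2 else X 3

/-- For each value of `c` the conditional `2 × 2` table of `a` and `b` has rank one. All nontrivial
separation statements have sides `{a}` and `{b}` and condition on `c`, as `c` is not a collider. -/
theorem isModelParam_fork (hab : a ≠ b) (hac : a ≠ c) (hbc : b ≠ c)
    (h1 : G.Adj a c ∨ G.Adj c a) (h2 : G.Adj b c ∨ G.Adj c b)
    (h3 : ¬ (G.Adj a b ∨ G.Adj b a)) (h4 : ¬ (G.Adj a c ∧ G.Adj b c)) :
    IsModelParam (globalMarkov G) (forkParam a b c) := by
  have hcs : pairStatement hab {c} (by simpa using hac) (by simpa using hbc) ∈ globalMarkov G :=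
    pairStatement_mem hab hac hbc h3 _ _ _
      ⟨a, c, b, List.infix_rfl, Or.inl ⟨Finset.mem_singleton_self c, h4⟩⟩
  refine ⟨⟨1, fun j => ⟨1, one_pos, ?_⟩⟩, fun l => ?_, fun v hv _ => ⟨fun h => ?_, ?_⟩⟩
  · rw [forkParam]
    split_ifs <;> simp
  · fin_cases l
    · exact ⟨_, Or.inl ⟨tripleState a b 0 0 0, rfl⟩,
        exists_linear_of_mul_eq (j := tripleState a b 1 0 0) (by simp [forkParam, *])⟩
    · exact ⟨_, Or.inl ⟨tripleState a b 0 0 1, rfl⟩,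
        exists_linear_of_mul_eq (j := tripleState a b 1 0 1) (by simp [forkParam, *, mul_comm])⟩
    · exact ⟨_, Or.inl ⟨tripleState a b 0 0 0, rfl⟩,
        exists_linear_of_mul_eq (j := tripleState a b 0 1 0) (by simp [forkParam, *])⟩
    · exact ⟨_, Or.inl ⟨tripleState a b 0 0 1, rfl⟩,
        exists_linear_of_mul_eq (j := tripleState a b 0 1 1) (by simp [forkParam, *, mul_comm])⟩
    · exact ⟨_, Or.inl ⟨tripleState a b 0 0 0, rfl⟩,
        exists_linear_of_mul_eq (j := tripleState a b 0 0 1) (by simp [forkParam, *])⟩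
  · have hmul : ∀ α β γ, v (tripleState a b α β γ) * v (tripleState a b 0 0 γ) =
        v (tripleState a b α 0 γ) * v (tripleState a b 0 β γ) := by
      intro α β γ
      have := mul_eq_of_quadrics (v := v)
        (fun f hf => h f (Set.mem_biUnion hcs hf)) (by
          ext i
          have := eq_or_eq_or_eq hab hac hbc i
          simpa [pairStatement] using this)
        (x := tripleState a b α β γ) (y := tripleState a b 0 0 γ) (by simp [pairStatement, *])
      rw [this]
      congr 2 <;> refine eq_tripleState hab hac hbc ?_ ?_ ?_ <;>
        simp [Finset.piecewise, pairStatement, *, hab.symm, hac.symm]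
    have hv0 := hv (tripleState a b 0 0 0)
    have hv1 := hv (tripleState a b 0 0 1)
    -- Each of the two tables is normalized by its own corner; the last parameter is the ratio of
    -- the two corners.
    refine ⟨![v (tripleState a b 1 0 0) / v (tripleState a b 0 0 0),
      v (tripleState a b 1 0 1) / v (tripleState a b 0 0 1),
      v (tripleState a b 0 1 0) / v (tripleState a b 0 0 0),
      v (tripleState a b 0 1 1) / v (tripleState a b 0 0 1),
      v (tripleState a b 0 0 1) / v (tripleState a b 0 0 0)],
      v (tripleState a b 0 0 0), hv0, ?_⟩
    funext j
    obtain ⟨α, hα⟩ : ∃ α, j a = α := ⟨_, rfl⟩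
    obtain ⟨β, hβ⟩ : ∃ β, j b = β := ⟨_, rfl⟩
    obtain ⟨γ, hγ⟩ : ∃ γ, j c = γ := ⟨_, rfl⟩
    have hm := hmul α β γ
    rw [forkParam, hα, hβ, hγ, eq_tripleState hab hac hbc hα hβ hγ]
    refine mul_right_cancel₀ (hv (tripleState a b 0 0 γ)) (hm.trans ?_)
    fin_cases α <;> fin_cases β <;> fin_cases γ <;> simp <;> field_simp <;> simp
  · rintro ⟨z, t, -, rfl⟩ f hf
    simp only [Set.mem_iUnion] at hf
    obtain ⟨s, hs, hf⟩ := hf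
    rcases s.A.eq_empty_or_nonempty with hA | hA
    · exact eval_quadric_eq_zero_of_left_empty s _ hA f hf
    rcases s.B.eq_empty_or_nonempty with hB | hB
    · exact eval_quadric_eq_zero_of_right_empty s _ hB f hf
    obtain ⟨hAB, hC⟩ := two_edges_cases hab hac hbc h1 h2 hs hA hB
    have hcC : c ∈ s.C := (hC.resolve_right fun h => h4 h.1).1
    refine eval_quadric_eq_zero s _ s.A subset_rfl s.disjoint_AB (fun x y hxy => ?_) f hf
    have hc := hxy c hcC
    rcases hAB with ⟨hA, -⟩ | ⟨hA, -⟩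
    · simp only [hA, forkParam, Finset.piecewise_singleton, Function.update_self,
        Function.update_of_ne hab.symm, Function.update_of_ne hac.symm, map_mul, hc]
      ring
    · simp only [hA, forkParam, Finset.piecewise_singleton, Function.update_self,
        Function.update_of_ne hab, Function.update_of_ne hbc.symm, map_mul, hc]
      ring

/-- The parametrization of the distributions for which the first two vertices are independent. -/
noncomputable def colliderParam (a b c : Fin 3) (j : State 3) : MvPolynomial (Fin 6) ℂ :=
  if j c = 0 then
    (if j a = 0 then (if j b = 0 then X 0 else X 1) else (if j b = 0 then X 2 else X 3))
  else (if j a = 0 then X 4 else 1 - X 4) * (if j b = 0 then X 5 else 1 - X 5) -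
    (if j a = 0 then (if j b = 0 then X 0 else X 1) else (if j b = 0 then X 2 else X 3))

theorem sum_colliderParam (hab : a ≠ b) (hac : a ≠ c) (hbc : b ≠ c) :
    ∑ j, colliderParam a b c j = 1 := by
  rw [sum_tripleState hab hac hbc]
  simp [colliderParam, Fin.sum_univ_two, *]
  ring

theorem eval_marginal_pair (hab : a ≠ b) (hac : a ≠ c) (hbc : b ≠ c) {S : Finset (Fin 3)}
    (ha : a ∈ S) (hb : b ∈ S) (hc : c ∉ S) (v : State 3 → ℂ) (x : State 3) :
    eval v (marginal S x) = v (tripleState a b (x a) (x b) 0) + v (tripleState a b (x a) (x b) 1) := by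
  have hS : ∀ y : State 3, (∀ i ∈ S, y i = x i) ↔ y a = x a ∧ y b = x b := fun y => by
    refine ⟨fun h => ⟨h a ha, h b hb⟩, fun h i hi => ?_⟩
    rcases eq_or_eq_or_eq hab hac hbc i with rfl | rfl | rfl
    · exact h.1
    · exact h.2
    · exact absurd hi hc
  rw [eval_marginal, Finset.sum_filter]
  simp only [hS]
  rw [sum_tripleState hab hac hbc, Finset.sum_eq_single (x a), Finset.sum_eq_single (x b),
    Fin.sum_univ_two]
  · simp [hab]
  · intro β _ hβ
    simp [hab, hβ]
  · simp
  · intro α _ hα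
    simp [hα]
  · simp

/-- At a collider only the marginal independence of `a` and `b` is imposed. The parameters are the
probabilities of the states with value `0` at `c` and the marginals of `a` and `b`. They are
normalized by the total mass, which is `1` on the family, so each is a linear form over the total.
-/
theorem isModelParam_collider (hab : a ≠ b) (hac : a ≠ c) (hbc : b ≠ c)
    (h1 : G.Adj a c) (h2 : G.Adj b c) (h3 : ¬ (G.Adj a b ∨ G.Adj b a)) :
    IsModelParam (globalMarkov G) (colliderParam a b c) := by
  have hcs : pairStatement hab ∅ (Finset.notMem_empty a) (Finset.notMem_empty b) ∈ globalMarkov G :=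
    pairStatement_mem hab hac hbc h3 _ _ _
      ⟨a, c, b, List.infix_rfl, Or.inr ⟨⟨h1, h2⟩, fun c hc => absurd hc (Finset.notMem_empty c)⟩⟩
  refine ⟨⟨![1 / 8, 1 / 8, 1 / 8, 1 / 8, 1 / 2, 1 / 2], fun j => ⟨1 / 8, by norm_num, ?_⟩⟩,
    fun l => ⟨_, Or.inr rfl, ?_⟩, fun v hv hv' => ⟨fun h => ?_, ?_⟩⟩
  · rw [colliderParam]
    split_ifs <;> simp <;> norm_num
  · rw [sum_colliderParam hab hac hbc]
    fin_cases l
    · exact exists_linear_of_mul_eq (j := tripleState a b 0 0 0) (by simp [colliderParam, *])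
    · exact exists_linear_of_mul_eq (j := tripleState a b 0 1 0) (by simp [colliderParam, *])
    · exact exists_linear_of_mul_eq (j := tripleState a b 1 0 0) (by simp [colliderParam, *])
    · exact exists_linear_of_mul_eq (j := tripleState a b 1 1 0) (by simp [colliderParam, *])
    · refine ⟨fun j => if j a = 0 then 1 else 0, ?_⟩
      rw [sum_tripleState hab hac hbc]
      simp [colliderParam, Fin.sum_univ_two, *]
      ring
    · refine ⟨fun j => if j b = 0 then 1 else 0, ?_⟩
      rw [sum_tripleState hab hac hbc]
      simp [colliderParam, Fin.sum_univ_two, *]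
      ring
  · have hmul : (v (tripleState a b 0 0 0) + v (tripleState a b 0 0 1)) *
        (v (tripleState a b 1 1 0) + v (tripleState a b 1 1 1)) =
        (v (tripleState a b 0 1 0) + v (tripleState a b 0 1 1)) *
        (v (tripleState a b 1 0 0) + v (tripleState a b 1 0 1)) := by
      have := h _ (Set.mem_biUnion hcs ⟨tripleState a b 0 0 0, tripleState a b 1 1 0,
        by simp [pairStatement], rfl⟩)
      rw [map_sub, map_mul, map_mul] at this
      simp only [eval_marginal_pair hab hac hbc (S := (pairStatement hab ∅ (Finset.notMem_empty a)
        (Finset.notMem_empty b)).A ∪ (pairStatement hab ∅ (Finset.notMem_empty a)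
        (Finset.notMem_empty b)).B ∪ (pairStatement hab ∅ (Finset.notMem_empty a)
        (Finset.notMem_empty b)).C) (by simp [pairStatement]) (by simp [pairStatement])
        (by simp [pairStatement, hac.symm, hbc.symm])] at this
      simp [Finset.piecewise, pairStatement, hab, hab.symm] at this
      linear_combination this
    obtain ⟨T, hT⟩ : ∃ T, T = ∑ j, v j := ⟨_, rfl⟩
    rw [← hT] at hv'
    rw [sum_tripleState hab hac hbc] at hT
    simp only [Fin.sum_univ_two] at hT
    refine ⟨![v (tripleState a b 0 0 0) / T, v (tripleState a b 0 1 0) / T,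
      v (tripleState a b 1 0 0) / T, v (tripleState a b 1 1 0) / T,
      (v (tripleState a b 0 0 0) + v (tripleState a b 0 0 1) + v (tripleState a b 0 1 0) +
        v (tripleState a b 0 1 1)) / T,
      (v (tripleState a b 0 0 0) + v (tripleState a b 0 0 1) + v (tripleState a b 1 0 0) +
        v (tripleState a b 1 0 1)) / T], T, hv', ?_⟩
    funext j
    obtain ⟨α, hα⟩ : ∃ α, j a = α := ⟨_, rfl⟩
    obtain ⟨β, hβ⟩ : ∃ β, j b = β := ⟨_, rfl⟩
    obtain ⟨γ, hγ⟩ : ∃ γ, j c = γ := ⟨_, rfl⟩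
    rw [colliderParam, hα, hβ, hγ, eq_tripleState hab hac hbc hα hβ hγ]
    refine mul_right_cancel₀ hv' ?_
    -- For `γ = 1` the claim amounts to `p_{αβ+} p_{+++} = p_{α++} p_{+β+}`. The difference of the
    -- two sides is the determinant in `hmul`, up to a sign depending on `α` and `β`.
    fin_cases α <;> fin_cases β <;> fin_cases γ <;> simp <;> field_simp <;>
      first
      | exact Or.inl trivial
      | (refine Or.inl ?_; rw [hT]; linear_combination hmul)
      | (refine Or.inl ?_; rw [hT]; linear_combination -hmul)
  · rintro ⟨z, t, -, rfl⟩ f hf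
    simp only [Set.mem_iUnion] at hf
    obtain ⟨s, hs, hf⟩ := hf
    rcases s.A.eq_empty_or_nonempty with hA | hA
    · exact eval_quadric_eq_zero_of_left_empty s _ hA f hf
    rcases s.B.eq_empty_or_nonempty with hB | hB
    · exact eval_quadric_eq_zero_of_right_empty s _ hB f hf
    obtain ⟨hAB, hC⟩ := two_edges_cases hab hac hbc (Or.inl h1) (Or.inl h2) hs hA hB
    have hcC : c ∉ s.C := (hC.resolve_left fun h => h.2 ⟨h1, h2⟩).2
    obtain ⟨x, y, -, rfl⟩ := hf
    have hm : ∀ x, eval (fun j => t * eval z (colliderParam a b c j))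
        (marginal (s.A ∪ s.B ∪ s.C) x) = t * ((if x a = 0 then z 4 else 1 - z 4) *
          if x b = 0 then z 5 else 1 - z 5) := by
      intro x
      rw [eval_marginal_pair hab hac hbc
        (by rcases hAB with ⟨h, h'⟩ | ⟨h, h'⟩ <;> simp [h, h'])
        (by rcases hAB with ⟨h, h'⟩ | ⟨h, h'⟩ <;> simp [h, h'])
        (by rcases hAB with ⟨h, h'⟩ | ⟨h, h'⟩ <;> simp [h, h', hcC, hac.symm, hbc.symm])]
      simp only [colliderParam, tripleState_left, tripleState_middle hab,
        tripleState_right hac hbc, one_ne_zero, if_true, if_false, map_sub, map_mul]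
      have e1 : eval z (if x a = 0 then X 4 else 1 - X 4) = if x a = 0 then z 4 else 1 - z 4 := by
        split_ifs <;> simp
      have e2 : eval z (if x b = 0 then X 5 else 1 - X 5) = if x b = 0 then z 5 else 1 - z 5 := by
        split_ifs <;> simp
      rw [e1, e2]
      ring
    rw [map_sub, map_mul, map_mul, hm, hm, hm, hm]
    rcases hAB with ⟨hA, -⟩ | ⟨hA, -⟩
    · simp only [hA, Finset.piecewise_singleton, Function.update_self,
        Function.update_of_ne hab.symm]
      ring
    · simp only [hA, Finset.piecewise_singleton, Function.update_self,
        Function.update_of_ne hab]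
      ring

end three

/-! ### Choice of the parametrization and conclusion -/

theorem exists_generic_dim {n m : ℕ} {G : Digraph (Fin n)}
    {π : State n → MvPolynomial (Fin m) ℂ} (h : IsModelParam (globalMarkov G) π) (hn : n ≠ 1)
    (hnm : n ≤ m) (hedge : (∃ u v, G.Adj u v) → n < m) :
    ∃ F : MvPolynomial (Fin n × State n) ℝ, F ≠ 0 ∧
      ∀ X : Fin n → State n → ℝ, MvPolynomial.eval (fun q => X q.1 q.2) F ≠ 0 →
        ∃ d : ℕ, HasDim (ciModel (globalMarkov G)) (d + n) ∧
          HasDim (spohnCIVariety X (globalMarkov G)) d ∧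
          ((∃ u v, G.Adj u v) → 0 < d ∧ IsIrreducible (spohnCIVariety X (globalMarkov G))) := by
  obtain ⟨F, hF, hX⟩ := h.generic hn hnm
  refine ⟨F, hF, fun X hXF => ⟨m - n, ?_, (hX X hXF).2.1, fun he =>
    ⟨Nat.sub_pos_of_lt (hedge he), (hX X hXF).2.2 (hedge he)⟩⟩⟩
  rw [Nat.sub_add_cancel hnm]
  exact (hX X hXF).1

theorem card_state_ne_zero (n : ℕ) : Fintype.card {j : State n // j ≠ 0} = 2 ^ n - 1 := by
  rw [Fintype.card_subtype_compl, Fintype.card_subtype_eq]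
  simp

theorem IsAcyclic.ne {n : ℕ} {G : Digraph (Fin n)} (hG : IsAcyclic G) {u v : Fin n}
    (h : G.Adj u v) : u ≠ v := by
  rintro rfl
  exact hG u (Relation.TransGen.single h)

/-- The graph is edgeless (`m = n`), or complete (`m = 2 ^ n - 1`), or has three vertices and a
non-adjacent pair `a, b`. In the last case the edges at the third vertex decide: both present gives
a collider (`6`) or not (`5`), exactly one gives an isolated vertex (`4`). -/
theorem exists_param {n : ℕ} (hn : n ≤ 3) (hn1 : n ≠ 1) (G : Digraph (Fin n))
    (hG : IsAcyclic G) : ∃ (m : ℕ) (π : State n → MvPolynomial (Fin m) ℂ),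
      IsModelParam (globalMarkov G) π ∧ n ≤ m ∧ ((∃ u v, G.Adj u v) → n < m) := by
  by_cases hempty : ∃ u v, G.Adj u v
  swap
  · exact ⟨n, _, isModelParam_product fun u v _ h => hempty ⟨u, v, h⟩, le_rfl,
      fun h => absurd h hempty⟩
  by_cases hcomplete : ∀ u v, u ≠ v → G.Adj u v ∨ G.Adj v u
  · have h2 : 2 ≤ n := by
      obtain ⟨u, v, huv⟩ := hempty
      have h1 := hG.ne huv
      have h3 : u.val ≠ v.val := fun h => h1 (Fin.ext h)
      omega
    have hlt : n < Fintype.card {j : State n // j ≠ 0} := by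
      rw [card_state_ne_zero]
      interval_cases n <;> norm_num
    exact ⟨_, _, isModelParam_saturated hcomplete, hlt.le, fun _ => hlt⟩
  · push Not at hcomplete
    obtain ⟨a, b, hab, h1, h2⟩ := hcomplete
    obtain ⟨u, v, huv⟩ := hempty
    -- With at most two vertices, a single edge already makes the graph complete.
    have hn3 : n = 3 := by
      by_contra hne
      have h3 : u.val ≠ v.val := fun h => hG.ne huv (Fin.ext h)
      have h4 : a.val ≠ b.val := fun h => hab (Fin.ext h)
      have hcases : (u = a ∧ v = b) ∨ (u = b ∧ v = a) := by
        simp only [Fin.ext_iff]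
        omega
      rcases hcases with ⟨rfl, rfl⟩ | ⟨rfl, rfl⟩
      · exact h1 huv
      · exact h2 huv
    subst hn3
    have hnab : ¬ (G.Adj a b ∨ G.Adj b a) := not_or.2 ⟨h1, h2⟩
    obtain ⟨c, hac, hbc⟩ : ∃ c : Fin 3, a ≠ c ∧ b ≠ c :=
      (by decide : ∀ a b : Fin 3, ∃ c : Fin 3, a ≠ c ∧ b ≠ c) a b
    by_cases hA : G.Adj a c ∨ G.Adj c a <;> by_cases hB : G.Adj b c ∨ G.Adj c b
    · by_cases hcol : G.Adj a c ∧ G.Adj b c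
      · exact ⟨6, _, isModelParam_collider hab hac hbc hcol.1 hcol.2 hnab, by norm_num,
          fun _ => by norm_num⟩
      · exact ⟨5, _, isModelParam_fork hab hac hbc hA hB hnab hcol, by norm_num,
          fun _ => by norm_num⟩
    · exact ⟨4, _, isModelParam_edge hac hab hbc.symm hA hnab (by rwa [or_comm]), by norm_num,
        fun _ => by norm_num⟩
    · exact ⟨4, _, isModelParam_edge hbc hab.symm hac.symm hB (by rwa [or_comm])
        (by rwa [or_comm]), by norm_num, fun _ => by norm_num⟩
    · exfalso
      have hne := hG.ne huv
      rcases eq_or_eq_or_eq hab hac hbc u with rfl | rfl | rfl <;>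
        rcases eq_or_eq_or_eq hab hac hbc v with rfl | rfl | rfl <;> tauto

end SpohnCI
theorem proposition6p4 (n : ℕ) (hn : n ≤ 3) (hn1 : n ≠ 1)
    (G : Digraph (Fin n)) (hG : SpohnCI.IsAcyclic G) :
    ∃ F : MvPolynomial (Fin n × SpohnCI.State n) ℝ, F ≠ 0 ∧
      ∀ X : Fin n → SpohnCI.State n → ℝ,
        MvPolynomial.eval (fun q => X q.1 q.2) F ≠ 0 →
          ∃ d : ℕ,
            SpohnCI.HasDim (SpohnCI.ciModel (SpohnCI.globalMarkov G)) (d + n) ∧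
            SpohnCI.HasDim (SpohnCI.spohnCIVariety X (SpohnCI.globalMarkov G)) d ∧
            ((∃ u v, G.Adj u v) →
              0 < d ∧ IsIrreducible (SpohnCI.spohnCIVariety X (SpohnCI.globalMarkov G))) := by
  obtain ⟨m, π, h, hnm, hedge⟩ := SpohnCI.exists_param hn hn1 G hG
  exact SpohnCI.exists_generic_dim h hn1 hnm hedge
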